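/- **Notation.** Write $e(x)=e^{2\pi i x}$ and let $\mathbb H$ be the upper half plane, $q=e(\tau)$ and $q^n=e(n\tau)$ for rational $n$. Let $G=\mathrm{Mp}_2(\mathbb Z)$ be the group of pairs $(A,w)$, where $A=\begin{pmatrix}a&b\\c&d\end{pmatrix}\in \mathrm{SL}_2(\mathbb Z)$ and $w$ is a holomorphic square root of $c\tau+d$ on $\mathbb H$, and let $\varepsilon(A,w)=\eta(A\tau)/(\eta(\tau)w(\tau))$ be the character of $G$ given by the Dedekind eta function (the quotient is independent of $\tau$). An integral positive definite lattice $\underline L=(L,\beta)$ of rank $n$ is a free $\mathbb Z$-module $L$ of rank $n$ with a symmetric positive definite bilinear form $\beta:L\times L\to\mathbb Z$; put $\beta(x)=\frac12\beta(x,x)$ and extend $\beta$ bilinearly to $\mathbb Q\otimes L$ and $\mathbb C\otimes L$. Its dual is $L^\#=\{r\in\mathbb Q\otimes L:\beta(r,L)\subseteq\mathbb Z\}$, its shadow is $L^\bullet=\{r\in\mathbb Q\otimes L:\beta(r,x)\equiv\beta(x)\bmod\mathbb Z\ \text{for all } x\in L\}$, and its associated bilinear module is the finite abelian group $L^\#/L$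 with the bilinear form $(x+L,y+L)\mapsto\beta(x,y)+\mathbb Z\in\mathbb Q/\mathbb Z$. For $k\in\frac12\mathbb Z$ and $h\in\mathbb Z$ let $J_{k,\underline L}(\varepsilon^h)$ be the space of holomorphic functions $\phi(\tau,z)$ on $\mathbb H\times(\mathbb C\otimes L)$ such that 1. $\phi\big(A\tau,\tfrac{z}{c\tau+d}\big)\,e\big(\tfrac{-c\beta(z)}{c\tau+d}\big)\,w(\tau)^{-2k}=\varepsilon(\alpha)^h\phi(\tau,z)$ for all $\alpha=(A,w)\in G$; 2. $\phi(\tau,z+x\tau+y)\,e(\tau\beta(x)+\beta(x,z))=e(\beta(x+y))\,\phi(\tau,z)$ for all $x,y\in L$; 3. $\phi$ has an absolutely convergent Fourier expansion $\phi(\tau,z)=\sum c(n,r)\,q^n e(\beta(z,r))$, the sum being over all $n\in\frac h{24}+\mathbb Z$ and $r\in L^\bullet$ with $n\ge\beta(r)$. Let $W(\underline L)$ be the space of functions $\lambda:L^\bullet\to\mathbb C$ with $\lambda(r+x)=e(\beta(x))\lambda(r)$ for $r\in L^\bullet$ and $x\in L$, and for $\lambda\in W(\underline L)$ put $\vartheta_{\underline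 L,\lambda}(\tau,z)=\sum_{r\in L^\bullet}\lambda(r)\,q^{\beta(r)}e(\beta(r,z))$. **Theorem.** Let $\underline L_1$ and $\underline L_2$ be integral positive definite lattices of ranks $n_1$ and $n_2$ whose associated bilinear modules are isomorphic. Then for every $k\in\frac12\mathbb Z$ and every $h\in\mathbb Z$ there is a natural isomorphism of complex vector spaces $$J_{k+\frac{n_1}2,\underline L_1}\big(\varepsilon^{h+3n_1}\big)\;\cong\;J_{k+\frac{n_2}2,\underline L_2}\big(\varepsilon^{h+3n_2}\big).$$ Here "natural" means the following. For every isomorphism $\sigma:L_1^\#/L_1\to L_2^\#/L_2$ of bilinear modules there is a linear isomorphism $T:W(\underline L_1)\to W(\underline L_2)$, independent of $k$ and $h$, such that * $T$ lies over $\sigma$: there are maps $s:L_1^\bullet\to L_2^\bullet$ and $u:L_1^\bullet\to\{\pm1\}$ such that $s(r+x)-s(r)\in L_2^\#$ represents $\sigma(x+L_1)$ for all $r\in L_1^\bullet$ and $x\in L_1^\#$, and $(T\lambda)(s(r))=u(r)\lambda(r)$ for all $\lambda\in W(\underline L_1)$ and $r\in L_1^\bullet$; * for all $k$ and $h$, each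 $\phi\in J_{k+n_1/2,\underline L_1}(\varepsilon^{h+3n_1})$ is a finite sum $\sum_i f_i(\tau)\,\vartheta_{\underline L_1,\lambda_i}(\tau,z)$ with holomorphic functions $f_i$ on $\mathbb H$ and $\lambda_i\in W(\underline L_1)$, and the isomorphism above sends $\phi$ to $\sum_i f_i(\tau)\,\vartheta_{\underline L_2,T\lambda_i}(\tau,z)$, for every way of writing $\phi$ as such a sum, with arbitrary functions $f_i:\mathbb H\to\mathbb C$. -/

import Mathlib

open scoped TensorProduct UpperHalfPlane MatrixGroups Manifold

noncomputable section

namespace JacobiLattice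

/-- `e(x) = exp(2πix)`. -/
def e (x : ℂ) : ℂ := Complex.exp (2 * Real.pi * Complex.I * x)

/-- `cτ + d`, where `(c, d)` is the second row of `A`. -/
def autFactor (A : SL(2, ℤ)) (τ : ℍ) : ℂ :=
  ((A.1 1 0 : ℤ) : ℂ) * (τ : ℂ) + ((A.1 1 1 : ℤ) : ℂ)

/-- Elements `(A, w)` of the metaplectic cover of `SL(2, ℤ)`: `w` is a holomorphic square root of
`cτ + d` on the upper half plane. (Only the elements, not the group law, are used below.) -/
structure Metaplectic where
  A : SL(2, ℤ)
  w : ℍ → ℂ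
  holo : MDifferentiable 𝓘(ℂ) 𝓘(ℂ) w
  sq : ∀ τ, w τ ^ 2 = autFactor A τ

/-- The character `ε(A, w) = η(Aτ) / (η(τ) w(τ))` of the metaplectic group. The quotient does not
depend on `τ`, so it is evaluated at `τ = i`. -/
def epsilon (α : Metaplectic) : ℂ :=
  ModularForm.eta ((α.A • UpperHalfPlane.I : ℍ) : ℂ) /
    (ModularForm.eta ((UpperHalfPlane.I : ℍ) : ℂ) * α.w UpperHalfPlane.I)

/-- A positive definite, symmetric, integer valued bilinear form on `L`. For `L` free of finite
rank this is an integral positive definite lattice `(L, β)`. -/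
structure PosDefLattice (L : Type*) [AddCommGroup L] where
  form : LinearMap.BilinForm ℤ L
  symm : ∀ x y, form x y = form y x
  pos : ∀ x, x ≠ 0 → 0 < form x x

namespace PosDefLattice

variable {L : Type*} [AddCommGroup L] (Λ : PosDefLattice L)

/-- The extension of `β` to `ℚ ⊗ L`. -/
def formQ : LinearMap.BilinForm ℚ (ℚ ⊗[ℤ] L) := Λ.form.baseChange ℚ

/-- The extension of `β` to `ℂ ⊗ L`. -/
def formC : LinearMap.BilinForm ℂ (ℂ ⊗[ℤ] L) := Λ.form.baseChange ℂ

/-- `β(x) = β(x, x) / 2` on `L`. -/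
def quad (x : L) : ℚ := (Λ.form x x : ℚ) / 2

/-- `β(r) = β(r, r) / 2` on `ℚ ⊗ L`. -/
def quadQ (r : ℚ ⊗[ℤ] L) : ℚ := Λ.formQ r r / 2

/-- `β(z) = β(z, z) / 2` on `ℂ ⊗ L`. -/
def quadC (z : ℂ ⊗[ℤ] L) : ℂ := Λ.formC z z / 2

end PosDefLattice

/-- The embedding of `L` into `ℚ ⊗ L`. -/
def inclQ (L : Type*) [AddCommGroup L] : L →+ ℚ ⊗[ℤ] L :=
  (TensorProduct.mk ℤ ℚ L 1).toAddMonoidHom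

/-- The embedding of `ℚ ⊗ L` into `ℂ ⊗ L`. -/
def inclC (L : Type*) [AddCommGroup L] : ℚ ⊗[ℤ] L →ₗ[ℚ] ℂ ⊗[ℤ] L :=
  TensorProduct.AlgebraTensorModule.map (Algebra.linearMap ℚ ℂ) LinearMap.id

namespace PosDefLattice

variable {L : Type*} [AddCommGroup L] (Λ : PosDefLattice L)

/-- The shadow of the lattice: all `r ∈ ℚ ⊗ L` with `β(r, x) ≡ β(x) mod ℤ` for all `x ∈ L`. -/
def shadow : Set (ℚ ⊗[ℤ] L) :=
  {r | ∀ x : L, ∃ m : ℤ, Λ.formQ r (inclQ L x) - Λ.quad x = m}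

/-- The dual lattice: all `r ∈ ℚ ⊗ L` with `β(r, x) ∈ ℤ` for all `x ∈ L`. -/
def dual : AddSubgroup (ℚ ⊗[ℤ] L) where
  carrier := {r | ∀ x : L, ∃ m : ℤ, Λ.formQ r (inclQ L x) = m}
  zero_mem' x := ⟨0, by simp⟩
  add_mem' := by
    intro a b ha hb x
    obtain ⟨m, hm⟩ := ha x
    obtain ⟨k, hk⟩ := hb x
    exact ⟨m + k, by simp [hm, hk]⟩
  neg_mem' := by
    intro a ha x
    obtain ⟨m, hm⟩ := ha x
    exact ⟨-m, by simp [hm]⟩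

/-- The finite abelian group `L^# / L`. -/
abbrev Disc : Type _ := Λ.dual ⧸ ((inclQ L).range.addSubgroupOf Λ.dual)

/-- The class in `L^# / L` of an element of the dual. -/
def toDisc : Λ.dual →+ Λ.Disc := QuotientAddGroup.mk' _

theorem formQ_symm (r s : ℚ ⊗[ℤ] L) : Λ.formQ r s = Λ.formQ s r :=
  (LinearMap.BilinForm.IsSymm.baseChange ℚ (B₂ := Λ.form) ⟨Λ.symm⟩).eq r s

theorem coe_eq_zero_of_int {q : ℚ} (h : ∃ m : ℤ, q = m) : (q : AddCircle (1 : ℚ)) = 0 := by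
  obtain ⟨m, rfl⟩ := h
  rw [AddCircle.coe_eq_zero_iff]
  exact ⟨m, by simp⟩

/-- `y ↦ β(x, y) + ℤ` on `L^#`, for `x ∈ L^#`. -/
def discFormAux (x : Λ.dual) : Λ.dual →+ AddCircle (1 : ℚ) :=
  (QuotientAddGroup.mk' (AddSubgroup.zmultiples (1 : ℚ))).comp
    ((Λ.formQ (x : ℚ ⊗[ℤ] L)).toAddMonoidHom.comp Λ.dual.subtype)

theorem discFormAux_apply (x y : Λ.dual) :
    Λ.discFormAux x y = ((Λ.formQ (x : ℚ ⊗[ℤ] L) (y : ℚ ⊗[ℤ] L) : ℚ) : AddCircle (1 : ℚ)) := rfl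

theorem discFormAux_right (x y : Λ.dual) (hy : y ∈ (inclQ L).range.addSubgroupOf Λ.dual) :
    Λ.discFormAux x y = 0 := by
  obtain ⟨l, hl⟩ := hy
  rw [discFormAux_apply]
  apply coe_eq_zero_of_int
  obtain ⟨m, hm⟩ := x.2 l
  refine ⟨m, ?_⟩
  rw [← hm]
  exact congrArg (Λ.formQ (x : ℚ ⊗[ℤ] L)) hl.symm

theorem discFormAux_left (x y : Λ.dual) (hx : x ∈ (inclQ L).range.addSubgroupOf Λ.dual) :
    Λ.discFormAux x y = 0 := by
  have h := Λ.discFormAux_right y x hx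
  rw [discFormAux_apply] at h ⊢
  rwa [Λ.formQ_symm]

/-- The form `β'(x + L, y + L) = β(x, y) + ℤ` of the bilinear module `(L^# / L, β')` associated
to the lattice, with values in `ℚ / ℤ`. -/
def discForm : Λ.Disc →+ Λ.Disc →+ AddCircle (1 : ℚ) :=
  QuotientAddGroup.lift _
    { toFun := fun x => QuotientAddGroup.lift _ (Λ.discFormAux x) (Λ.discFormAux_right x)
      map_zero' := by
        ext y
        change Λ.discFormAux 0 y = 0
        simp [discFormAux_apply]
      map_add' := by
        intro a b
        ext y
        change Λ.discFormAux (a + b) y = Λ.discFormAux a y + Λ.discFormAux b y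
        simp [discFormAux_apply] }
    (by
      intro x hx
      ext y
      exact Λ.discFormAux_left x y hx)

theorem discForm_toDisc (x y : Λ.dual) :
    Λ.discForm (Λ.toDisc x) (Λ.toDisc y) =
      ((Λ.formQ (x : ℚ ⊗[ℤ] L) (y : ℚ ⊗[ℤ] L) : ℚ) : AddCircle (1 : ℚ)) := rfl

/-- The space `W` of functions `a` on the shadow with `a(r + x) = e(β(x)) a(r)` for `x ∈ L`. -/
def W : Submodule ℂ (Λ.shadow → ℂ) where
  carrier := {a | ∀ (r r' : Λ.shadow) (x : L), (r' : ℚ ⊗[ℤ] L) = r + inclQ L x →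
    a r' = e (Λ.quad x : ℂ) * a r}
  zero_mem' r r' x _ := by simp
  add_mem' := by
    intro a b ha hb r r' x h
    simp [ha r r' x h, hb r r' x h, mul_add]
  smul_mem' := by
    intro c a ha r r' x h
    simp [ha r r' x h, mul_left_comm]

/-- The theta function `ϑ_a(τ, z) = ∑_r a(r) q^{β(r)} e(β(r, z))`, the sum being over the
shadow. -/
def theta (a : Λ.W) (τ : ℍ) (z : ℂ ⊗[ℤ] L) : ℂ :=
  ∑' r : Λ.shadow,
    a.1 r * e ((Λ.quadQ (r : ℚ ⊗[ℤ] L) : ℂ) * (τ : ℂ)) * e (Λ.formC (inclC L (r : ℚ ⊗[ℤ] L)) z)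

/-- The transformation law under the metaplectic group, for weight `κ / 2` and character `ε^h`. -/
def MetaplecticLaw (κ h : ℤ) (φ : ℍ → ℂ ⊗[ℤ] L → ℂ) : Prop :=
  ∀ (α : Metaplectic) (τ : ℍ) (z : ℂ ⊗[ℤ] L),
    φ (α.A • τ) ((autFactor α.A τ)⁻¹ • z) *
        e (-((α.A.1 1 0 : ℤ) : ℂ) * Λ.quadC z / autFactor α.A τ) * α.w τ ^ (-κ) =
      epsilon α ^ h * φ τ z

/-- The transformation law under `L × L`. -/
def LatticeLaw (φ : ℍ → ℂ ⊗[ℤ] L → ℂ) : Prop :=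
  ∀ (x y : L) (τ : ℍ) (z : ℂ ⊗[ℤ] L),
    φ τ (z + (τ : ℂ) ⊗ₜ[ℤ] x + (1 : ℂ) ⊗ₜ[ℤ] y) *
        e ((τ : ℂ) * (Λ.quad x : ℂ) + Λ.formC ((1 : ℂ) ⊗ₜ[ℤ] x) z) =
      e (Λ.quad (x + y) : ℂ) * φ τ z

/-- The pairs `(n, r)` with `n ∈ h/24 + ℤ`, `r` in the shadow, and `n ≥ β(r)`. -/
def FourierIndex (h : ℤ) : Type _ :=
  {p : ℚ × (ℚ ⊗[ℤ] L) //
    (∃ m : ℤ, p.1 = (h : ℚ) / 24 + m) ∧ p.2 ∈ Λ.shadow ∧ Λ.quadQ p.2 ≤ p.1}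

/-- The Fourier series `∑ c(n, r) q^n e(β(z, r))`, over the pairs `(n, r)` above, represents `φ`. -/
def HasFourier (h : ℤ) (c : Λ.FourierIndex h → ℂ) (φ : ℍ → ℂ ⊗[ℤ] L → ℂ) : Prop :=
  ∀ (τ : ℍ) (z : ℂ ⊗[ℤ] L),
    HasSum (fun p : Λ.FourierIndex h =>
      c p * e ((p.1.1 : ℂ) * (τ : ℂ)) * e (Λ.formC z (inclC L p.1.2))) (φ τ z)

end PosDefLattice

/-- The point of `ℂ ⊗ L` with coordinates `v` with respect to a `ℤ`-basis of `L`. -/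
def ofCoords (L : Type*) [AddCommGroup L] [Module.Free ℤ L] [Module.Finite ℤ L]
    (v : Fin (Module.finrank ℤ L) → ℂ) : ℂ ⊗[ℤ] L :=
  ∑ i, v i ⊗ₜ[ℤ] Module.finBasis ℤ L i

/-- `φ` is holomorphic on `ℍ × (ℂ ⊗ L)`, read in the linear coordinates of `ofCoords`. -/
def IsHolo {L : Type*} [AddCommGroup L] [Module.Free ℤ L] [Module.Finite ℤ L]
    (φ : ℍ → ℂ ⊗[ℤ] L → ℂ) : Prop :=
  DifferentiableOn ℂ
    (fun p : ℂ × (Fin (Module.finrank ℤ L) → ℂ) =>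
      φ (UpperHalfPlane.ofComplex p.1) (ofCoords L p.2))
    {p | 0 < p.1.im}

/-- The space of Jacobi forms of weight `κ / 2`, lattice index `Λ` and character `ε^h`. -/
def JacobiForms {L : Type*} [AddCommGroup L] [Module.Free ℤ L] [Module.Finite ℤ L]
    (κ : ℤ) (Λ : PosDefLattice L) (h : ℤ) : Submodule ℂ (ℍ → ℂ ⊗[ℤ] L → ℂ) where
  carrier := {φ | IsHolo φ ∧ Λ.MetaplecticLaw κ h φ ∧ Λ.LatticeLaw φ ∧ ∃ c, Λ.HasFourier h c φ}
  zero_mem' := by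
    refine ⟨?_, ?_, ?_, 0, ?_⟩
    · exact differentiableOn_const (0 : ℂ)
    · intro α τ z
      simp
    · intro x y τ z
      simp
    · intro τ z
      simp
  add_mem' := by
    rintro φ ψ ⟨h1, h2, h3, c, h4⟩ ⟨g1, g2, g3, d, g4⟩
    refine ⟨h1.add g1, ?_, ?_, c + d, ?_⟩
    · intro α τ z
      simp only [Pi.add_apply]
      linear_combination h2 α τ z + g2 α τ z
    · intro x y τ z
      simp only [Pi.add_apply]
      linear_combination h3 x y τ z + g3 x y τ z
    · intro τ z
      simpa [add_mul] using (h4 τ z).add (g4 τ z)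
  smul_mem' := by
    rintro t φ ⟨h1, h2, h3, c, h4⟩
    refine ⟨h1.const_smul t, ?_, ?_, t • c, ?_⟩
    · intro α τ z
      simp only [Pi.smul_apply, smul_eq_mul]
      linear_combination t * h2 α τ z
    · intro x y τ z
      simp only [Pi.smul_apply, smul_eq_mul]
      linear_combination t * h3 x y τ z
    · intro τ z
      simpa [mul_assoc] using (h4 τ z).mul_left t

section Natural

variable {L₁ L₂ : Type*} [AddCommGroup L₁] [AddCommGroup L₂]
  {Λ₁ : PosDefLattice L₁} {Λ₂ : PosDefLattice L₂}

/-- `T : W(Λ₁) ≃ W(Λ₂)` lies over the isomorphism `σ : L₁^# / L₁ ≃ L₂^# / L₂`: up to signs, `T`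
transports functions along a map `s` of the shadows that is compatible with `σ` in the sense that
`s(r + x) - s(r)` represents `σ(x + L₁)` for `x ∈ L₁^#`. -/
def LiesOver (σ : Λ₁.Disc ≃+ Λ₂.Disc) (T : Λ₁.W ≃ₗ[ℂ] Λ₂.W) : Prop :=
  ∃ (s : Λ₁.shadow → Λ₂.shadow) (u : Λ₁.shadow → ℤˣ),
    (∀ (r r' : Λ₁.shadow) (x : Λ₁.dual), (r' : ℚ ⊗[ℤ] L₁) = r + x →
      ∃ y : Λ₂.dual, (s r' : ℚ ⊗[ℤ] L₂) = s r + y ∧ σ (Λ₁.toDisc x) = Λ₂.toDisc y) ∧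
    ∀ (a : Λ₁.W) (r : Λ₁.shadow), (T a).1 (s r) = ((u r : ℤ) : ℂ) * a.1 r

/-- `φ = ∑ i, f i · ϑ_{a i}`, a theta expansion of `φ`. -/
def IsThetaExpansion {L : Type*} [AddCommGroup L] (Λ : PosDefLattice L) {m : ℕ}
    (f : Fin m → ℍ → ℂ) (a : Fin m → Λ.W) (φ : ℍ → ℂ ⊗[ℤ] L → ℂ) : Prop :=
  ∀ (τ : ℍ) (z : ℂ ⊗[ℤ] L), φ τ z = ∑ i, f i τ * Λ.theta (a i) τ z

/-- The linear isomorphism `Φ` between spaces of functions is the one induced by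
`T : W(Λ₁) ≃ W(Λ₂)` on theta expansions: every `φ` has a theta expansion with holomorphic
coefficients, and `Φ` sends `∑ i, f i · ϑ_{a i}` to `∑ i, f i · ϑ_{T (a i)}`. -/
def InducedByTheta (T : Λ₁.W ≃ₗ[ℂ] Λ₂.W)
    {V₁ : Submodule ℂ (ℍ → ℂ ⊗[ℤ] L₁ → ℂ)} {V₂ : Submodule ℂ (ℍ → ℂ ⊗[ℤ] L₂ → ℂ)}
    (Φ : V₁ ≃ₗ[ℂ] V₂) : Prop :=
  ∀ φ : V₁,
    (∃ (m : ℕ) (f : Fin m → ℍ → ℂ) (a : Fin m → Λ₁.W),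
      (∀ i, MDifferentiable 𝓘(ℂ) 𝓘(ℂ) (f i)) ∧ IsThetaExpansion Λ₁ f a φ.1) ∧
    ∀ (m : ℕ) (f : Fin m → ℍ → ℂ) (a : Fin m → Λ₁.W), IsThetaExpansion Λ₁ f a φ.1 →
      IsThetaExpansion Λ₂ f (fun i => T (a i)) (Φ φ).1

end Natural

end JacobiLattice

end

open scoped TensorProduct UpperHalfPlane MatrixGroups Manifold

noncomputable section

namespace JacobiLattice

/-! The theta decomposition replaces a Jacobi form by its vector F of theta coefficients, a function
on `L^#/L` for each τ, and the conditions on F involve the lattice only through data that the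
bilinear module determines. Fix ρ in the shadow and identify W with the functions b on `L^#/L`, by
letting b correspond to ρ + x ↦ e(β(x)) b(x). In these coordinates τ ↦ τ + 1 acts on theta functions
diagonally by e(β(ρ + x)). By Poisson summation, inversion acts through a constant C > 0 and a
kernel that is e of an expression in β(ρ + x), β(ρ + y) and the bilinear form (`kernel_neg_one`).
The map T is b ↦ b ∘ σ⁻¹, for suitably matched elements of the two shadows.

The isomorphism σ preserves β(x, y) mod ℤ, but in general not β(x) mod ℤ. However, x ↦ β(ρ₁ + x) and
y ↦ β(ρ + y) are quadratic functions with the same polarization, so up to a constant they differ by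
a homomorphism to ℚ/ℤ. Every such homomorphism is β(d, ·) for some d in the dual, and replacing ρ by
ρ + d absorbs it (`exists_shadowCompat`). A single constant c remains.

This constant is computed by a form of Milgram's formula, C · ∑ e(-β(ρ + x)) = e(-n/8), where n is
the rank (`IsInversionConst.mul_gaussSum`). It follows from the relation STS = T⁻¹ST⁻¹, evaluated on
theta functions at one point, together with their linear independence. Absolute values give C₁ = C₂;
then c ≡ (n₂ - n₁)/8 mod ℤ (`ShadowCompat.const_eq`). The shift of the weight by n/2 and of the
character by 3n compensates exactly this: 3n/24 = n/8 in the exponents of q, and the eighth roots of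
unity in the inversion law cancel (`ShadowCompat.isThetaVector`).

Conversely, a vector with the right q-expansions and inversion law yields a Jacobi form. The element
(1, -1) forces κ ≡ h mod 2 unless the form is zero. When the parities agree, division by η^h leaves
an integral weight, so S and T suffice. -/

theorem e_add (x y : ℂ) : e (x + y) = e x * e y := by
  simp only [e, ← Complex.exp_add]; ring_nf

theorem e_zero : e 0 = 1 := by simp [e]

theorem e_ne_zero (x : ℂ) : e x ≠ 0 := Complex.exp_ne_zero _

theorem e_neg (x : ℂ) : e (-x) = (e x)⁻¹ := by
  rw [e, mul_neg, Complex.exp_neg, e]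

theorem e_sub (x y : ℂ) : e (x - y) = e x / e y := by
  rw [sub_eq_add_neg, e_add, e_neg, div_eq_mul_inv]

theorem e_int (m : ℤ) : e m = 1 := by
  rw [e, Complex.exp_eq_one_iff]
  exact ⟨m, by ring⟩

theorem e_add_int (x : ℂ) (m : ℤ) : e (x + m) = e x := by rw [e_add, e_int, mul_one]

theorem e_sum {ι : Type*} (s : Finset ι) (f : ι → ℂ) : e (∑ i ∈ s, f i) = ∏ i ∈ s, e (f i) := by
  simp only [e, Finset.mul_sum, Complex.exp_sum]

theorem e_nat_mul (n : ℕ) (x : ℂ) : e (n * x) = e x ^ n := by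
  rw [e, e, ← Complex.exp_nat_mul]; ring_nf

theorem e_int_mul (n : ℤ) (x : ℂ) : e (n * x) = e x ^ n := by
  rw [e, e, ← Complex.exp_int_mul]; ring_nf

theorem norm_e (x : ℂ) : ‖e x‖ = Real.exp (-2 * Real.pi * x.im) := by
  rw [e, Complex.norm_exp]
  congr 1
  simp

theorem norm_e_ratCast (q : ℚ) : ‖e q‖ = 1 := by
  rw [norm_e]; simp

/-- Congruent rational numbers have the same image under `e`. -/
theorem e_ratCast_congr {p q : ℚ} (h : ∃ m : ℤ, p = q + m) : e p = e q := by
  obtain ⟨m, rfl⟩ := h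
  push_cast
  exact e_add_int _ _

theorem e_eq_one_iff (q : ℚ) : e q = 1 ↔ ∃ m : ℤ, q = m := by
  constructor
  · intro h
    rw [e, Complex.exp_eq_one_iff] at h
    obtain ⟨m, hm⟩ := h
    refine ⟨m, ?_⟩
    have h2 : (2 * Real.pi * Complex.I : ℂ) ≠ 0 := by simp [Real.pi_ne_zero]
    rw [mul_comm (m : ℂ)] at hm
    exact_mod_cast mul_left_cancel₀ h2 hm
  · rintro ⟨m, rfl⟩
    exact_mod_cast e_int m

theorem e_ratCast_eq_iff (p q : ℚ) : e p = e q ↔ ∃ m : ℤ, p = q + m := by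
  constructor
  · intro h
    have h1 : e ((p - q : ℚ) : ℂ) = 1 := by
      push_cast
      rw [e_sub, h, div_self (e_ne_zero _)]
    obtain ⟨m, hm⟩ := (e_eq_one_iff _).1 h1
    exact ⟨m, by rw [← hm]; ring⟩
  · exact e_ratCast_congr

/-! ### Rational and complex points of a lattice -/

theorem inclC_tmul {L : Type*} [AddCommGroup L] (q : ℚ) (x : L) :
    inclC L (q ⊗ₜ[ℤ] x) = (q : ℂ) ⊗ₜ[ℤ] x := by
  simp [inclC]

theorem inclC_inclQ {L : Type*} [AddCommGroup L] (x : L) :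
    inclC L (inclQ L x) = (1 : ℂ) ⊗ₜ[ℤ] x := by
  simp [inclQ, inclC_tmul]

theorem inclC_smul {L : Type*} [AddCommGroup L] (q : ℚ) (r : ℚ ⊗[ℤ] L) :
    inclC L (q • r) = (q : ℂ) • inclC L r := by
  induction r using TensorProduct.induction_on with
  | zero => simp
  | tmul a x => simp [TensorProduct.smul_tmul', inclC_tmul]
  | add a b ha hb => rw [smul_add, map_add, ha, hb, map_add, smul_add]

/-- Every element of `ℚ ⊗ L` has a positive multiple in `L`. -/
theorem exists_nsmul_eq_inclQ {L : Type*} [AddCommGroup L] (r : ℚ ⊗[ℤ] L) :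
    ∃ (N : ℕ) (x : L), 0 < N ∧ (N : ℚ) • r = inclQ L x := by
  induction r using TensorProduct.induction_on with
  | zero => exact ⟨1, 0, one_pos, by simp⟩
  | tmul a x =>
    refine ⟨a.den, a.num • x, a.pos, ?_⟩
    rw [TensorProduct.smul_tmul', smul_eq_mul, Rat.den_mul_eq_num]
    simp [inclQ, TensorProduct.smul_tmul']
  | add a b ha hb =>
    obtain ⟨N, x, hN, hx⟩ := ha
    obtain ⟨M, y, hM, hy⟩ := hb
    refine ⟨N * M, (M : ℤ) • x + (N : ℤ) • y, Nat.mul_pos hN hM, ?_⟩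
    rw [smul_add, map_add, map_zsmul, map_zsmul, ← hx, ← hy]
    push_cast
    rw [mul_comm (N : ℚ), mul_smul, mul_comm (M : ℚ), mul_smul]
    simp [Nat.cast_smul_eq_nsmul]

theorem inclQ_injective {L : Type*} [AddCommGroup L] [Module.Free ℤ L] :
    Function.Injective (inclQ L) := by
  have h := Module.Flat.rTensor_preserves_injective_linearMap (M := L) (Algebra.linearMap ℤ ℚ)
    (by intro a b h; simpa using h)
  intro x y hxy
  have := @h ((1 : ℤ) ⊗ₜ x) ((1 : ℤ) ⊗ₜ y) (by simpa [inclQ] using hxy)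
  simpa using congrArg (TensorProduct.lid ℤ L) this

theorem coe_eq_coe_iff {p q : ℚ} :
    (p : AddCircle (1 : ℚ)) = q ↔ ∃ m : ℤ, p = q + m := by
  rw [← sub_eq_zero, ← AddCircle.coe_sub, AddCircle.coe_eq_zero_iff]
  constructor
  · rintro ⟨m, hm⟩
    exact ⟨m, by rw [zsmul_one] at hm; rw [hm]; ring⟩
  · rintro ⟨m, rfl⟩
    exact ⟨m, by simp⟩

/-! ### The extended forms, the dual, the shadow and the theta terms -/

namespace PosDefLattice

variable {L : Type*} [AddCommGroup L] (Λ : PosDefLattice L)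

theorem formC_symm (z w : ℂ ⊗[ℤ] L) : Λ.formC z w = Λ.formC w z :=
  (LinearMap.BilinForm.IsSymm.baseChange ℂ (B₂ := Λ.form) ⟨Λ.symm⟩).eq z w

theorem formC_inclC (r s : ℚ ⊗[ℤ] L) :
    Λ.formC (inclC L r) (inclC L s) = (Λ.formQ r s : ℂ) := by
  induction r using TensorProduct.induction_on with
  | zero => simp
  | add a b ha hb => simp [ha, hb]
  | tmul a x =>
    induction s using TensorProduct.induction_on with
    | zero => simp
    | add a b ha hb => simp only [map_add, ha, hb, Rat.cast_add]
    | tmul b y => simp [inclC_tmul, formC, formQ, LinearMap.BilinForm.baseChange_tmul]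

theorem formQ_inclQ (x y : L) : Λ.formQ (inclQ L x) (inclQ L y) = Λ.form x y := by
  simp [inclQ, formQ, LinearMap.BilinForm.baseChange_tmul]

theorem quadQ_inclQ (x : L) : Λ.quadQ (inclQ L x) = Λ.quad x := by
  rw [quadQ, formQ_inclQ, quad]

theorem quadQ_add (r s : ℚ ⊗[ℤ] L) :
    Λ.quadQ (r + s) = Λ.quadQ r + Λ.quadQ s + Λ.formQ r s := by
  simp only [quadQ, map_add, LinearMap.add_apply, Λ.formQ_symm s r]
  ring

theorem quadQ_neg (r : ℚ ⊗[ℤ] L) : Λ.quadQ (-r) = Λ.quadQ r := by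
  simp [quadQ]

theorem quadC_add (z w : ℂ ⊗[ℤ] L) :
    Λ.quadC (z + w) = Λ.quadC z + Λ.quadC w + Λ.formC z w := by
  simp only [quadC, map_add, LinearMap.add_apply, Λ.formC_symm w z]
  ring

theorem quadC_smul (t : ℂ) (z : ℂ ⊗[ℤ] L) : Λ.quadC (t • z) = t ^ 2 * Λ.quadC z := by
  simp only [quadC, map_smul, LinearMap.smul_apply, smul_eq_mul]
  ring

theorem quadC_inclC (r : ℚ ⊗[ℤ] L) : Λ.quadC (inclC L r) = (Λ.quadQ r : ℂ) := by
  rw [quadC, formC_inclC, quadQ]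
  push_cast
  rfl

theorem formQ_pos {r : ℚ ⊗[ℤ] L} (hr : r ≠ 0) : 0 < Λ.formQ r r := by
  obtain ⟨N, x, hN, hx⟩ := exists_nsmul_eq_inclQ r
  have hN' : (N : ℚ) ≠ 0 := by positivity
  have hx0 : x ≠ 0 := by
    rintro rfl
    rw [map_zero, smul_eq_zero] at hx
    exact hx.elim hN' hr
  have h1 : Λ.formQ ((N : ℚ) • r) ((N : ℚ) • r) = Λ.form x x := by rw [hx, formQ_inclQ]
  simp only [map_smul, LinearMap.smul_apply, smul_eq_mul] at h1
  have h2 : (0 : ℚ) < Λ.form x x := by exact_mod_cast Λ.pos x hx0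
  rw [← h1] at h2
  exact pos_of_mul_pos_right (pos_of_mul_pos_right h2 (by positivity)) (by positivity)

theorem formQ_nondegenerate : Λ.formQ.Nondegenerate := by
  rw [LinearMap.BilinForm.Nondegenerate, LinearMap.IsRefl.nondegenerate_iff_separatingLeft]
  · intro r hr
    by_contra h
    exact (Λ.formQ_pos h).ne' (hr r)
  · intro r s h
    rw [Λ.formQ_symm, h]

theorem inclQ_mem_dual (x : L) : inclQ L x ∈ Λ.dual := fun y => ⟨_, Λ.formQ_inclQ x y⟩

theorem e_quad_add_self (l : L) : e (Λ.quad l) * e (Λ.quad l) = 1 := by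
  rw [← e_add, ← e_int (Λ.form l l)]
  congr 1
  simp [quad]

/-- This is the purpose of the shadow: the sign character l ↦ e(β(l)) of L becomes a pairing with r,
and can therefore be absorbed into a translation of z. -/
theorem e_formQ_shadow (r : Λ.shadow) (l : L) :
    e (Λ.formQ (r : ℚ ⊗[ℤ] L) (inclQ L l)) = e (Λ.quad l) := by
  obtain ⟨m, hm⟩ := r.2 l
  exact e_ratCast_congr ⟨m, by rw [← hm]; ring⟩

theorem toDisc_eq_iff (x y : Λ.dual) :
    Λ.toDisc x = Λ.toDisc y ↔ ∃ l : L, (y : ℚ ⊗[ℤ] L) = x + inclQ L l := by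
  rw [toDisc, QuotientAddGroup.mk'_eq_mk']
  constructor
  · rintro ⟨z, ⟨l, hl⟩, h⟩
    refine ⟨l, ?_⟩
    rw [← h]
    exact congrArg (fun w => (x : ℚ ⊗[ℤ] L) + w) hl.symm
  · rintro ⟨l, h⟩
    refine ⟨⟨inclQ L l, Λ.inclQ_mem_dual l⟩, ⟨l, rfl⟩, ?_⟩
    ext
    exact h.symm

theorem toDisc_surjective : Function.Surjective Λ.toDisc := QuotientAddGroup.mk'_surjective _

/-- A representative in the dual of a class of the discriminant group. -/
def rep (d : Λ.Disc) : Λ.dual := (Λ.toDisc_surjective d).choose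

theorem toDisc_rep (d : Λ.Disc) : Λ.toDisc (Λ.rep d) = d := (Λ.toDisc_surjective d).choose_spec

/-- `ρ + x`, as an element of the shadow. -/
def shadowAdd (ρ : Λ.shadow) (x : Λ.dual) : Λ.shadow :=
  ⟨ρ + x, fun l => by
    obtain ⟨m, hm⟩ := ρ.2 l
    obtain ⟨k, hk⟩ := x.2 l
    refine ⟨m + k, ?_⟩
    rw [map_add, LinearMap.add_apply, hk]
    push_cast
    rw [← hm]
    ring⟩

/-- The shadow is a coset of the dual. -/
def shadowEquiv (ρ : Λ.shadow) : Λ.dual ≃ Λ.shadow where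
  toFun := Λ.shadowAdd ρ
  invFun r := ⟨r - ρ, fun l => by
    obtain ⟨m, hm⟩ := ρ.2 l
    obtain ⟨k, hk⟩ := r.2 l
    refine ⟨k - m, ?_⟩
    rw [map_sub, LinearMap.sub_apply]
    push_cast
    rw [← hm, ← hk]
    ring⟩
  left_inv x := by ext; simp [shadowAdd]
  right_inv r := by ext; simp [shadowAdd]

/-- `r ↦ -r` on the shadow. -/
def shadowNeg : Λ.shadow ≃ Λ.shadow where
  toFun r := ⟨-r, fun l => by
    obtain ⟨m, hm⟩ := r.2 l
    refine ⟨-m - Λ.form l l, ?_⟩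
    rw [map_neg, LinearMap.neg_apply]
    push_cast
    rw [← hm, quad]
    ring⟩
  invFun r := ⟨-r, fun l => by
    obtain ⟨m, hm⟩ := r.2 l
    refine ⟨-m - Λ.form l l, ?_⟩
    rw [map_neg, LinearMap.neg_apply]
    push_cast
    rw [← hm, quad]
    ring⟩
  left_inv x := by ext; simp
  right_inv r := by ext; simp

/-- `q^{β(r)} e(β(r, z))`. -/
def term (τ : ℂ) (z : ℂ ⊗[ℤ] L) (r : ℚ ⊗[ℤ] L) : ℂ :=
  e ((Λ.quadQ r : ℂ) * τ) * e (Λ.formC (inclC L r) z)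

theorem term_ne_zero (τ : ℂ) (z : ℂ ⊗[ℤ] L) (r : ℚ ⊗[ℤ] L) : Λ.term τ z r ≠ 0 :=
  mul_ne_zero (e_ne_zero _) (e_ne_zero _)

/-- Completing the square: a shift of the summation index by r becomes a shift of z by τr. Coset
sums thereby reduce to sums over a lattice. -/
theorem term_add (τ : ℂ) (z : ℂ ⊗[ℤ] L) (r s : ℚ ⊗[ℤ] L) :
    Λ.term τ z (r + s) = Λ.term τ z r * Λ.term τ (z + τ • inclC L r) s := by
  simp only [term, ← e_add]
  congr 1
  rw [quadQ_add, map_add, map_add, LinearMap.add_apply, map_add (Λ.formC (inclC L s)), map_smul,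
    formC_inclC, Λ.formQ_symm s r]
  push_cast
  simp only [smul_eq_mul]
  ring

theorem term_add_arg (τ : ℂ) (z : ℂ ⊗[ℤ] L) (r s : ℚ ⊗[ℤ] L) :
    Λ.term τ (z + inclC L s) r = Λ.term τ z r * e (Λ.formQ s r) := by
  simp only [term, ← e_add]
  congr 1
  rw [map_add, formC_inclC, Λ.formQ_symm]
  ring

theorem term_neg (τ : ℂ) (z : ℂ ⊗[ℤ] L) (r : ℚ ⊗[ℤ] L) : Λ.term τ z (-r) = Λ.term τ (-z) r := by
  simp only [term, quadQ_neg, map_neg, LinearMap.neg_apply]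

end PosDefLattice

/-- The decomposition of a group into cosets of a subgroup that is the isomorphic image of `B`. -/
theorem bijective_coset_decomposition {A B : Type*} [AddCommGroup A] [AddCommGroup B]
    (S : AddSubgroup A) (p : B →+ A) (hp : Function.Injective p) (hS : ∀ a, a ∈ S ↔ ∃ k, p k = a)
    (g : A ⧸ S → A) (hg : ∀ d, (QuotientAddGroup.mk (g d) : A ⧸ S) = d) :
    Function.Bijective (fun x : (A ⧸ S) × B => g x.1 + p x.2) := by
  have hmk : ∀ k, (QuotientAddGroup.mk (p k) : A ⧸ S) = 0 := fun k =>
    (QuotientAddGroup.eq_zero_iff _).2 ((hS _).2 ⟨k, rfl⟩)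
  constructor
  · rintro ⟨d, k⟩ ⟨d', k'⟩ h
    have h1 := congrArg (fun a => (QuotientAddGroup.mk a : A ⧸ S)) h
    simp only [QuotientAddGroup.mk_add, hmk, hg, add_zero] at h1
    subst h1
    simpa [hp.eq_iff] using h
  · intro a
    have : a - g (QuotientAddGroup.mk a) ∈ S := by
      rw [← QuotientAddGroup.eq_zero_iff, QuotientAddGroup.mk_sub, hg, sub_self]
    obtain ⟨k, hk⟩ := (hS _).1 this
    exact ⟨(QuotientAddGroup.mk a, k), by simp [hk]⟩

namespace PosDefLattice

variable {L : Type*} [AddCommGroup L] (Λ : PosDefLattice L)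

theorem e_quad_add (x y : L) : e (Λ.quad (x + y)) = e (Λ.quad x) * e (Λ.quad y) := by
  rw [← e_add]
  have h : Λ.quad (x + y) = Λ.quad x + Λ.quad y + Λ.form x y := by
    rw [← quadQ_inclQ, map_add, quadQ_add, formQ_inclQ, quadQ_inclQ, quadQ_inclQ]
  rw [h]
  push_cast
  rw [e_add_int]

/-! ### Dual bases, finiteness and characters of the discriminant group -/

section Bases

variable [Module.Free ℤ L] [Module.Finite ℤ L]

/-- The basis of `ℚ ⊗ L` dual to the chosen basis of `L`. -/
def dualBasis : Module.Basis (Fin (Module.finrank ℤ L)) ℚ (ℚ ⊗[ℤ] L) :=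
  Λ.formQ.dualBasis Λ.formQ_nondegenerate ((Module.finBasis ℤ L).baseChange ℚ)

theorem formQ_dualBasis (i j : Fin (Module.finrank ℤ L)) :
    Λ.formQ (Λ.dualBasis i) (inclQ L (Module.finBasis ℤ L j)) = if j = i then 1 else 0 := by
  have := LinearMap.BilinForm.apply_dualBasis_left Λ.formQ_nondegenerate
    ((Module.finBasis ℤ L).baseChange ℚ) i j
  rw [dualBasis, ← this]
  simp [inclQ]

theorem formQ_sum_dualBasis (t : Fin (Module.finrank ℤ L) → ℚ) (j : Fin (Module.finrank ℤ L)) :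
    Λ.formQ (∑ i, t i • Λ.dualBasis i) (inclQ L (Module.finBasis ℤ L j)) = t j := by
  simp [LinearMap.sum_apply, formQ_dualBasis]

theorem eq_sum_dualBasis (r : ℚ ⊗[ℤ] L) :
    r = ∑ i, Λ.formQ r (inclQ L (Module.finBasis ℤ L i)) • Λ.dualBasis i := by
  conv_lhs => rw [← Λ.dualBasis.sum_repr r]
  refine Finset.sum_congr rfl fun i _ => ?_
  congr 1
  conv_rhs => rw [← Λ.dualBasis.sum_repr r]
  rw [formQ_sum_dualBasis]

/-- Integrality conditions on `L` may be checked on a basis. -/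
theorem mem_dual_iff (r : ℚ ⊗[ℤ] L) :
    r ∈ Λ.dual ↔ ∀ i, ∃ m : ℤ, Λ.formQ r (inclQ L (Module.finBasis ℤ L i)) = m := by
  refine ⟨fun h i => h _, fun h x => ?_⟩
  choose m hm using h
  refine ⟨∑ i, (Module.finBasis ℤ L).repr x i * m i, ?_⟩
  conv_lhs => rw [← (Module.finBasis ℤ L).sum_repr x]
  simp only [map_sum, map_zsmul, hm, zsmul_eq_mul, Int.cast_sum, Int.cast_mul]

theorem dualBasis_mem_dual (i : Fin (Module.finrank ℤ L)) : Λ.dualBasis i ∈ Λ.dual := by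
  rw [mem_dual_iff]
  intro j
  exact ⟨if j = i then 1 else 0, by rw [formQ_dualBasis]; split_ifs <;> simp⟩

/-- The coordinates of an element of the dual. -/
def dualCoord (x : Λ.dual) (i : Fin (Module.finrank ℤ L)) : ℤ :=
  (x.2 (Module.finBasis ℤ L i)).choose

theorem dualCoord_spec (x : Λ.dual) (i : Fin (Module.finrank ℤ L)) :
    Λ.formQ (x : ℚ ⊗[ℤ] L) (inclQ L (Module.finBasis ℤ L i)) = Λ.dualCoord x i :=
  (x.2 (Module.finBasis ℤ L i)).choose_spec

theorem dualCoord_injective : Function.Injective Λ.dualCoord := by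
  intro x y h
  ext
  rw [Λ.eq_sum_dualBasis x, Λ.eq_sum_dualBasis y]
  simp only [dualCoord_spec, h]

/-- Since l ↦ e(β(l)) is multiplicative, it suffices to prescribe the pairing on a basis of L, and
the dual basis realises any prescribed values. -/
theorem shadow_nonempty : Nonempty Λ.shadow := by
  refine ⟨⟨∑ i, Λ.quad (Module.finBasis ℤ L i) • Λ.dualBasis i, fun x => ?_⟩⟩
  rw [← e_eq_one_iff]
  push_cast
  rw [e_sub, div_eq_one_iff_eq (e_ne_zero _)]
  refine Submodule.span_induction (p := fun x _ =>
    e (Λ.formQ (∑ i, Λ.quad (Module.finBasis ℤ L i) • Λ.dualBasis i) (inclQ L x)) =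
      e (Λ.quad x)) ?_ ?_ ?_ ?_ ((Module.finBasis ℤ L).mem_span x)
  · rintro _ ⟨i, rfl⟩
    rw [formQ_sum_dualBasis]
  · simp [quad]
  · intro x y _ _ hx hy
    rw [e_quad_add, ← hx, ← hy, ← e_add, map_add, map_add]
    push_cast
    rfl
  · intro c x _ hx
    induction c with
    | zero => simp [quad]
    | succ c ih =>
      rw [add_smul, one_smul, e_quad_add, map_add, map_add, Rat.cast_add, e_add, ih, hx]
    | pred c ih =>
      rw [sub_smul, one_smul, map_sub, map_sub, Rat.cast_sub, e_sub, ih, hx, div_eq_iff (e_ne_zero _),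
        ← e_quad_add, sub_add_cancel]

instance : Module.Finite ℤ Λ.dual := by
  have hadd : ∀ x y, Λ.dualCoord (x + y) = Λ.dualCoord x + Λ.dualCoord y := by
    intro x y
    ext i
    have := Λ.dualCoord_spec (x + y) i
    rw [AddSubgroup.coe_add, map_add, LinearMap.add_apply, dualCoord_spec, dualCoord_spec] at this
    exact_mod_cast this.symm
  have hsmul : ∀ (c : ℤ) x, Λ.dualCoord (c • x) = c • Λ.dualCoord x := by
    intro c x
    ext i
    have := Λ.dualCoord_spec (c • x) i
    rw [AddSubgroup.coe_zsmul, map_zsmul, LinearMap.smul_apply, dualCoord_spec, zsmul_eq_mul] at this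
    simpa using (show (Λ.dualCoord (c • x) i) = c * Λ.dualCoord x i by exact_mod_cast this.symm)
  exact Module.Finite.of_injective
    ({ toFun := Λ.dualCoord, map_add' := hadd, map_smul' := hsmul } :
      Λ.dual →ₗ[ℤ] (Fin (Module.finrank ℤ L) → ℤ)) Λ.dualCoord_injective

/-- The group is finitely generated, and it is torsion because every rational vector has a positive
multiple in L. -/
instance : Finite Λ.Disc := by
  have : Module.Finite ℤ Λ.Disc :=
    Module.Finite.of_surjective Λ.toDisc.toIntLinearMap Λ.toDisc_surjective
  apply Module.finite_of_fg_torsion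
  intro d
  obtain ⟨x, rfl⟩ := Λ.toDisc_surjective d
  obtain ⟨N, l, hN, hl⟩ := exists_nsmul_eq_inclQ (x : ℚ ⊗[ℤ] L)
  refine ⟨⟨(N : ℤ), mem_nonZeroDivisors_of_ne_zero (by exact_mod_cast hN.ne')⟩, ?_⟩
  change (N : ℤ) • Λ.toDisc x = 0
  rw [← map_zsmul, ← map_zero Λ.toDisc, eq_comm, toDisc_eq_iff]
  refine ⟨l, ?_⟩
  rw [← hl]
  simp [Nat.cast_smul_eq_nsmul]

instance : Fintype Λ.Disc := Fintype.ofFinite _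

/-- Every character of the discriminant group is `x ↦ e(β(d, x))` for some `d`. -/
theorem exists_formQ_eq_of_hom (χ : Λ.dual →+ AddCircle (1 : ℚ))
    (hχ : ∀ l, χ ⟨inclQ L l, Λ.inclQ_mem_dual l⟩ = 0) :
    ∃ d : Λ.dual, ∀ x : Λ.dual, χ x = ((Λ.formQ (d : ℚ ⊗[ℤ] L) x : ℚ) : AddCircle (1 : ℚ)) := by
  -- Rational lifts of the values of `χ` on the dual basis are the coordinates of `d`; the vanishing
  -- of `χ` on L is what places `d` in the dual.
  choose t ht using fun i => QuotientAddGroup.mk_surjective (χ ⟨Λ.dualBasis i, Λ.dualBasis_mem_dual i⟩)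
  set d : ℚ ⊗[ℤ] L := ∑ i, t i • inclQ L (Module.finBasis ℤ L i) with hd
  have key : ∀ x : Λ.dual, χ x = ((Λ.formQ d x : ℚ) : AddCircle (1 : ℚ)) := by
    intro x
    have hx : x = ∑ i, Λ.dualCoord x i • (⟨Λ.dualBasis i, Λ.dualBasis_mem_dual i⟩ : Λ.dual) := by
      ext
      rw [AddSubgroup.val_finsetSum]
      conv_lhs => rw [Λ.eq_sum_dualBasis x]
      refine Finset.sum_congr rfl fun i _ => ?_
      rw [dualCoord_spec, AddSubgroup.coe_zsmul, Int.cast_smul_eq_zsmul]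
    conv_lhs => rw [hx]
    rw [map_sum]
    simp only [map_zsmul, ← ht]
    rw [Λ.formQ_symm, hd, map_sum]
    simp only [map_smul, dualCoord_spec]
    change _ = QuotientAddGroup.mk' (AddSubgroup.zmultiples (1 : ℚ)) _
    rw [map_sum]
    refine Finset.sum_congr rfl fun i _ => ?_
    rw [smul_eq_mul, mul_comm, ← zsmul_eq_mul, map_zsmul]
    rfl
  refine ⟨⟨d, fun l => ?_⟩, key⟩
  have h1 := key ⟨inclQ L l, Λ.inclQ_mem_dual l⟩
  rw [hχ, ← AddCircle.coe_zero, eq_comm, coe_eq_coe_iff] at h1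
  simpa using h1

end Bases

end PosDefLattice

/-! ### Poisson summation for a lattice with an orthogonal basis -/

theorem hasSum_mul_of_summable_norm {α β : Type*} {f : α → ℂ} {g : β → ℂ}
    (hf : Summable fun k => ‖f k‖) (hg : Summable fun k => ‖g k‖) :
    HasSum (fun x : α × β => f x.1 * g x.2) ((∑' k, f k) * ∑' k, g k) := by
  rw [tsum_mul_tsum_of_summable_norm hf hg]
  exact (summable_mul_of_summable_norm hf hg).hasSum

/-- A product of absolutely convergent series is a series over the product of the index sets. -/
theorem hasSum_pi_prod {α : Type*} {n : ℕ} (f : Fin n → α → ℂ) (hf : ∀ i, Summable fun k => ‖f i k‖) :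
    Summable (fun k : Fin n → α => ‖∏ i, f i (k i)‖) ∧
      HasSum (fun k : Fin n → α => ∏ i, f i (k i)) (∏ i, ∑' k, f i k) := by
  induction n with
  | zero => exact ⟨.of_finite, by simp⟩
  | succ n ih =>
    obtain ⟨h1, h2⟩ := ih (fun i => f i.succ) fun i => hf i.succ
    have h0 := hf 0
    have hcons : ∀ x : α × (Fin n → α),
        ∏ i, f i (Fin.consEquiv (fun _ : Fin (n + 1) => α) x i) =
          f 0 x.1 * ∏ i : Fin n, f i.succ (x.2 i) := by
      intro x
      rw [Fin.prod_univ_succ]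
      rfl
    constructor
    · rw [← (Fin.consEquiv fun _ : Fin (n + 1) => α).summable_iff]
      refine (h0.mul_of_nonneg h1 (fun _ => norm_nonneg _) (fun _ => norm_nonneg _)).congr fun x => ?_
      rw [Function.comp_apply, hcons, norm_mul]
    · rw [← (Fin.consEquiv fun _ : Fin (n + 1) => α).hasSum_iff, Fin.prod_univ_succ]
      have h3 := hasSum_mul_of_summable_norm h0 h1
      rw [h2.tsum_eq] at h3
      rw [← funext hcons] at h3
      exact h3

/-- The square root of `-iτ` with positive real part. -/
def rootS (τ : ℂ) : ℂ := (-Complex.I * τ) ^ (1 / 2 : ℂ)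

theorem rootS_real_mul {a : ℝ} (ha : 0 < a) (τ : ℂ) : rootS (a * τ) = (√a : ℝ) * rootS τ := by
  rcases eq_or_ne τ 0 with rfl | hτ
  · simp [rootS]
  have h : -Complex.I * τ ≠ 0 := by simp [hτ]
  rw [rootS, rootS, mul_left_comm, Complex.cpow_def_of_ne_zero (mul_ne_zero (by exact_mod_cast ha.ne') h),
    Complex.cpow_def_of_ne_zero h, Complex.log_ofReal_mul ha h, add_mul, Complex.exp_add,
    Real.sqrt_eq_rpow, Real.rpow_def_of_pos ha]
  push_cast
  rfl

namespace PosDefLattice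

variable {L : Type*} [AddCommGroup L] (Λ : PosDefLattice L)

/-- Pairwise orthogonal vectors of `L` that form a basis of `ℚ ⊗ L`. -/
structure OrthoFrame where
  v : Fin (Module.finrank ℤ L) → L
  a : Fin (Module.finrank ℤ L) → ℤ
  a_pos : ∀ i, 0 < a i
  ortho : ∀ i j, Λ.form (v i) (v j) = if i = j then a i else 0
  expand : ∀ r : ℚ ⊗[ℤ] L, r = ∑ i, (Λ.formQ r (inclQ L (v i)) / a i) • inclQ L (v i)

/-- A rational orthogonal basis, rescaled into L. Theta series of the sublattice it spans are
products of Jacobi theta functions of one variable, which reduces Poisson summation to dimension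
one. -/
theorem nonempty_orthoFrame [Module.Free ℤ L] [Module.Finite ℤ L] : Nonempty Λ.OrthoFrame := by
  obtain ⟨u', hu'⟩ := LinearMap.BilinForm.exists_orthogonal_basis (B := Λ.formQ) ⟨Λ.formQ_symm⟩
  have hd : Module.finrank ℚ (ℚ ⊗[ℤ] L) = Module.finrank ℤ L := Module.finrank_baseChange
  obtain ⟨u, hu⟩ : ∃ u : Module.Basis (Fin (Module.finrank ℤ L)) ℚ (ℚ ⊗[ℤ] L),
      ∀ i j, i ≠ j → Λ.formQ (u i) (u j) = 0 := by
    refine ⟨u'.reindex (finCongr hd), fun i j hij => ?_⟩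
    simp only [Module.Basis.reindex_apply]
    exact hu' (by simpa using hij)
  choose N v hN hv using fun i => exists_nsmul_eq_inclQ (u i)
  have hv0 : ∀ i, v i ≠ 0 := by
    intro i h
    have h1 := hv i
    rw [h, map_zero, smul_eq_zero] at h1
    exact h1.elim (by exact_mod_cast (hN i).ne') (u.ne_zero i)
  have ho : ∀ i j, Λ.form (v i) (v j) = if i = j then Λ.form (v i) (v i) else 0 := by
    intro i j
    split_ifs with h
    · rw [h]
    · have h1 := Λ.formQ_inclQ (v i) (v j)
      rw [← hv, ← hv] at h1
      simp only [map_smul, LinearMap.smul_apply, hu i j h, smul_zero] at h1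
      exact_mod_cast h1.symm
  refine ⟨⟨v, fun i => Λ.form (v i) (v i), fun i => Λ.pos _ (hv0 i), ho, fun r => ?_⟩⟩
  have hr : r = ∑ i, (u.repr r i / N i) • inclQ L (v i) := by
    conv_lhs => rw [← u.sum_repr r]
    refine Finset.sum_congr rfl fun i _ => ?_
    rw [← hv, smul_smul, div_mul_cancel₀ _ (by exact_mod_cast (hN i).ne')]
  conv_lhs => rw [hr]
  refine Finset.sum_congr rfl fun i _ => ?_
  congr 1
  have h2 : (Λ.form (v i) (v i) : ℚ) ≠ 0 := by exact_mod_cast (Λ.pos _ (hv0 i)).ne'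
  rw [eq_div_iff h2]
  conv_rhs => rw [hr]
  simp only [map_sum, LinearMap.sum_apply, map_smul, LinearMap.smul_apply, formQ_inclQ]
  rw [Finset.sum_eq_single i]
  · simp
  · intro j _ hj
    rw [ho j i, if_neg hj]
    simp
  · simp

namespace OrthoFrame

variable {Λ} (B : Λ.OrthoFrame)

theorem a_ne_zero (i : Fin (Module.finrank ℤ L)) : (B.a i : ℂ) ≠ 0 := by
  exact_mod_cast ne_of_gt (B.a_pos i)

/-- The coordinates `β(v_i, z)` of a point. -/
def coord (z : ℂ ⊗[ℤ] L) (i : Fin (Module.finrank ℤ L)) : ℂ := Λ.formC (inclC L (inclQ L (B.v i))) z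

theorem expandC (z : ℂ ⊗[ℤ] L) :
    z = ∑ i, (B.coord z i / B.a i) • inclC L (inclQ L (B.v i)) := by
  induction z using TensorProduct.induction_on with
  | zero => simp [coord]
  | add z w hz hw =>
    conv_lhs => rw [hz, hw]
    simp [coord, ← Finset.sum_add_distrib, add_div, add_smul]
  | tmul t x =>
    have h1 : t ⊗ₜ[ℤ] x = t • inclC L (inclQ L x) := by
      simp [inclC_inclQ, TensorProduct.smul_tmul']
    conv_lhs => rw [h1, B.expand (inclQ L x), map_sum, Finset.smul_sum]
    refine Finset.sum_congr rfl fun i _ => ?_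
    rw [inclC_smul, smul_smul, h1, coord, map_smul, formC_inclC, Λ.formQ_symm]
    push_cast
    rw [smul_eq_mul, mul_div_assoc]

theorem quadQ_sum (t : Fin (Module.finrank ℤ L) → ℚ) :
    Λ.quadQ (∑ i, t i • inclQ L (B.v i)) = ∑ i, B.a i * t i ^ 2 / 2 := by
  simp only [quadQ, map_sum, LinearMap.sum_apply, map_smul, LinearMap.smul_apply, formQ_inclQ,
    B.ortho, Finset.sum_div]
  refine Finset.sum_congr rfl fun i _ => ?_
  rw [Finset.sum_eq_single i]
  · simp
    ring
  · intro j _ hj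
    simp [hj]
  · simp

theorem quadC_eq (z : ℂ ⊗[ℤ] L) : Λ.quadC z = ∑ i, B.coord z i ^ 2 / (2 * B.a i) := by
  rw [quadC]
  conv_lhs => rw [B.expandC z]
  simp only [map_sum, LinearMap.sum_apply, map_smul, LinearMap.smul_apply, formC_inclC, formQ_inclQ,
    B.ortho, Finset.sum_div]
  refine Finset.sum_congr rfl fun i _ => ?_
  rw [Finset.sum_eq_single i]
  · simp
    field_simp [B.a_ne_zero i]
  · intro j _ hj
    simp [hj]
  · simp

theorem term_sum (τ : ℂ) (z : ℂ ⊗[ℤ] L) (t : Fin (Module.finrank ℤ L) → ℚ) :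
    Λ.term τ z (∑ i, t i • inclQ L (B.v i)) =
      ∏ i, e (B.a i * t i ^ 2 / 2 * τ + t i * B.coord z i) := by
  rw [term, quadQ_sum, ← e_add, ← e_sum]
  congr 1
  rw [Finset.sum_add_distrib, map_sum, map_sum, LinearMap.sum_apply]
  push_cast
  rw [Finset.sum_mul]
  congr 1
  refine Finset.sum_congr rfl fun i _ => ?_
  rw [inclC_smul, map_smul, LinearMap.smul_apply, coord, smul_eq_mul]

/-- The embedding of `ℤ^n` into `L` given by the frame. -/
def latticeHom : (Fin (Module.finrank ℤ L) → ℤ) →+ L where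
  toFun k := ∑ i, k i • B.v i
  map_zero' := by simp
  map_add' k l := by simp [add_smul, Finset.sum_add_distrib]

theorem inclQ_latticeHom (k : Fin (Module.finrank ℤ L) → ℤ) :
    inclQ L (B.latticeHom k) = ∑ i, (k i : ℚ) • inclQ L (B.v i) := by
  simp [latticeHom, Int.cast_smul_eq_zsmul]

/-- The elements of the dual of the lattice spanned by the frame. -/
def dualPoint (k : Fin (Module.finrank ℤ L) → ℤ) : ℚ ⊗[ℤ] L :=
  ∑ i, ((k i : ℚ) / B.a i) • inclQ L (B.v i)

theorem term_latticeHom (τ : ℂ) (z : ℂ ⊗[ℤ] L) (k : Fin (Module.finrank ℤ L) → ℤ) :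
    Λ.term τ z (inclQ L (B.latticeHom k)) =
      ∏ i, jacobiTheta₂_term (k i) (B.coord z i) (B.a i * τ) := by
  rw [inclQ_latticeHom, term_sum]
  refine Finset.prod_congr rfl fun i _ => ?_
  rw [e, jacobiTheta₂_term]
  congr 1
  push_cast
  ring

theorem term_dualPoint (τ : ℂ) (z : ℂ ⊗[ℤ] L) (k : Fin (Module.finrank ℤ L) → ℤ) :
    Λ.term τ z (B.dualPoint k) =
      ∏ i, jacobiTheta₂_term (k i) (B.coord z i / B.a i) (τ / B.a i) := by
  rw [dualPoint, term_sum]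
  refine Finset.prod_congr rfl fun i _ => ?_
  rw [e, jacobiTheta₂_term]
  congr 1
  push_cast
  field_simp [B.a_ne_zero i]
  ring

theorem im_a_mul_pos (τ : ℍ) (i : Fin (Module.finrank ℤ L)) : 0 < ((B.a i : ℂ) * τ).im := by
  have : (0 : ℝ) < B.a i := by exact_mod_cast B.a_pos i
  rw [← Complex.ofReal_intCast, Complex.im_ofReal_mul]
  exact mul_pos this τ.im_pos

theorem im_div_a_pos {τ : ℂ} (hτ : 0 < τ.im) (i : Fin (Module.finrank ℤ L)) :
    0 < (τ / (B.a i : ℂ)).im := by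
  have : (0 : ℝ) < B.a i := by exact_mod_cast B.a_pos i
  rw [← Complex.ofReal_intCast, Complex.div_ofReal_im]
  exact div_pos hτ this

theorem summable_term_dualPoint {τ : ℂ} (hτ : 0 < τ.im) (z : ℂ ⊗[ℤ] L) :
    Summable fun k => ‖Λ.term τ z (B.dualPoint k)‖ := by
  simp only [term_dualPoint]
  exact (hasSum_pi_prod _ fun i =>
    ((summable_jacobiTheta₂_term_iff _ _).2 (B.im_div_a_pos hτ i)).norm).1

theorem tsum_term_dualPoint {τ : ℂ} (hτ : 0 < τ.im) (z : ℂ ⊗[ℤ] L) :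
    ∑' k, Λ.term τ z (B.dualPoint k) =
      ∏ i, jacobiTheta₂ (B.coord z i / B.a i) (τ / B.a i) := by
  simp only [term_dualPoint]
  exact (hasSum_pi_prod _ fun i =>
    ((summable_jacobiTheta₂_term_iff _ _).2 (B.im_div_a_pos hτ i)).norm).2.tsum_eq

theorem hasSum_term_latticeHom (τ : ℍ) (z : ℂ ⊗[ℤ] L) :
    HasSum (fun k => Λ.term τ z (inclQ L (B.latticeHom k)))
      (∏ i, jacobiTheta₂ (B.coord z i) (B.a i * τ)) := by
  simp only [term_latticeHom]
  exact (hasSum_pi_prod _ fun i =>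
    ((summable_jacobiTheta₂_term_iff _ _).2 (B.im_a_mul_pos τ i)).norm).2

theorem im_neg_one_div_pos (τ : ℍ) : 0 < (-1 / (τ : ℂ)).im := by
  simpa [neg_div, ← neg_inv] using τ.im_inv_neg_coe_pos

/-- Poisson summation for the lattice spanned by the frame. -/
theorem hasSum_term_latticeHom_inversion (τ : ℍ) (z : ℂ ⊗[ℤ] L) :
    HasSum (fun k => Λ.term τ z (inclQ L (B.latticeHom k)))
      (((∏ i, (√(B.a i : ℝ))⁻¹ : ℝ) : ℂ) * (rootS τ ^ Module.finrank ℤ L)⁻¹ *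
        e (-Λ.quadC z / τ) * ∑' k, Λ.term (-1 / τ) ((τ : ℂ)⁻¹ • z) (B.dualPoint k)) := by
  convert B.hasSum_term_latticeHom τ z using 1
  rw [B.tsum_term_dualPoint (im_neg_one_div_pos τ), B.quadC_eq]
  have h1 : ∀ i, jacobiTheta₂ (B.coord z i) (B.a i * τ) =
      (((√(B.a i : ℝ))⁻¹ : ℝ) : ℂ) * (rootS τ)⁻¹ * e (-(B.coord z i ^ 2 / (2 * B.a i)) / τ) *
        jacobiTheta₂ (B.coord ((τ : ℂ)⁻¹ • z) i / B.a i) (-1 / τ / B.a i) := by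
    intro i
    have ha := B.a_ne_zero i
    have hτ := τ.ne_zero
    -- The modular parameter is a i · τ, so the square root in the functional equation is √(a i)
    -- times that of τ.
    rw [jacobiTheta₂_functional_equation]
    congr 1
    · congr 1
      · have h2 := rootS_real_mul (a := B.a i) (by exact_mod_cast B.a_pos i) τ
        rw [rootS] at h2
        push_cast at h2 ⊢
        rw [h2, one_div, mul_inv]
      · rw [e]
        congr 1
        field_simp
    · congr 1
      · rw [coord, coord, map_smul, smul_eq_mul]
        field_simp
      · field_simp
  simp only [h1, Finset.prod_mul_distrib]
  rw [← e_sum]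
  congr 1
  simp [neg_div, Finset.sum_div, Finset.sum_neg_distrib]

end OrthoFrame

end PosDefLattice

/-! ### Poisson summation for an arbitrary lattice -/

namespace PosDefLattice

variable {L : Type*} [AddCommGroup L] {Λ : PosDefLattice L}

namespace OrthoFrame

variable (B : Λ.OrthoFrame)

theorem a_ne_zero_rat (i : Fin (Module.finrank ℤ L)) : (B.a i : ℚ) ≠ 0 := by
  exact_mod_cast ne_of_gt (B.a_pos i)

theorem formQ_dualPoint (k : Fin (Module.finrank ℤ L) → ℤ) (i : Fin (Module.finrank ℤ L)) :
    Λ.formQ (B.dualPoint k) (inclQ L (B.v i)) = k i := by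
  simp only [dualPoint, map_sum, LinearMap.sum_apply, map_smul, LinearMap.smul_apply, formQ_inclQ,
    B.ortho]
  rw [Finset.sum_eq_single i]
  · simp [B.a_ne_zero_rat i]
  · intro j _ hj
    simp [hj]
  · simp

theorem dualPoint_injective : Function.Injective B.dualPoint := by
  intro k l h
  ext i
  have := B.formQ_dualPoint k i
  rw [h, formQ_dualPoint] at this
  exact_mod_cast this.symm

theorem exists_dualPoint_eq (x : Λ.dual) : ∃ k, B.dualPoint k = x := by
  choose k hk using fun i => x.2 (B.v i)
  refine ⟨k, ?_⟩
  rw [B.expand x, dualPoint]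
  simp only [hk]

/-- The dual as a subset of the dual of the lattice spanned by the frame. -/
def dualEquiv : {k // B.dualPoint k ∈ Λ.dual} ≃ Λ.dual :=
  Equiv.ofBijective (fun k => ⟨B.dualPoint k, k.2⟩) <| by
    constructor
    · intro k l h
      exact Subtype.ext (B.dualPoint_injective (congrArg Subtype.val h))
    · intro x
      obtain ⟨k, hk⟩ := B.exists_dualPoint_eq x
      exact ⟨⟨k, hk ▸ x.2⟩, Subtype.ext hk⟩

theorem dualEquiv_apply (k : {k // B.dualPoint k ∈ Λ.dual}) :
    (B.dualEquiv k : ℚ ⊗[ℤ] L) = B.dualPoint k := rfl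

theorem latticeHom_injective : Function.Injective B.latticeHom := by
  intro k l h
  ext i
  have h1 : ∀ k, Λ.form (B.latticeHom k) (B.v i) = k i * B.a i := by
    intro k
    change Λ.form (∑ j, k j • B.v j) (B.v i) = _
    rw [map_sum, LinearMap.sum_apply, Finset.sum_eq_single i]
    · simp [B.ortho]
    · intro j _ hj
      simp [B.ortho, hj]
    · simp
  have h2 := h1 k
  rw [h, h1] at h2
  exact (mul_right_cancel₀ (B.a_pos i).ne' h2).symm

theorem formQ_latticeHom_dualPoint (m k : Fin (Module.finrank ℤ L) → ℤ) :
    Λ.formQ (inclQ L (B.latticeHom m)) (B.dualPoint k) = ((∑ i, m i * k i : ℤ) : ℚ) := by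
  rw [inclQ_latticeHom, map_sum, LinearMap.sum_apply]
  push_cast
  refine Finset.sum_congr rfl fun i _ => ?_
  rw [map_smul, LinearMap.smul_apply, Λ.formQ_symm, formQ_dualPoint, smul_eq_mul]

/-- The decomposition of `L` into cosets of the lattice spanned by the frame. -/
def cosetEquiv : (L ⧸ B.latticeHom.range) × (Fin (Module.finrank ℤ L) → ℤ) ≃ L :=
  Equiv.ofBijective _ (bijective_coset_decomposition B.latticeHom.range B.latticeHom
    B.latticeHom_injective (fun _ => AddMonoidHom.mem_range) Quotient.out QuotientAddGroup.out_eq')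

theorem cosetEquiv_apply (p : (L ⧸ B.latticeHom.range) × (Fin (Module.finrank ℤ L) → ℤ)) :
    B.cosetEquiv p = p.1.out + B.latticeHom p.2 := rfl

variable [Module.Free ℤ L] [Module.Finite ℤ L]

instance : Finite (L ⧸ B.latticeHom.range) := by
  have : Module.Finite ℤ (L ⧸ B.latticeHom.range) :=
    Module.Finite.of_surjective (QuotientAddGroup.mk' B.latticeHom.range).toIntLinearMap
      (QuotientAddGroup.mk'_surjective _)
  apply Module.finite_of_fg_torsion
  intro d
  obtain ⟨x, rfl⟩ := QuotientAddGroup.mk'_surjective _ d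
  have hN : ∏ i, B.a i ≠ 0 := Finset.prod_ne_zero_iff.2 fun i _ => (B.a_pos i).ne'
  refine ⟨⟨∏ i, B.a i, mem_nonZeroDivisors_of_ne_zero hN⟩, ?_⟩
  change (∏ i, B.a i) • QuotientAddGroup.mk' B.latticeHom.range x = 0
  rw [← map_zsmul, QuotientAddGroup.mk'_apply, QuotientAddGroup.eq_zero_iff]
  choose c hc using fun i => Finset.dvd_prod_of_mem B.a (Finset.mem_univ i)
  refine ⟨fun i => c i * Λ.form x (B.v i), inclQ_injective ?_⟩
  rw [inclQ_latticeHom, map_zsmul]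
  conv_rhs => rw [B.expand (inclQ L x), Finset.smul_sum]
  refine Finset.sum_congr rfl fun i _ => ?_
  rw [← Int.cast_smul_eq_zsmul ℚ, smul_smul, formQ_inclQ]
  congr 1
  rw [hc i]
  push_cast
  field_simp [B.a_ne_zero_rat i]

instance : Fintype (L ⧸ B.latticeHom.range) := Fintype.ofFinite _

/-- Orthogonality of characters of the finite group `L / M`. -/
theorem sum_e_formQ_dualPoint (k : Fin (Module.finrank ℤ L) → ℤ) [Decidable (B.dualPoint k ∈ Λ.dual)] :
    ∑ g : L ⧸ B.latticeHom.range, e (Λ.formQ (inclQ L g.out) (B.dualPoint k)) =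
      if B.dualPoint k ∈ Λ.dual then (Fintype.card (L ⧸ B.latticeHom.range) : ℂ) else 0 := by
  have hinv : ∀ x y : L, (QuotientAddGroup.mk x : L ⧸ B.latticeHom.range) = QuotientAddGroup.mk y →
      e (Λ.formQ (inclQ L x) (B.dualPoint k)) = e (Λ.formQ (inclQ L y) (B.dualPoint k)) := by
    intro x y h
    rw [QuotientAddGroup.eq] at h
    obtain ⟨m, hm⟩ := h
    have hy : y = x + B.latticeHom m := by rw [hm]; abel
    rw [hy, map_add, map_add, LinearMap.add_apply, formQ_latticeHom_dualPoint]
    exact (e_ratCast_congr ⟨_, rfl⟩).symm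
  split_ifs with h
  · rw [Finset.sum_congr rfl (g := fun _ => (1 : ℂ))]
    · simp
    · intro g _
      rw [e_eq_one_iff, Λ.formQ_symm]
      exact h _
  -- Outside the dual the character is nontrivial: translation by a suitable x permutes the cosets
  -- and multiplies the sum by a number different from 1.
  · obtain ⟨x, hx⟩ : ∃ x : L, e (Λ.formQ (inclQ L x) (B.dualPoint k)) ≠ 1 := by
      by_contra! hc
      refine h fun x => ?_
      rw [← e_eq_one_iff, Λ.formQ_symm]
      exact hc x
    have hsum := Equiv.sum_comp (Equiv.addRight (QuotientAddGroup.mk x : L ⧸ B.latticeHom.range))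
      (fun g => e (Λ.formQ (inclQ L g.out) (B.dualPoint k)))
    have hshift : ∀ g : L ⧸ B.latticeHom.range,
        e (Λ.formQ (inclQ L (Equiv.addRight (QuotientAddGroup.mk x) g).out) (B.dualPoint k)) =
        e (Λ.formQ (inclQ L g.out) (B.dualPoint k)) * e (Λ.formQ (inclQ L x) (B.dualPoint k)) := by
      intro g
      rw [hinv _ (g.out + x)]
      · rw [map_add, map_add, LinearMap.add_apply]
        push_cast
        rw [e_add]
      · rw [QuotientAddGroup.out_eq', QuotientAddGroup.mk_add, QuotientAddGroup.out_eq']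
        rfl
    simp only [hshift] at hsum
    rw [← Finset.sum_mul] at hsum
    have h3 : (∑ g : L ⧸ B.latticeHom.range, e (Λ.formQ (inclQ L g.out) (B.dualPoint k))) *
        (e (Λ.formQ (inclQ L x) (B.dualPoint k)) - 1) = 0 := by
      rw [mul_sub, hsum]
      ring
    exact (mul_eq_zero.1 h3).resolve_right (sub_ne_zero.2 hx)

end OrthoFrame

variable (Λ)

/-- The embedding of `L` into its dual. -/
def inclDual : L →+ Λ.dual := (inclQ L).codRestrict Λ.dual Λ.inclQ_mem_dual

theorem coe_inclDual (l : L) : (Λ.inclDual l : ℚ ⊗[ℤ] L) = inclQ L l := rfl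

theorem inclDual_injective [Module.Free ℤ L] : Function.Injective Λ.inclDual := fun _ _ h =>
  inclQ_injective (congrArg Subtype.val h)

variable [Module.Free ℤ L] [Module.Finite ℤ L]

theorem summable_term_dual {τ : ℂ} (hτ : 0 < τ.im) (z : ℂ ⊗[ℤ] L) :
    Summable fun x : Λ.dual => ‖Λ.term τ z x‖ := by
  obtain ⟨B⟩ := Λ.nonempty_orthoFrame
  rw [← B.dualEquiv.summable_iff]
  exact (B.summable_term_dualPoint hτ z).comp_injective Subtype.val_injective

theorem summable_term_coset (ρ : ℚ ⊗[ℤ] L) {τ : ℂ} (hτ : 0 < τ.im) (z : ℂ ⊗[ℤ] L) :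
    Summable fun x : Λ.dual => ‖Λ.term τ z (ρ + x)‖ := by
  simp only [term_add, norm_mul]
  exact (Λ.summable_term_dual hτ _).mul_left _

theorem summable_term_lattice {τ : ℂ} (hτ : 0 < τ.im) (z : ℂ ⊗[ℤ] L) :
    Summable fun l : L => ‖Λ.term τ z (inclQ L l)‖ := by
  have h := (Λ.summable_term_dual hτ z).comp_injective (i := Λ.inclDual) Λ.inclDual_injective
  simpa only [Function.comp_def, coe_inclDual] using h

/-- The theta function of the lattice, as a finite sum over the cosets of the lattice spanned
by a frame. -/
theorem OrthoFrame.tsum_term_lattice (B : Λ.OrthoFrame) (τ : ℍ) (z : ℂ ⊗[ℤ] L) :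
    ∑' l : L, Λ.term τ z (inclQ L l) = ∑ g : L ⧸ B.latticeHom.range,
      Λ.term τ z (inclQ L g.out) * ∑' k, Λ.term τ (z + (τ : ℂ) • inclC L (inclQ L g.out))
        (inclQ L (B.latticeHom k)) := by
  have h1 := (Λ.summable_term_lattice τ.im_pos z).of_norm
  rw [← B.cosetEquiv.summable_iff] at h1
  simp only [Function.comp_def] at h1
  rw [← B.cosetEquiv.tsum_eq, h1.tsum_prod, tsum_fintype]
  refine Finset.sum_congr rfl fun g _ => ?_
  rw [← tsum_mul_left]
  refine tsum_congr fun k => ?_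
  rw [B.cosetEquiv_apply, map_add, term_add]

/-- Poisson summation for the theta series of a lattice. -/
theorem exists_tsum_term_inversion : ∃ C : ℝ, 0 < C ∧ ∀ (τ : ℍ) (z : ℂ ⊗[ℤ] L),
    ∑' l : L, Λ.term τ z (inclQ L l) =
      C * (rootS τ ^ Module.finrank ℤ L)⁻¹ * e (-Λ.quadC z / τ) *
        ∑' y : Λ.dual, Λ.term (-1 / τ) ((τ : ℂ)⁻¹ • z) y := by
  classical
  obtain ⟨B⟩ := Λ.nonempty_orthoFrame
  -- The product comes from inversion for the frame lattice, the index from orthogonality of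
  -- characters. Later arguments use only that the constant is positive.
  refine ⟨(∏ i, (√(B.a i : ℝ))⁻¹) * Fintype.card (L ⧸ B.latticeHom.range), ?_, fun τ z => ?_⟩
  · refine mul_pos (Finset.prod_pos fun i _ => inv_pos.2 (Real.sqrt_pos.2 ?_)) ?_
    · exact_mod_cast B.a_pos i
    · exact_mod_cast Fintype.card_pos
  have hτ0 := τ.ne_zero
  have hS : ∀ g : L ⧸ B.latticeHom.range, Summable fun k => Λ.term (-1 / τ) ((τ : ℂ)⁻¹ • z)
      (B.dualPoint k) * e (Λ.formQ (inclQ L g.out) (B.dualPoint k)) := by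
    intro g
    simp only [← term_add_arg]
    exact (B.summable_term_dualPoint (OrthoFrame.im_neg_one_div_pos τ) _).of_norm
  have hg : ∀ g : L ⧸ B.latticeHom.range,
      Λ.term τ z (inclQ L g.out) * ∑' k, Λ.term τ (z + (τ : ℂ) • inclC L (inclQ L g.out))
        (inclQ L (B.latticeHom k)) =
      ((∏ i, (√(B.a i : ℝ))⁻¹ : ℝ) : ℂ) * (rootS τ ^ Module.finrank ℤ L)⁻¹ * e (-Λ.quadC z / τ) *
        ∑' k, Λ.term (-1 / τ) ((τ : ℂ)⁻¹ • z) (B.dualPoint k) *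
          e (Λ.formQ (inclQ L g.out) (B.dualPoint k)) := by
    intro g
    rw [(B.hasSum_term_latticeHom_inversion τ _).tsum_eq, smul_add, inv_smul_smul₀ hτ0]
    simp only [term_add_arg]
    -- The Gaussian factor of the shifted argument cancels the weight of the coset representative,
    -- which then survives only as a character of the dual points.
    have he : Λ.term τ z (inclQ L g.out) *
        e (-Λ.quadC (z + (τ : ℂ) • inclC L (inclQ L g.out)) / τ) = e (-Λ.quadC z / τ) := by
      rw [term, ← e_add, ← e_add, quadC_add, quadC_smul, quadC_inclC, map_smul, smul_eq_mul,
        Λ.formC_symm z]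
      congr 1
      field_simp
      ring
    rw [← he]
    ring
  rw [OrthoFrame.tsum_term_lattice Λ B, Finset.sum_congr rfl fun g _ => hg g, ← Finset.mul_sum,
    ← Summable.tsum_finsetSum fun g _ => hS g]
  -- Summation over the cosets removes the dual points of the frame lattice that do not lie in the
  -- dual of L.
  simp only [← Finset.mul_sum, B.sum_e_formQ_dualPoint]
  rw [← B.dualEquiv.tsum_eq]
  simp only [B.dualEquiv_apply]
  have hind := tsum_subtype {k | B.dualPoint k ∈ Λ.dual}
    (fun k => Λ.term (-1 / τ) ((τ : ℂ)⁻¹ • z) (B.dualPoint k))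
  have hind' : ∑' k : {k // B.dualPoint k ∈ Λ.dual},
      Λ.term (-1 / τ) ((τ : ℂ)⁻¹ • z) (B.dualPoint k) = _ := hind
  rw [hind']
  have hterm : ∀ k, (Λ.term (-1 / τ) ((τ : ℂ)⁻¹ • z) (B.dualPoint k) *
      if B.dualPoint k ∈ Λ.dual then (Fintype.card (L ⧸ B.latticeHom.range) : ℂ) else 0) =
      {k | B.dualPoint k ∈ Λ.dual}.indicator
        (fun k => Λ.term (-1 / τ) ((τ : ℂ)⁻¹ • z) (B.dualPoint k)) k *
        Fintype.card (L ⧸ B.latticeHom.range) := by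
    intro k
    by_cases h : B.dualPoint k ∈ Λ.dual <;> simp [h, Set.indicator]
  simp only [hterm]
  rw [tsum_mul_right]
  push_cast
  ring

end PosDefLattice

/-! ### Coordinates on W and theta inversion in these coordinates -/

namespace PosDefLattice

variable {L : Type*} [AddCommGroup L] (Λ : PosDefLattice L)

theorem e_quadQ_add_inclQ (x : Λ.dual) (l : L) :
    e (Λ.quadQ ((x : ℚ ⊗[ℤ] L) + inclQ L l)) = e (Λ.quadQ (x : ℚ ⊗[ℤ] L)) * e (Λ.quad l) := by
  obtain ⟨m, hm⟩ := x.2 l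
  rw [quadQ_add, hm, quadQ_inclQ, ← e_add]
  push_cast
  rw [e_add_int]

/-- `β` mod `ℤ` is well defined on the cosets of `L` in the shadow. -/
theorem e_quadQ_shadow_congr (ρ : Λ.shadow) {x y : Λ.dual} (h : Λ.toDisc x = Λ.toDisc y) :
    e (Λ.quadQ ((ρ : ℚ ⊗[ℤ] L) + x)) = e (Λ.quadQ ((ρ : ℚ ⊗[ℤ] L) + y)) := by
  obtain ⟨l, hl⟩ := (Λ.toDisc_eq_iff _ _).1 h
  rw [Λ.quadQ_add ρ x, Λ.quadQ_add ρ y]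
  push_cast
  rw [e_add, e_add, e_add, e_add, hl, e_quadQ_add_inclQ, map_add, Rat.cast_add, e_add,
    e_formQ_shadow]
  linear_combination (-e (Λ.quadQ ρ) * e (Λ.quadQ x) * e (Λ.formQ ρ x)) * Λ.e_quad_add_self l

/-- Coordinates on `W` given by the choice of an element `ρ` of the shadow: the function `b` on
`L^# / L` corresponds to `ρ + x ↦ e(β(x)) b(x)`. -/
def coeffEquiv (ρ : Λ.shadow) : (Λ.Disc → ℂ) ≃ₗ[ℂ] Λ.W where
  toFun b := ⟨fun r => e (Λ.quadQ ((Λ.shadowEquiv ρ).symm r : ℚ ⊗[ℤ] L)) *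
      b (Λ.toDisc ((Λ.shadowEquiv ρ).symm r)), fun r r' l h => by
    have h1 : ((Λ.shadowEquiv ρ).symm r' : ℚ ⊗[ℤ] L) = (Λ.shadowEquiv ρ).symm r + inclQ L l := by
      change (r' : ℚ ⊗[ℤ] L) - ρ = r - ρ + inclQ L l
      rw [h]
      abel
    dsimp only
    rw [← (Λ.toDisc_eq_iff _ _).2 ⟨l, h1⟩, h1, e_quadQ_add_inclQ]
    ring⟩
  map_add' b b' := by
    ext r
    change e _ * (b _ + b' _) = e _ * b _ + e _ * b' _
    ring
  map_smul' t b := by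
    ext r
    change e _ * (t * b _) = t * (e _ * b _)
    ring
  invFun a := fun d => e (-Λ.quadQ (Λ.rep d : ℚ ⊗[ℤ] L)) * a.1 (Λ.shadowAdd ρ (Λ.rep d))
  left_inv b := by
    ext d
    have h1 : (Λ.shadowEquiv ρ).symm (Λ.shadowAdd ρ (Λ.rep d)) = Λ.rep d :=
      (Λ.shadowEquiv ρ).symm_apply_apply _
    simp only [h1, toDisc_rep]
    rw [← mul_assoc, ← e_add, neg_add_cancel, e_zero, one_mul]
  right_inv a := by
    ext r
    obtain ⟨x, rfl⟩ := (Λ.shadowEquiv ρ).surjective r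
    simp only [Equiv.symm_apply_apply]
    obtain ⟨l, hl⟩ := (Λ.toDisc_eq_iff (Λ.rep (Λ.toDisc x)) x).1 (Λ.toDisc_rep _)
    rw [a.2 (Λ.shadowAdd ρ (Λ.rep (Λ.toDisc x))) (Λ.shadowEquiv ρ x) l, hl, e_quadQ_add_inclQ, e_neg]
    · rw [mul_comm (e (Λ.quadQ _)), mul_assoc, mul_inv_cancel_left₀ (e_ne_zero _)]
    · change (ρ : ℚ ⊗[ℤ] L) + x = ρ + Λ.rep (Λ.toDisc x) + inclQ L l
      rw [hl]
      abel

theorem coeffEquiv_shadowAdd (ρ : Λ.shadow) (b : Λ.Disc → ℂ) (x : Λ.dual) :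
    (Λ.coeffEquiv ρ b).1 (Λ.shadowAdd ρ x) = e (Λ.quadQ (x : ℚ ⊗[ℤ] L)) * b (Λ.toDisc x) := by
  have h1 : (Λ.shadowEquiv ρ).symm (Λ.shadowAdd ρ x) = x :=
    (Λ.shadowEquiv ρ).symm_apply_apply _
  change e (Λ.quadQ ((Λ.shadowEquiv ρ).symm _ : ℚ ⊗[ℤ] L)) * _ = _
  rw [h1]

/-- The theta function attached to a function on `L^# / L`, via the coordinates `coeffEquiv`. -/
def discTheta (ρ : Λ.shadow) (b : Λ.Disc → ℂ) (τ : ℂ) (z : ℂ ⊗[ℤ] L) : ℂ :=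
  ∑' x : Λ.dual, e (Λ.quadQ (x : ℚ ⊗[ℤ] L)) * b (Λ.toDisc x) * Λ.term τ z (ρ + x)

theorem theta_coeffEquiv (ρ : Λ.shadow) (b : Λ.Disc → ℂ) (τ : ℍ) (z : ℂ ⊗[ℤ] L) :
    Λ.theta (Λ.coeffEquiv ρ b) τ z = Λ.discTheta ρ b τ z := by
  rw [theta, discTheta, ← (Λ.shadowEquiv ρ).tsum_eq]
  refine tsum_congr fun x => ?_
  change (Λ.coeffEquiv ρ b).1 (Λ.shadowAdd ρ x) * _ * _ = _
  rw [coeffEquiv_shadowAdd, term, mul_assoc]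
  rfl

/-- The theta series of the coset `r + L` of the shadow. -/
def shadowTheta (r : ℚ ⊗[ℤ] L) (τ : ℂ) (z : ℂ ⊗[ℤ] L) : ℂ :=
  ∑' l : L, e (Λ.quad l) * Λ.term τ z (r + inclQ L l)

/-- The translation of z by τr accounts for the coset, and the translation by r produces the signs
e(β(l)) = e(β(r, l)). -/
theorem shadowTheta_eq (r : Λ.shadow) (τ : ℂ) (z : ℂ ⊗[ℤ] L) :
    Λ.shadowTheta r τ z = Λ.term τ z r *
      ∑' l : L, Λ.term τ (z + τ • inclC L r + inclC L r) (inclQ L l) := by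
  rw [shadowTheta, ← tsum_mul_left]
  refine tsum_congr fun l => ?_
  rw [term_add, term_add_arg, e_formQ_shadow]
  ring

/-- The constants of the theta inversion formula in the coordinates `coeffEquiv`. -/
def kernel (ρ : Λ.shadow) (s : ℤˣ) (d d' : Λ.Disc) : ℂ :=
  e ((Λ.quadQ (Λ.rep d : ℚ ⊗[ℤ] L) + (s : ℤ) * Λ.formQ (ρ + Λ.rep d) (ρ + Λ.rep d') -
    Λ.quadQ (Λ.rep d' : ℚ ⊗[ℤ] L) : ℚ))

/-- The operator on functions on `L^# / L` with the given kernel. -/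
def kernelOp (ρ : Λ.shadow) (s : ℤˣ) [Fintype Λ.Disc] (b : Λ.Disc → ℂ) : Λ.Disc → ℂ :=
  fun d' => ∑ d, b d * Λ.kernel ρ s d d'

/-- Independence of the representatives. Changing x by l adds, modulo ℤ, β(l) through the first term
and sβ(l) through the second; these half-integers cancel or add up to β(l, l). The same happens for
y. -/
theorem kernel_toDisc (ρ : Λ.shadow) (s : ℤˣ) (x : Λ.dual) (y : Λ.dual) :
    Λ.kernel ρ s (Λ.toDisc x) (Λ.toDisc y) =
      e ((Λ.quadQ (x : ℚ ⊗[ℤ] L) + (s : ℤ) * Λ.formQ (ρ + x) (ρ + y) -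
        Λ.quadQ (y : ℚ ⊗[ℤ] L) : ℚ)) := by
  obtain ⟨l, hl⟩ := (Λ.toDisc_eq_iff _ _).1 (Λ.toDisc_rep (Λ.toDisc x))
  obtain ⟨k, hk⟩ := (Λ.toDisc_eq_iff _ _).1 (Λ.toDisc_rep (Λ.toDisc y))
  obtain ⟨m₁, h₁⟩ := (Λ.rep (Λ.toDisc x)).2 l
  obtain ⟨m₂, h₂⟩ := (Λ.rep (Λ.toDisc y)).2 k
  obtain ⟨m₃, h₃⟩ := (Λ.shadowAdd ρ (Λ.rep (Λ.toDisc x))).2 k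
  obtain ⟨m₄, h₄⟩ := (Λ.shadowAdd ρ (Λ.rep (Λ.toDisc y))).2 l
  have h5 : Λ.quad l + Λ.quad l = Λ.form l l := by rw [quad]; ring
  have h6 : Λ.quad k + Λ.quad k = Λ.form k k := by rw [quad]; ring
  rw [kernel]
  simp only [shadowAdd] at h₃ h₄
  have e1 : Λ.formQ ((ρ : ℚ ⊗[ℤ] L) + x) (ρ + y) =
      Λ.formQ (ρ + Λ.rep (Λ.toDisc x)) (ρ + Λ.rep (Λ.toDisc y)) +
        (Λ.quad k + m₃) + (Λ.quad l + m₄) + Λ.form l k := by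
    rw [← h₃, ← h₄, hl, hk, ← formQ_inclQ]
    simp only [map_add, LinearMap.add_apply, Λ.formQ_symm (inclQ L l)]
    ring
  have e2 : Λ.quadQ (x : ℚ ⊗[ℤ] L) = Λ.quadQ (Λ.rep (Λ.toDisc x) : ℚ ⊗[ℤ] L) + Λ.quad l + m₁ := by
    rw [hl, quadQ_add, quadQ_inclQ, h₁]
  have e3 : Λ.quadQ (y : ℚ ⊗[ℤ] L) = Λ.quadQ (Λ.rep (Λ.toDisc y) : ℚ ⊗[ℤ] L) + Λ.quad k + m₂ := by
    rw [hk, quadQ_add, quadQ_inclQ, h₂]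
  symm
  apply e_ratCast_congr
  rw [e1, e2, e3]
  rcases Int.units_eq_one_or s with rfl | rfl
  · refine ⟨Λ.form l l + m₁ + m₃ + m₄ + Λ.form l k - m₂, ?_⟩
    push_cast
    rw [← h5]
    ring
  · refine ⟨-Λ.form k k + m₁ - m₃ - m₄ - Λ.form l k - m₂, ?_⟩
    push_cast
    rw [← h6]
    ring

/-- The weights e(β(ρ + x)) are constant on the cosets of L, so the translation is diagonal. -/
theorem discTheta_add_one (ρ : Λ.shadow) (b : Λ.Disc → ℂ) (τ : ℂ) (z : ℂ ⊗[ℤ] L) :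
    Λ.discTheta ρ b (τ + 1) z =
      Λ.discTheta ρ (fun d => e (Λ.quadQ ((ρ : ℚ ⊗[ℤ] L) + Λ.rep d)) * b d) τ z := by
  refine tsum_congr fun x => ?_
  dsimp only
  rw [Λ.e_quadQ_shadow_congr ρ (Λ.toDisc_rep (Λ.toDisc x)), term, mul_add, mul_one, e_add, term]
  ring

/-- A constant `C > 0` is the constant of the theta inversion formula of the lattice. -/
def IsInversionConst (C : ℝ) : Prop :=
  0 < C ∧ ∀ (τ : ℍ) (z : ℂ ⊗[ℤ] L),
    ∑' l : L, Λ.term τ z (inclQ L l) =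
      C * (rootS τ ^ Module.finrank ℤ L)⁻¹ * e (-Λ.quadC z / τ) *
        ∑' y : Λ.dual, Λ.term (-1 / τ) ((τ : ℂ)⁻¹ • z) y

variable {Λ} in
-- Inversion of the untwisted series at z + τr + r. The linear terms created by the shift turn the
-- sum over the dual into a sum over -r + L^#, which is again the whole shadow.
theorem IsInversionConst.shadowTheta {C : ℝ} (hC : Λ.IsInversionConst C) (r : Λ.shadow) (τ : ℍ)
    (z : ℂ ⊗[ℤ] L) :
    Λ.shadowTheta r τ z = C * (rootS τ ^ Module.finrank ℤ L)⁻¹ * e (-Λ.quadC z / τ) *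
      ∑' s : Λ.shadow, e (Λ.formQ r s) * Λ.term (-1 / τ) ((τ : ℂ)⁻¹ • z) s := by
  have hτ0 := τ.ne_zero
  rw [shadowTheta_eq, hC.2, ← ((Λ.shadowEquiv (Λ.shadowNeg r))).tsum_eq, ← tsum_mul_left,
    ← tsum_mul_left, ← tsum_mul_left]
  refine tsum_congr fun y => ?_
  have hs : ((Λ.shadowEquiv (Λ.shadowNeg r) y : Λ.shadow) : ℚ ⊗[ℤ] L) = -r + y := rfl
  rw [hs]
  have key : Λ.term τ z r * e (-Λ.quadC (z + (τ : ℂ) • inclC L r + inclC L r) / τ) *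
      Λ.term (-1 / τ) ((τ : ℂ)⁻¹ • (z + (τ : ℂ) • inclC L r + inclC L r)) y =
      e (-Λ.quadC z / τ) * (e (Λ.formQ r (-r + y)) * Λ.term (-1 / τ) ((τ : ℂ)⁻¹ • z) (-r + y)) := by
    simp only [term, ← e_add]
    congr 1
    simp only [quadC_add, quadC_smul, quadC_inclC, quadQ_add, quadQ_neg, map_add, map_neg, map_smul,
      LinearMap.add_apply, LinearMap.smul_apply, LinearMap.neg_apply, formC_inclC, smul_eq_mul,
      Λ.formC_symm z, Λ.formQ_symm y, Rat.cast_add, Rat.cast_neg]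
    have h2 : (Λ.formQ (r : ℚ ⊗[ℤ] L) r : ℂ) = 2 * Λ.quadQ r := by
      rw [quadQ]; push_cast; ring
    rw [h2]
    field_simp
    ring
  linear_combination (C * (rootS τ ^ Module.finrank ℤ L)⁻¹) * key

/-- The decomposition of the dual into cosets of `L`. -/
def dualCosetEquiv [Module.Free ℤ L] : Λ.Disc × L ≃ Λ.dual :=
  Equiv.ofBijective _ (bijective_coset_decomposition ((inclQ L).range.addSubgroupOf Λ.dual)
    Λ.inclDual Λ.inclDual_injective
    (fun x => by
      rw [AddSubgroup.mem_addSubgroupOf]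
      constructor
      · rintro ⟨l, hl⟩
        exact ⟨l, Subtype.ext hl⟩
      · rintro ⟨l, rfl⟩
        exact ⟨l, rfl⟩) Λ.rep Λ.toDisc_rep)

theorem coe_dualCosetEquiv [Module.Free ℤ L] (d : Λ.Disc) (l : L) :
    (Λ.dualCosetEquiv (d, l) : ℚ ⊗[ℤ] L) = Λ.rep d + inclQ L l := rfl

theorem toDisc_dualCosetEquiv [Module.Free ℤ L] (d : Λ.Disc) (l : L) :
    Λ.toDisc (Λ.dualCosetEquiv (d, l)) = d := by
  conv_rhs => rw [← Λ.toDisc_rep d]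
  exact ((Λ.toDisc_eq_iff _ _).2 ⟨l, Λ.coe_dualCosetEquiv d l⟩).symm

section

variable [Module.Free ℤ L] [Module.Finite ℤ L]

theorem summable_discTheta (ρ : Λ.shadow) (b : Λ.Disc → ℂ) {τ : ℂ} (hτ : 0 < τ.im) (z : ℂ ⊗[ℤ] L) :
    Summable fun x : Λ.dual =>
      ‖e (Λ.quadQ (x : ℚ ⊗[ℤ] L)) * b (Λ.toDisc x) * Λ.term τ z (ρ + x)‖ := by
  obtain ⟨M, hM⟩ := (Set.finite_range fun d => ‖b d‖).bddAbove
  refine Summable.of_nonneg_of_le (fun _ => norm_nonneg _) (fun x => ?_)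
    ((Λ.summable_term_coset ρ hτ z).mul_left M)
  rw [norm_mul, norm_mul, norm_e_ratCast, one_mul]
  exact mul_le_mul_of_nonneg_right (hM ⟨_, rfl⟩) (norm_nonneg _)

theorem discTheta_add (ρ : Λ.shadow) (b b' : Λ.Disc → ℂ) {τ : ℂ} (hτ : 0 < τ.im)
    (z : ℂ ⊗[ℤ] L) :
    Λ.discTheta ρ (b + b') τ z = Λ.discTheta ρ b τ z + Λ.discTheta ρ b' τ z := by
  rw [discTheta, discTheta, discTheta, ← (Λ.summable_discTheta ρ b hτ z).of_norm.tsum_add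
    (Λ.summable_discTheta ρ b' hτ z).of_norm]
  refine tsum_congr fun x => ?_
  simp only [Pi.add_apply]
  ring

theorem discTheta_eq_sum (ρ : Λ.shadow) (b : Λ.Disc → ℂ) {τ : ℂ} (hτ : 0 < τ.im) (z : ℂ ⊗[ℤ] L) :
    Λ.discTheta ρ b τ z = ∑ d, b d * (e (Λ.quadQ (Λ.rep d : ℚ ⊗[ℤ] L)) *
      Λ.shadowTheta (ρ + Λ.rep d) τ z) := by
  have h1 := (Λ.summable_discTheta ρ b hτ z).of_norm
  rw [← Λ.dualCosetEquiv.summable_iff] at h1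
  simp only [Function.comp_def] at h1
  rw [discTheta, ← Λ.dualCosetEquiv.tsum_eq, h1.tsum_prod, tsum_fintype]
  refine Finset.sum_congr rfl fun d _ => ?_
  rw [shadowTheta, ← tsum_mul_left, ← tsum_mul_left]
  refine tsum_congr fun l => ?_
  rw [toDisc_dualCosetEquiv, coe_dualCosetEquiv, e_quadQ_add_inclQ, add_assoc]
  ring

variable {Λ}

/-- The theta inversion formula. -/
theorem IsInversionConst.discTheta {C : ℝ} (hC : Λ.IsInversionConst C) (ρ : Λ.shadow)
    (b : Λ.Disc → ℂ) (s : ℤˣ) (τ : ℍ) (z : ℂ ⊗[ℤ] L) :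
    Λ.discTheta ρ b τ z = C * (rootS τ ^ Module.finrank ℤ L)⁻¹ * e (-Λ.quadC z / τ) *
      Λ.discTheta ρ (Λ.kernelOp ρ s b) (-1 / τ) (((s : ℤ) / (τ : ℂ)) • z) := by
  have hterm : ∀ y : Λ.dual, Λ.term (-1 / τ) (((s : ℤ) / (τ : ℂ)) • z) (ρ + y) =
      Λ.term (-1 / τ) ((τ : ℂ)⁻¹ • z) (((s : ℤ) : ℚ) • (ρ + y)) := by
    intro y
    rcases Int.units_eq_one_or s with rfl | rfl
    · simp
    · rw [Units.val_neg, Units.val_one, Int.cast_neg, Int.cast_one, Int.cast_neg, Int.cast_one,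
        neg_smul, one_smul, term_neg, neg_div, one_div, neg_smul]
  -- The shadow is stable under negation, so it is parametrised by s(ρ + y) for either sign; the
  -- sign is then moved to the argument z.
  obtain ⟨E, hE⟩ : ∃ E : Λ.dual ≃ Λ.shadow, ∀ y, (E y : ℚ ⊗[ℤ] L) = ((s : ℤ) : ℚ) • (ρ + y) := by
    rcases Int.units_eq_one_or s with rfl | rfl
    · exact ⟨Λ.shadowEquiv ρ, fun y => by simp [shadowEquiv, shadowAdd]⟩
    · exact ⟨(Λ.shadowEquiv ρ).trans Λ.shadowNeg, fun y => by
        simp [shadowEquiv, shadowAdd, shadowNeg, add_comm]⟩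
  rw [Λ.discTheta_eq_sum ρ b τ.im_pos, PosDefLattice.discTheta]
  have hd : ∀ d, b d * (e (Λ.quadQ (Λ.rep d : ℚ ⊗[ℤ] L)) * Λ.shadowTheta (ρ + Λ.rep d) τ z) =
      C * (rootS τ ^ Module.finrank ℤ L)⁻¹ * e (-Λ.quadC z / τ) * ∑' y : Λ.dual,
        e (Λ.quadQ (y : ℚ ⊗[ℤ] L)) * (b d * Λ.kernel ρ s d (Λ.toDisc y)) *
          Λ.term (-1 / τ) (((s : ℤ) / (τ : ℂ)) • z) (ρ + y) := by
    intro d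
    have h1 := hC.shadowTheta (Λ.shadowAdd ρ (Λ.rep d)) τ z
    have h2 : ((Λ.shadowAdd ρ (Λ.rep d) : Λ.shadow) : ℚ ⊗[ℤ] L) = ρ + Λ.rep d := rfl
    rw [h2] at h1
    rw [h1, ← E.tsum_eq, ← tsum_mul_left, ← tsum_mul_left, ← tsum_mul_left, ← tsum_mul_left]
    refine tsum_congr fun y => ?_
    have h3 : Λ.kernel ρ s d (Λ.toDisc y) = e (Λ.quadQ (Λ.rep d : ℚ ⊗[ℤ] L)) *
        e (Λ.formQ ((ρ : ℚ ⊗[ℤ] L) + Λ.rep d) (((s : ℤ) : ℚ) • (ρ + y))) *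
          (e (Λ.quadQ (y : ℚ ⊗[ℤ] L)))⁻¹ := by
      conv_lhs => rw [← Λ.toDisc_rep d]
      rw [kernel_toDisc, ← e_neg, ← e_add, ← e_add, map_smul, smul_eq_mul]
      push_cast
      rw [sub_eq_add_neg]
    rw [hE, hterm, h3]
    field_simp [e_ne_zero]
  rw [Finset.sum_congr rfl fun d _ => hd d, ← Finset.mul_sum, ← Summable.tsum_finsetSum]
  · congr 1
    refine tsum_congr fun y => ?_
    rw [kernelOp, Finset.mul_sum, Finset.sum_mul]
  · intro d _
    exact (Λ.summable_discTheta ρ (fun d' => b d * Λ.kernel ρ s d d')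
      (OrthoFrame.im_neg_one_div_pos τ) _).of_norm

end

end PosDefLattice

/-! ### Linear independence and holomorphy of the theta functions -/

section

attribute [local instance] instMeasureSpaceUnitAddCircle
  instIsProbabilityMeasureUnitAddCircleVolume

/-- Uniqueness of the coefficients of an absolutely convergent multiple Fourier series. -/
theorem eq_zero_of_tsum_mFourier_eq_zero {ι d : Type*} [Fintype d] (m : ι → d → ℤ)
    (hm : Function.Injective m) (g : ι → ℂ) (hg : Summable fun i => ‖g i‖)
    (h : ∀ t : d → ℝ, ∑' i, g i * UnitAddTorus.mFourier (m i) (fun j => (t j : UnitAddCircle)) = 0) :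
    g = 0 := by
  have hs : Summable fun i => g i • UnitAddTorus.mFourier (m i) := by
    refine Summable.of_norm ?_
    simpa only [norm_smul, UnitAddTorus.mFourier_norm, mul_one] using hg
  have h0 : ∑' i, g i • UnitAddTorus.mFourier (m i) = 0 := by
    ext x
    choose t ht using fun j => QuotientAddGroup.mk_surjective (x j)
    rw [← ContinuousMap.tsum_apply hs]
    have := h t
    have hx : (fun j => (t j : UnitAddCircle)) = x := funext ht
    rw [hx] at this
    simpa using this
  have h1 : HasSum (fun i => g i • UnitAddTorus.mFourier (m i)) 0 := h0 ▸ hs.hasSum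
  ext i₀
  -- The functional extracting one Fourier coefficient is continuous for uniform convergence, hence
  -- commutes with the sum; orthonormality leaves a single term.
  let ℓ : C(UnitAddTorus d, ℂ) →L[ℂ] ℂ := (innerSL ℂ (UnitAddTorus.mFourierLp (d := d) 2 (m i₀))).comp
    (ContinuousMap.toLp 2 MeasureTheory.volume ℂ)
  have h2 := ℓ.hasSum h1
  rw [map_zero] at h2
  classical
  have h3 : ∀ i, ℓ (g i • UnitAddTorus.mFourier (m i)) = if i = i₀ then g i₀ else 0 := by
    intro i
    have ho := (orthonormal_iff_ite.1 (UnitAddTorus.orthonormal_mFourier (d := d))) (m i₀) (m i)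
    rw [map_smul]
    change g i • inner ℂ (UnitAddTorus.mFourierLp 2 (m i₀)) (UnitAddTorus.mFourierLp 2 (m i)) = _
    rw [ho]
    by_cases hi : i = i₀
    · simp [hi]
    · rw [if_neg hi, if_neg fun h => hi (hm h).symm, smul_zero]
  simp only [h3] at h2
  exact (h2.unique (hasSum_ite_eq i₀ (g i₀))).symm

end

theorem differentiableOn_finset_prod {E ι : Type*} [NormedAddCommGroup E] [NormedSpace ℂ E]
    (u : Finset ι) {f : ι → E → ℂ} {s : Set E} (hf : ∀ i ∈ u, DifferentiableOn ℂ (f i) s) :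
    DifferentiableOn ℂ (fun x => ∏ i ∈ u, f i x) s := by
  classical
  induction u using Finset.induction_on with
  | empty => simp only [Finset.prod_empty]; exact differentiableOn_const 1
  | insert i u hi ih =>
    simp only [Finset.prod_insert hi]
    exact (hf i (Finset.mem_insert_self i u)).mul
      (ih fun j hj => hf j (Finset.mem_insert_of_mem hj))

namespace PosDefLattice

variable {L : Type*} [AddCommGroup L] (Λ : PosDefLattice L)

section

variable [Module.Free ℤ L] [Module.Finite ℤ L]

/-- Uniqueness of the Fourier coefficients in the variable `z`. -/
theorem eq_zero_of_tsum_e_eq_zero (g : Λ.dual → ℂ) (hg : Summable fun x => ‖g x‖)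
    (h : ∀ z, ∑' x : Λ.dual, g x * e (Λ.formC (inclC L x) z) = 0) : g = 0 := by
  refine eq_zero_of_tsum_mFourier_eq_zero Λ.dualCoord Λ.dualCoord_injective g hg fun t => ?_
  rw [← h (∑ i, (t i : ℂ) • inclC L (inclQ L (Module.finBasis ℤ L i)))]
  refine tsum_congr fun x => ?_
  congr 1
  rw [map_sum, e_sum]
  change ∏ i, fourier (Λ.dualCoord x i) (t i : UnitAddCircle) = _
  refine Finset.prod_congr rfl fun i _ => ?_
  rw [map_smul, formC_inclC, dualCoord_spec, fourier_coe_apply, e]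
  congr 1
  push_cast
  simp only [smul_eq_mul]
  ring

/-- Uniqueness of the coefficients of a theta-like series. -/
theorem eq_zero_of_tsum_term_eq_zero (ρ : Λ.shadow) (τ : ℂ) (g : Λ.dual → ℂ)
    (hs : ∀ z, Summable fun x : Λ.dual => g x * Λ.term τ z (ρ + x))
    (h : ∀ z, ∑' x : Λ.dual, g x * Λ.term τ z (ρ + x) = 0) : g = 0 := by
  have hterm : ∀ z (x : Λ.dual), g x * Λ.term τ z (ρ + x) =
      e (Λ.formC (inclC L ρ) z) * ((g x * e ((Λ.quadQ ((ρ : ℚ ⊗[ℤ] L) + x) : ℂ) * τ)) *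
        e (Λ.formC (inclC L x) z)) := by
    intro z x
    rw [term, map_add (inclC L), map_add, LinearMap.add_apply, e_add]
    ring
  have h0 : (fun x : Λ.dual => g x * e ((Λ.quadQ ((ρ : ℚ ⊗[ℤ] L) + x) : ℂ) * τ)) = 0 := by
    refine Λ.eq_zero_of_tsum_e_eq_zero _ ?_ fun z => ?_
    · have := (hs 0).norm
      simpa only [term, map_zero, e_zero, mul_one] using this
    · have := h z
      simp only [hterm] at this
      rw [tsum_mul_left] at this
      exact (mul_eq_zero.1 this).resolve_left (e_ne_zero _)
  ext x
  exact (mul_eq_zero.1 (congrFun h0 x)).resolve_right (e_ne_zero _)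

/-- At fixed τ the series is, up to a common factor, a Fourier series in z with pairwise distinct
frequencies. This is what transfers identities between theta expansions to their coefficients. -/
theorem discTheta_injective (ρ : Λ.shadow) {τ : ℂ} (hτ : 0 < τ.im) (b : Λ.Disc → ℂ)
    (h : ∀ z, Λ.discTheta ρ b τ z = 0) : b = 0 := by
  have := Λ.eq_zero_of_tsum_term_eq_zero ρ τ
    (fun x => e (Λ.quadQ (x : ℚ ⊗[ℤ] L)) * b (Λ.toDisc x))
    (fun z => (Λ.summable_discTheta ρ b hτ z).of_norm) h
  ext d
  obtain ⟨x, rfl⟩ := Λ.toDisc_surjective d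
  exact (mul_eq_zero.1 (congrFun this x)).resolve_left (e_ne_zero _)

theorem differentiable_formC_ofCoords (w : ℂ ⊗[ℤ] L) :
    Differentiable ℂ fun v => Λ.formC w (ofCoords L v) := by
  have : (fun v => Λ.formC w (ofCoords L v)) =
      fun v => ∑ i, v i * Λ.formC w ((1 : ℂ) ⊗ₜ[ℤ] Module.finBasis ℤ L i) := by
    ext v
    rw [ofCoords, map_sum]
    refine Finset.sum_congr rfl fun i _ => ?_
    rw [← smul_eq_mul, ← map_smul, TensorProduct.smul_tmul', smul_eq_mul, mul_one]
  rw [this]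
  fun_prop

theorem _root_.JacobiLattice.differentiable_e : Differentiable ℂ e := by
  unfold e
  fun_prop

theorem differentiable_term (r s : ℚ ⊗[ℤ] L) (t : ℂ) :
    Differentiable ℂ fun p : ℂ × (Fin (Module.finrank ℤ L) → ℂ) =>
      Λ.term p.1 (ofCoords L p.2 + p.1 • inclC L s + t • inclC L s) r := by
  have h := Λ.differentiable_formC_ofCoords (inclC L r)
  unfold term
  simp only [map_add, map_smul, smul_eq_mul]
  refine (differentiable_e.comp (by fun_prop)).mul (differentiable_e.comp ?_)
  exact ((h.comp differentiable_snd).add (by fun_prop)).add (by fun_prop)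

/-- The theta functions are holomorphic. -/
theorem differentiableOn_discTheta (ρ : Λ.shadow) (b : Λ.Disc → ℂ) :
    DifferentiableOn ℂ (fun p : ℂ × (Fin (Module.finrank ℤ L) → ℂ) =>
      Λ.discTheta ρ b p.1 (ofCoords L p.2)) {p | 0 < p.1.im} := by
  obtain ⟨B⟩ := Λ.nonempty_orthoFrame
  -- Joint holomorphy follows from an expression by finitely many products of Jacobi theta functions
  -- of one variable, with arguments depending holomorphically on τ and z.
  have h1 : ∀ p ∈ {p : ℂ × (Fin (Module.finrank ℤ L) → ℂ) | 0 < p.1.im},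
      Λ.discTheta ρ b p.1 (ofCoords L p.2) =
      ∑ d, b d * (e (Λ.quadQ (Λ.rep d : ℚ ⊗[ℤ] L)) * (Λ.term p.1 (ofCoords L p.2)
        (ρ + Λ.rep d) * ∑ g : L ⧸ B.latticeHom.range, Λ.term p.1 (ofCoords L p.2 +
          p.1 • inclC L (ρ + Λ.rep d) + inclC L (ρ + Λ.rep d)) (inclQ L g.out) *
        ∏ i, jacobiTheta₂ (B.coord (ofCoords L p.2 + p.1 • inclC L (ρ + Λ.rep d) +
          inclC L (ρ + Λ.rep d) + p.1 • inclC L (inclQ L g.out)) i) (B.a i * p.1))) := by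
    intro p hp
    rw [Λ.discTheta_eq_sum ρ b hp]
    refine Finset.sum_congr rfl fun d _ => ?_
    have h2 := Λ.shadowTheta_eq (Λ.shadowAdd ρ (Λ.rep d)) p.1 (ofCoords L p.2)
    rw [show ((Λ.shadowAdd ρ (Λ.rep d) : Λ.shadow) : ℚ ⊗[ℤ] L) = ρ + Λ.rep d from rfl] at h2
    rw [h2, OrthoFrame.tsum_term_lattice Λ B ⟨p.1, hp⟩]
    congr 3
    refine Finset.sum_congr rfl fun g _ => ?_
    rw [(B.hasSum_term_latticeHom ⟨p.1, hp⟩ _).tsum_eq]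
  refine DifferentiableOn.congr ?_ h1
  refine DifferentiableOn.fun_sum fun d _ => (DifferentiableOn.const_mul (DifferentiableOn.const_mul
    (DifferentiableOn.mul ?_ ?_) _) _)
  · have := Λ.differentiable_term (ρ + Λ.rep d) 0 0
    simp only [map_zero, smul_zero, add_zero] at this
    exact this.differentiableOn
  refine DifferentiableOn.fun_sum fun g _ => DifferentiableOn.mul ?_ ?_
  · have := Λ.differentiable_term (inclQ L g.out) (ρ + Λ.rep d) 1
    simp only [one_smul] at this
    exact this.differentiableOn
  refine differentiableOn_finset_prod _ fun i _ p hp => ?_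
  have hc : DifferentiableAt ℂ (fun p : ℂ × (Fin (Module.finrank ℤ L) → ℂ) =>
      B.coord (ofCoords L p.2 + p.1 • inclC L (ρ + Λ.rep d) +
          inclC L (ρ + Λ.rep d) + p.1 • inclC L (inclQ L g.out)) i) p := by
    simp only [OrthoFrame.coord, map_add, map_smul, smul_eq_mul]
    have h := (Λ.differentiable_formC_ofCoords (inclC L (inclQ L (B.v i)))).comp
      (differentiable_snd (E := ℂ))
    exact (((h p).add (by fun_prop)).add (by fun_prop)).add (by fun_prop)
  have hJ := (hasFDerivAt_jacobiTheta₂ (B.coord (ofCoords L p.2 + p.1 • inclC L (ρ + Λ.rep d) +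
          inclC L (ρ + Λ.rep d) + p.1 • inclC L (inclQ L g.out)) i)
          (B.im_a_mul_pos ⟨p.1, hp⟩ i)).differentiableAt
  exact (DifferentiableAt.comp p (g := fun q : ℂ × ℂ => jacobiTheta₂ q.1 q.2)
    hJ (hc.prodMk (by fun_prop))).differentiableWithinAt

end

end PosDefLattice

/-! ### Milgram's formula for the shadow -/

theorem rootS_I : rootS Complex.I = 1 := by
  rw [rootS, neg_mul, Complex.I_mul_I, neg_neg, Complex.one_cpow]

theorem rootS_sq (τ : ℂ) : rootS τ ^ 2 = -Complex.I * τ := by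
  rw [rootS, ← Complex.cpow_nat_mul]
  norm_num

theorem e_neg_eighth : e (-(1 / 8)) = (√(1 / 2 : ℝ) : ℝ) * (1 - Complex.I) := by
  have h : (2 * Real.pi * Complex.I * (-(1 / 8)) : ℂ) = ((-(Real.pi / 4) : ℝ) : ℂ) * Complex.I := by
    push_cast
    ring
  rw [e, h, Complex.exp_mul_I, ← Complex.ofReal_cos, ← Complex.ofReal_sin, Real.cos_neg, Real.sin_neg,
    Real.cos_pi_div_four, Real.sin_pi_div_four]
  have h2 : √(1 / 2 : ℝ) = √2 / 2 := by
    rw [Real.sqrt_eq_iff_mul_self_eq (by norm_num) (by positivity)]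
    have := Real.mul_self_sqrt (show (0 : ℝ) ≤ 2 by norm_num)
    linarith
  rw [h2]
  push_cast
  ring

/-- The two points are those at which inversion is applied in the word STS, starting from 1 + i. The
product is the eighth root of unity in Milgram's formula. -/
theorem rootS_mul_rootS : rootS (1 + Complex.I) * rootS ((1 + Complex.I) / 2) = e (-(1 / 8)) := by
  have h1 : (1 + Complex.I) / 2 = ((1 / 2 : ℝ) : ℂ) * (1 + Complex.I) := by
    push_cast
    ring
  rw [h1, rootS_real_mul (by norm_num), mul_left_comm, ← sq, rootS_sq, e_neg_eighth]
  congr 1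
  linear_combination -Complex.I_sq

namespace PosDefLattice

variable {L : Type*} [AddCommGroup L] {Λ : PosDefLattice L}

theorem kernel_ne_zero (ρ : Λ.shadow) (s : ℤˣ) (d d' : Λ.Disc) : Λ.kernel ρ s d d' ≠ 0 :=
  e_ne_zero _

theorem discTheta_smul (ρ : Λ.shadow) (t : ℂ) (b : Λ.Disc → ℂ) (τ : ℂ) (z : ℂ ⊗[ℤ] L) :
    Λ.discTheta ρ (t • b) τ z = t * Λ.discTheta ρ b τ z := by
  rw [discTheta, discTheta, ← tsum_mul_left]
  refine tsum_congr fun x => ?_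
  simp only [Pi.smul_apply, smul_eq_mul]
  ring

variable [Module.Free ℤ L] [Module.Finite ℤ L]

variable (Λ) in
/-- The complex conjugate of the Gauss sum of the shadow. -/
def gaussSum (ρ : Λ.shadow) : ℂ := ∑ d, e (-Λ.quadQ ((ρ : ℚ ⊗[ℤ] L) + Λ.rep d))

/-- Completion of the square in a sum over `L^# / L`. -/
theorem sum_kernel_mul_kernel (ρ : Λ.shadow) (d d'' : Λ.Disc) :
    ∑ d', Λ.kernel ρ 1 d d' * e (-Λ.quadQ ((ρ : ℚ ⊗[ℤ] L) + Λ.rep d')) * Λ.kernel ρ (-1) d' d'' =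
      Λ.gaussSum ρ * (e (Λ.quadQ ((ρ : ℚ ⊗[ℤ] L) + Λ.rep d)) * Λ.kernel ρ (-1) d d'' *
        e (Λ.quadQ ((ρ : ℚ ⊗[ℤ] L) + Λ.rep d''))) := by
  -- The translation by d - d'' completes the square, so the two sums agree term by term.
  rw [gaussSum, ← Equiv.sum_comp (Equiv.subRight (d - d''))
    (fun d => e (-Λ.quadQ ((ρ : ℚ ⊗[ℤ] L) + Λ.rep d))), Finset.sum_mul]
  refine Finset.sum_congr rfl fun d' _ => ?_
  have h1 : e (-Λ.quadQ ((ρ : ℚ ⊗[ℤ] L) + Λ.rep (Equiv.subRight (d - d'') d'))) =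
      e (-Λ.quadQ ((ρ : ℚ ⊗[ℤ] L) + (Λ.rep d' - (Λ.rep d - Λ.rep d'') : Λ.dual))) := by
    rw [e_neg, e_neg, Λ.e_quadQ_shadow_congr ρ]
    rw [toDisc_rep, map_sub, map_sub, toDisc_rep, toDisc_rep, toDisc_rep]
    rfl
  rw [h1, kernel, kernel, kernel]
  simp only [← e_add]
  congr 1
  simp only [Units.val_neg, Units.val_one, Int.cast_neg, Int.cast_one]
  simp only [quadQ, AddSubgroup.coe_sub, map_add, map_sub, LinearMap.add_apply,
    LinearMap.sub_apply]
  push_cast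
  rw [Λ.formQ_symm (Λ.rep d') ρ, Λ.formQ_symm (Λ.rep d) ρ, Λ.formQ_symm (Λ.rep d'') ρ,
    Λ.formQ_symm (Λ.rep d') (Λ.rep d), Λ.formQ_symm (Λ.rep d'') (Λ.rep d),
    Λ.formQ_symm (Λ.rep d'') (Λ.rep d')]
  ring

/-- The counterpart of STS = T⁻¹ST⁻¹ for the operators on coefficients, in which the Gauss sum
appears as a scalar. Comparison with the same relation for theta functions evaluates this scalar. -/
theorem kernelOp_kernelOp (ρ : Λ.shadow) (b : Λ.Disc → ℂ) :
    Λ.kernelOp ρ (-1) (fun d => e (-Λ.quadQ ((ρ : ℚ ⊗[ℤ] L) + Λ.rep d)) * Λ.kernelOp ρ 1 b d) =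
      Λ.gaussSum ρ • fun d => e (Λ.quadQ ((ρ : ℚ ⊗[ℤ] L) + Λ.rep d)) *
        Λ.kernelOp ρ (-1) (fun d => e (Λ.quadQ ((ρ : ℚ ⊗[ℤ] L) + Λ.rep d)) * b d) d := by
  ext d''
  simp only [kernelOp, Pi.smul_apply, smul_eq_mul, Finset.mul_sum, Finset.sum_mul]
  rw [Finset.sum_comm]
  refine Finset.sum_congr rfl fun d _ => ?_
  have := sum_kernel_mul_kernel ρ d d''
  trans b d * ∑ d', Λ.kernel ρ 1 d d' * e (-Λ.quadQ ((ρ : ℚ ⊗[ℤ] L) + Λ.rep d')) *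
    Λ.kernel ρ (-1) d' d''
  · rw [Finset.mul_sum]
    exact Finset.sum_congr rfl fun d' _ => by ring
  · rw [this]
    ring

/-- The evaluation of the Gauss sum of the shadow, a form of Milgram's formula. -/
theorem IsInversionConst.mul_gaussSum {C : ℝ} (hC : Λ.IsInversionConst C) (ρ : Λ.shadow) :
    C * Λ.gaussSum ρ = e (-(1 / 8)) ^ Module.finrank ℤ L := by
  classical
  have hI1 : (0 : ℝ) < (1 + Complex.I).im := by simp
  have hI2 : (0 : ℝ) < ((1 + Complex.I) / 2).im := by simp
  set b : Λ.Disc → ℂ := Pi.single 0 1 with hb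
  set b' : Λ.Disc → ℂ := fun d => e (Λ.quadQ ((ρ : ℚ ⊗[ℤ] L) + Λ.rep d)) *
        Λ.kernelOp ρ (-1) (fun d => e (Λ.quadQ ((ρ : ℚ ⊗[ℤ] L) + Λ.rep d)) * b d) d with hb'
  have hb0 : b' ≠ 0 := by
    intro h
    have h1 := congrFun h 0
    simp only [hb', hb, kernelOp, Pi.zero_apply, mul_eq_zero, e_ne_zero, false_or] at h1
    rw [Finset.sum_eq_single 0] at h1
    · simp [e_ne_zero, kernel_ne_zero] at h1
    · intro d _ hd
      simp [hd]
    · simp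
  -- Linear independence gives an argument where the theta function is nonzero, so that it can be
  -- cancelled at the end. The choice z = -iw then makes both paths from (1 + i, z) end at (-1 + i,
  -- w).
  obtain ⟨w, hw⟩ : ∃ w, Λ.discTheta ρ b' (-1 + Complex.I) w ≠ 0 := by
    by_contra! h
    exact hb0 (Λ.discTheta_injective ρ (by simp) b' h)
  set z : ℂ ⊗[ℤ] L := (-Complex.I) • w with hz
  clear_value z
  have hIne : (1 + Complex.I : ℂ) ≠ 0 := by
    intro h
    simpa using congrArg Complex.im h
  have hmul : (1 + Complex.I) * (1 + Complex.I) = 2 * Complex.I := by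
    linear_combination Complex.I_sq
  -- the path `S`, `T`, `S`
  have A1 := hC.discTheta ρ b 1 ⟨1 + Complex.I, hI1⟩ z
  have A2 := Λ.discTheta_add_one ρ (fun d => e (-Λ.quadQ ((ρ : ℚ ⊗[ℤ] L) + Λ.rep d)) *
    Λ.kernelOp ρ 1 b d) (-1 / (1 + Complex.I)) ((((1 : ℤˣ) : ℤ) / (1 + Complex.I)) • z)
  have A2' : (fun d => e (Λ.quadQ ((ρ : ℚ ⊗[ℤ] L) + Λ.rep d)) *
      (e (-Λ.quadQ ((ρ : ℚ ⊗[ℤ] L) + Λ.rep d)) * Λ.kernelOp ρ 1 b d)) = Λ.kernelOp ρ 1 b := by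
    ext d
    rw [e_neg, mul_inv_cancel_left₀ (e_ne_zero _)]
  rw [A2', show -1 / (1 + Complex.I) + 1 = (1 + Complex.I) / 2 by
    field_simp; linear_combination -hmul] at A2
  have A3 := hC.discTheta ρ (fun d => e (-Λ.quadQ ((ρ : ℚ ⊗[ℤ] L) + Λ.rep d)) *
    Λ.kernelOp ρ 1 b d) (-1) ⟨(1 + Complex.I) / 2, hI2⟩ ((((1 : ℤˣ) : ℤ) / (1 + Complex.I)) • z)
  rw [kernelOp_kernelOp, discTheta_smul] at A3
  -- the path `T⁻¹`, `S`, `T⁻¹`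
  have B1 := Λ.discTheta_add_one ρ b Complex.I z
  have B2 := hC.discTheta ρ (fun d => e (Λ.quadQ ((ρ : ℚ ⊗[ℤ] L) + Λ.rep d)) * b d) (-1)
    UpperHalfPlane.I z
  have B3 := Λ.discTheta_add_one ρ (Λ.kernelOp ρ (-1) fun d =>
    e (Λ.quadQ ((ρ : ℚ ⊗[ℤ] L) + Λ.rep d)) * b d) (-1 + Complex.I) w
  have hz1 : (((((-1 : ℤˣ) : ℤ) : ℂ) / ((1 + Complex.I) / 2)) • ((((1 : ℤˣ) : ℤ) : ℂ) /
      (1 + Complex.I)) • z) = w := by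
    rw [hz, smul_smul, smul_smul]
    convert one_smul ℂ w using 2
    push_cast
    field_simp
    linear_combination -hmul
  have hz2 : ((((-1 : ℤˣ) : ℤ) : ℂ) / Complex.I) • z = w := by
    rw [hz, smul_smul]
    convert one_smul ℂ w using 2
    push_cast
    field_simp [Complex.I_ne_zero]
  have ht1 : -1 / ((1 + Complex.I) / 2) = -1 + Complex.I := by
    field_simp
    linear_combination -Complex.I_sq
  have ht2 : -1 / Complex.I = -1 + Complex.I + 1 := by
    field_simp [Complex.I_ne_zero]
    linear_combination -Complex.I_sq
  simp only [UpperHalfPlane.coe_I] at B2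
  rw [hz2, ht2, B3, rootS_I, one_pow, inv_one, mul_one] at B2
  rw [hz1, ht1] at A3
  rw [add_comm Complex.I, A1, ← A2, A3, B2] at B1
  -- The Gaussian factors along the two paths agree. One path carries C² and the Gauss sum, the
  -- other only C, so the square roots evaluate C times the Gauss sum.
  have he : e (-Λ.quadC z / (1 + Complex.I)) *
      e (-Λ.quadC ((((1 : ℤˣ) : ℤ) / (1 + Complex.I)) • z) / ((1 + Complex.I) / 2)) =
      e (-Λ.quadC z / Complex.I) := by
    rw [← e_add, quadC_smul]
    congr 1
    push_cast
    field_simp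
    linear_combination (Λ.quadC z) * hmul
  have hR := rootS_mul_rootS
  have hR1 : rootS (1 + Complex.I) ≠ 0 := left_ne_zero_of_mul (hR ▸ e_ne_zero _)
  have hR2 : rootS ((1 + Complex.I) / 2) ≠ 0 := right_ne_zero_of_mul (hR ▸ e_ne_zero _)
  have hC0 : (C : ℂ) ≠ 0 := by exact_mod_cast hC.1.ne'
  rw [← he] at B1
  have hE1 := e_ne_zero (-Λ.quadC z / (1 + Complex.I))
  have hE2 := e_ne_zero (-Λ.quadC ((((1 : ℤˣ) : ℤ) / (1 + Complex.I)) • z) / ((1 + Complex.I) / 2))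
  rw [← hR, mul_pow]
  set X := Λ.discTheta ρ b' (-1 + Complex.I) w
  change _ * (_ * (_ * X)) = _ * X at B1
  generalize e (-Λ.quadC z / (1 + Complex.I)) = E₁ at *
  generalize e (-Λ.quadC ((((1 : ℤˣ) : ℤ) / (1 + Complex.I)) • z) / ((1 + Complex.I) / 2)) = E₂ at *
  have hne : (C : ℂ) * E₁ * E₂ * X ≠ 0 := by simp [hC0, hE1, hE2, hw]
  refine mul_left_cancel₀ hne ?_
  change (C : ℂ) * (rootS (1 + Complex.I) ^ Module.finrank ℤ L)⁻¹ * E₁ *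
    (C * (rootS ((1 + Complex.I) / 2) ^ Module.finrank ℤ L)⁻¹ * E₂ * (Λ.gaussSum ρ * X)) =
      C * (E₁ * E₂) * X at B1
  field_simp at B1
  linear_combination (C * E₁ * E₂ * X) * B1

end PosDefLattice

/-! ### Comparison of two lattices with isomorphic bilinear modules -/

/-- In this form only β(ρ + d), β(ρ + d') and values of the bilinear form occur. The values β(d),
which σ need not preserve mod ℤ, have disappeared. -/
theorem PosDefLattice.kernel_neg_one {L : Type*} [AddCommGroup L] (Λ : PosDefLattice L)
    (ρ : Λ.shadow) (d d' : Λ.Disc) :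
    Λ.kernel ρ (-1) d d' = e ((-Λ.quadQ ((ρ : ℚ ⊗[ℤ] L) + Λ.rep d) -
      Λ.quadQ ((ρ : ℚ ⊗[ℤ] L) + Λ.rep d') + Λ.formQ (Λ.rep d : ℚ ⊗[ℤ] L) (Λ.rep d) -
        Λ.formQ (Λ.rep d : ℚ ⊗[ℤ] L) (Λ.rep d') : ℚ)) := by
  rw [kernel]
  congr 2
  simp only [quadQ, map_add, LinearMap.add_apply, Units.val_neg, Units.val_one, Int.cast_neg,
    Int.cast_one]
  rw [Λ.formQ_symm (Λ.rep d) ρ, Λ.formQ_symm (Λ.rep d') ρ]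
  ring

section Compare

variable {L₁ L₂ : Type*} [AddCommGroup L₁] [AddCommGroup L₂]
  {Λ₁ : PosDefLattice L₁} {Λ₂ : PosDefLattice L₂}

/-- The elements `ρ₁`, `ρ₂` of the shadows are compatible with `σ`: the maps `x ↦ β(ρ + x) mod ℤ`
correspond to each other under `σ`, up to the constant `c`. -/
def ShadowCompat (σ : Λ₁.Disc ≃+ Λ₂.Disc) (ρ₁ : Λ₁.shadow) (ρ₂ : Λ₂.shadow) (c : ℚ) : Prop :=
  ∀ (x : Λ₁.dual) (y : Λ₂.dual), σ (Λ₁.toDisc x) = Λ₂.toDisc y →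
    ∃ m : ℤ, Λ₂.quadQ ((ρ₂ : ℚ ⊗[ℤ] L₂) + y) = Λ₁.quadQ ((ρ₁ : ℚ ⊗[ℤ] L₁) + x) + c + m

/-- `σ` is compatible with the bilinear forms. -/
def FormCompat (σ : Λ₁.Disc ≃+ Λ₂.Disc) : Prop :=
  ∀ x y, Λ₂.discForm (σ x) (σ y) = Λ₁.discForm x y

variable {σ : Λ₁.Disc ≃+ Λ₂.Disc} {ρ₁ : Λ₁.shadow} {ρ₂ : Λ₂.shadow} {c : ℚ}

theorem FormCompat.symm (hσ : FormCompat σ) : FormCompat σ.symm := by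
  intro x y
  rw [← hσ, AddEquiv.apply_symm_apply, AddEquiv.apply_symm_apply]

theorem ShadowCompat.symm (h : ShadowCompat σ ρ₁ ρ₂ c) : ShadowCompat σ.symm ρ₂ ρ₁ (-c) := by
  intro y x hxy
  obtain ⟨m, hm⟩ := h x y (by rw [← hxy, AddEquiv.apply_symm_apply])
  exact ⟨-m, by rw [hm]; push_cast; ring⟩

theorem FormCompat.formQ (hσ : FormCompat σ) {x x' : Λ₁.dual} {y y' : Λ₂.dual}
    (h : σ (Λ₁.toDisc x) = Λ₂.toDisc y) (h' : σ (Λ₁.toDisc x') = Λ₂.toDisc y') :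
    ∃ m : ℤ, Λ₂.formQ (y : ℚ ⊗[ℤ] L₂) y' = Λ₁.formQ (x : ℚ ⊗[ℤ] L₁) x' + m := by
  rw [← coe_eq_coe_iff, ← PosDefLattice.discForm_toDisc, ← PosDefLattice.discForm_toDisc, ← h, ← h',
    hσ]

/-- Two quadratic functions with the same polarization differ by a constant and a homomorphism to
ℚ/ℤ. By nondegeneracy that homomorphism is a pairing with an element of the dual, and a change of
base point in the shadow absorbs it. -/
theorem exists_shadowCompat [Module.Free ℤ L₂] [Module.Finite ℤ L₂] (hσ : FormCompat σ)
    (ρ₁ : Λ₁.shadow) : ∃ (ρ₂ : Λ₂.shadow) (c : ℚ), ShadowCompat σ ρ₁ ρ₂ c := by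
  obtain ⟨ρ⟩ := Λ₂.shadow_nonempty
  have hrep : ∀ y, σ (Λ₁.toDisc (Λ₁.rep (σ.symm (Λ₂.toDisc y)))) = Λ₂.toDisc y := by
    intro y
    rw [Λ₁.toDisc_rep, AddEquiv.apply_symm_apply]
  have hwd1 : ∀ x x' : Λ₁.dual, Λ₁.toDisc x = Λ₁.toDisc x' →
      ∃ m : ℤ, Λ₁.quadQ ((ρ₁ : ℚ ⊗[ℤ] L₁) + x) = Λ₁.quadQ ((ρ₁ : ℚ ⊗[ℤ] L₁) + x') + m := by
    intro x x' h
    rw [← e_ratCast_eq_iff]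
    exact Λ₁.e_quadQ_shadow_congr ρ₁ h
  have hwd2 : ∀ y y' : Λ₂.dual, Λ₂.toDisc y = Λ₂.toDisc y' →
      ∃ m : ℤ, Λ₂.quadQ ((ρ : ℚ ⊗[ℤ] L₂) + y) = Λ₂.quadQ ((ρ : ℚ ⊗[ℤ] L₂) + y') + m := by
    intro x x' h
    rw [← e_ratCast_eq_iff]
    exact Λ₂.e_quadQ_shadow_congr ρ h
  -- The difference of the two quadratic functions, each normalised to vanish at the base point. It
  -- is additive mod ℤ and integral on L₂.
  let f : Λ₂.dual → ℚ := fun y =>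
    (Λ₁.quadQ ((ρ₁ : ℚ ⊗[ℤ] L₁) + Λ₁.rep (σ.symm (Λ₂.toDisc y))) - Λ₁.quadQ (ρ₁ : ℚ ⊗[ℤ] L₁)) -
      (Λ₂.quadQ ((ρ : ℚ ⊗[ℤ] L₂) + y) - Λ₂.quadQ (ρ : ℚ ⊗[ℤ] L₂))
  have hf : ∀ y y', ∃ m : ℤ, f (y + y') = f y + f y' + m := by
    intro y y'
    obtain ⟨m, hm⟩ := hwd1 (Λ₁.rep (σ.symm (Λ₂.toDisc (y + y'))))
      (Λ₁.rep (σ.symm (Λ₂.toDisc y)) + Λ₁.rep (σ.symm (Λ₂.toDisc y'))) (by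
        simp only [map_add, Λ₁.toDisc_rep])
    obtain ⟨k, hk⟩ := hσ.formQ (hrep y) (hrep y')
    refine ⟨m - k, ?_⟩
    simp only [f, hm, AddSubgroup.coe_add]
    rw [← add_assoc, ← add_assoc, Λ₁.quadQ_add (_ + _), Λ₂.quadQ_add (_ + _)]
    simp only [Λ₁.quadQ_add (ρ₁ : ℚ ⊗[ℤ] L₁), Λ₂.quadQ_add (ρ : ℚ ⊗[ℤ] L₂), map_add,
      LinearMap.add_apply, hk]
    push_cast
    ring
  have hf0 : ∀ l, ∃ m : ℤ, f ⟨inclQ L₂ l, Λ₂.inclQ_mem_dual l⟩ = m := by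
    intro l
    have h0 : Λ₂.toDisc ⟨inclQ L₂ l, Λ₂.inclQ_mem_dual l⟩ = Λ₂.toDisc 0 :=
      ((Λ₂.toDisc_eq_iff _ _).2 ⟨l, by simp⟩).symm
    obtain ⟨m, hm⟩ := hwd2 _ _ h0
    obtain ⟨k, hk⟩ := hwd1 (Λ₁.rep (σ.symm (Λ₂.toDisc ⟨inclQ L₂ l, Λ₂.inclQ_mem_dual l⟩))) 0 (by
      rw [h0, Λ₁.toDisc_rep, map_zero, map_zero, map_zero])
    refine ⟨k - m, ?_⟩
    simp only [f, hk, hm]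
    simp
  obtain ⟨d, hd⟩ := Λ₂.exists_formQ_eq_of_hom
    (AddMonoidHom.mk' (fun y => ((f y : ℚ) : AddCircle (1 : ℚ))) (fun y y' => by
      rw [← AddCircle.coe_add]
      exact coe_eq_coe_iff.2 (hf y y')))
    (fun l => PosDefLattice.coe_eq_zero_of_int (hf0 l))
  -- The constant is dictated by the case x = y = 0.
  refine ⟨Λ₂.shadowAdd ρ d, Λ₂.quadQ ((ρ : ℚ ⊗[ℤ] L₂) + d) - Λ₁.quadQ (ρ₁ : ℚ ⊗[ℤ] L₁), ?_⟩
  intro x y hxy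
  obtain ⟨m, hm⟩ := coe_eq_coe_iff.1 (hd y)
  obtain ⟨k, hk⟩ := hwd1 x (Λ₁.rep (σ.symm (Λ₂.toDisc y))) (by
    rw [Λ₁.toDisc_rep, ← hxy, AddEquiv.symm_apply_apply])
  have hs : ((Λ₂.shadowAdd ρ d : Λ₂.shadow) : ℚ ⊗[ℤ] L₂) = ρ + d := rfl
  refine ⟨-m - k, ?_⟩
  rw [hs, hk]
  simp only [f] at hm
  rw [add_right_comm, Λ₂.quadQ_add (_ + _), Λ₂.quadQ_add (ρ : ℚ ⊗[ℤ] L₂) d, map_add,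
    LinearMap.add_apply, Λ₂.formQ_symm y d]
  push_cast
  linarith

theorem ShadowCompat.rep (h : ShadowCompat σ ρ₁ ρ₂ c) (d : Λ₁.Disc) :
    ∃ m : ℤ, Λ₂.quadQ ((ρ₂ : ℚ ⊗[ℤ] L₂) + Λ₂.rep (σ d)) =
      Λ₁.quadQ ((ρ₁ : ℚ ⊗[ℤ] L₁) + Λ₁.rep d) + c + m :=
  h _ _ (by rw [PosDefLattice.toDisc_rep, PosDefLattice.toDisc_rep])

/-- In `kernel_neg_one` the constant c enters once through d and once through d'; the remaining
terms are preserved by σ mod ℤ. -/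
theorem ShadowCompat.kernel (h : ShadowCompat σ ρ₁ ρ₂ c) (hσ : FormCompat σ) (d d' : Λ₁.Disc) :
    Λ₂.kernel ρ₂ (-1) (σ d) (σ d') = e (-2 * c) * Λ₁.kernel ρ₁ (-1) d d' := by
  obtain ⟨m₁, h₁⟩ := h.rep d
  obtain ⟨m₂, h₂⟩ := h.rep d'
  have hd : ∀ d, σ (Λ₁.toDisc (Λ₁.rep d)) = Λ₂.toDisc (Λ₂.rep (σ d)) := by
    intro d
    rw [PosDefLattice.toDisc_rep, PosDefLattice.toDisc_rep]
  obtain ⟨m₃, h₃⟩ := hσ.formQ (hd d) (hd d)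
  obtain ⟨m₄, h₄⟩ := hσ.formQ (hd d) (hd d')
  rw [Λ₁.kernel_neg_one, Λ₂.kernel_neg_one, h₁, h₂, h₃, h₄]
  have : (-2 * (c : ℂ)) = ((-2 * c : ℚ) : ℂ) := by push_cast; ring
  rw [this, ← e_add, ← Rat.cast_add]
  apply e_ratCast_congr
  refine ⟨-m₁ - m₂ + m₃ - m₄, ?_⟩
  push_cast
  ring

variable [Module.Free ℤ L₁] [Module.Finite ℤ L₁] [Module.Free ℤ L₂] [Module.Finite ℤ L₂]

theorem ShadowCompat.gaussSum (h : ShadowCompat σ ρ₁ ρ₂ c) :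
    Λ₂.gaussSum ρ₂ = e (-c) * Λ₁.gaussSum ρ₁ := by
  rw [PosDefLattice.gaussSum, PosDefLattice.gaussSum, ← Equiv.sum_comp σ.toEquiv, Finset.mul_sum]
  refine Finset.sum_congr rfl fun d _ => ?_
  have h1 := e_ratCast_congr (h.rep d)
  push_cast at h1
  rw [e_neg, e_neg, e_neg, ← mul_inv, ← e_add, add_comm (c : ℂ)]
  exact congrArg _ h1

/-- Compatible lattices have the same constant in the inversion formula, and `c` is determined
by the ranks. -/
theorem ShadowCompat.const_eq (h : ShadowCompat σ ρ₁ ρ₂ c) {C₁ C₂ : ℝ}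
    (hC₁ : Λ₁.IsInversionConst C₁) (hC₂ : Λ₂.IsInversionConst C₂) :
    C₁ = C₂ ∧ ∃ m : ℤ,
      c = ((Module.finrank ℤ L₂ : ℚ) - Module.finrank ℤ L₁) / 8 + m := by
  have h1 := hC₁.mul_gaussSum ρ₁
  have h2 := hC₂.mul_gaussSum ρ₂
  rw [h.gaussSum] at h2
  have hω : ‖e (-(1 / 8))‖ = 1 := by
    have := norm_e_ratCast (-(1 / 8))
    push_cast at this
    exact this
  have hcn : ‖e (-c)‖ = 1 := by
    have := norm_e_ratCast (-c)
    push_cast at this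
    exact this
  -- The constants are positive and the other factors, apart from the Gauss sum, have absolute value
  -- 1; absolute values therefore separate the constants from the roots of unity.
  have n1 := congrArg norm h1
  have n2 := congrArg norm h2
  rw [norm_mul, norm_pow, hω, one_pow, Complex.norm_real, Real.norm_of_nonneg hC₁.1.le] at n1
  rw [norm_mul, norm_mul, norm_pow, hω, one_pow, hcn, one_mul, Complex.norm_real,
    Real.norm_of_nonneg hC₂.1.le] at n2
  have hg : ‖Λ₁.gaussSum ρ₁‖ ≠ 0 := right_ne_zero_of_mul (n1 ▸ one_ne_zero)
  have hC : C₁ = C₂ := mul_right_cancel₀ hg (n1.trans n2.symm)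
  refine ⟨hC, ?_⟩
  rw [← e_ratCast_eq_iff]
  subst hC
  -- With equal constants, the quotient of the two evaluations of Gauss sums determines e(-c).
  have h3 : e (-c) * e (-(1 / 8)) ^ Module.finrank ℤ L₁ =
      e (-(1 / 8)) ^ Module.finrank ℤ L₂ := by
    rw [← h1, ← h2]
    ring
  rw [← e_nat_mul, ← e_nat_mul, ← e_add] at h3
  have h4 : e ((Module.finrank ℤ L₁ : ℂ) * -(1 / 8) + -c) * e (c : ℂ) *
      e ((Module.finrank ℤ L₂ : ℂ) * (1 / 8)) =
    e ((Module.finrank ℤ L₂ : ℂ) * -(1 / 8)) * e (c : ℂ) * e ((Module.finrank ℤ L₂ : ℂ) * (1 / 8)) := by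
    rw [← h3, add_comm]
  simp only [← e_add] at h4
  push_cast
  convert h4.symm using 2 <;> ring

end Compare

/-! ### The modular group and the multiplier of η -/

theorem coe_smul_eq (A : SL(2, ℤ)) (τ : ℍ) :
    ((A • τ : ℍ) : ℂ) = ((A.1 0 0 : ℂ) * τ + A.1 0 1) / autFactor A τ := by
  rw [UpperHalfPlane.coe_specialLinearGroup_apply]
  simp [autFactor]

theorem autFactor_eq_denom (A : SL(2, ℤ)) (τ : ℍ) : autFactor A τ = UpperHalfPlane.denom A τ := by
  rw [ModularGroup.denom_apply]
  rfl

theorem autFactor_ne_zero (A : SL(2, ℤ)) (τ : ℍ) : autFactor A τ ≠ 0 := by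
  rw [autFactor_eq_denom]
  exact UpperHalfPlane.denom_ne_zero _ τ

theorem det_eq_one (A : SL(2, ℤ)) : (A.1 0 0 : ℂ) * A.1 1 1 - A.1 0 1 * A.1 1 0 = 1 := by
  have := A.2
  rw [Matrix.det_fin_two] at this
  exact_mod_cast this

theorem autFactor_mul (A B : SL(2, ℤ)) (τ : ℍ) :
    autFactor (A * B) τ = autFactor A (B • τ) * autFactor B τ := by
  have h := autFactor_ne_zero B τ
  rw [autFactor, autFactor, coe_smul_eq]
  field_simp
  simp only [Matrix.SpecialLinearGroup.coe_mul, Matrix.mul_apply, Fin.sum_univ_two]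
  rw [autFactor]
  push_cast
  ring

/-- The cocycle relation behind the factor e(-cβ(z)/(cτ + d)) of the slash operator. -/
theorem lowerLeft_mul (A B : SL(2, ℤ)) (τ : ℍ) :
    (((A * B).1 1 0 : ℤ) : ℂ) * autFactor B τ = A.1 1 0 + B.1 1 0 * autFactor (A * B) τ := by
  have h := det_eq_one B
  simp only [autFactor, Matrix.SpecialLinearGroup.coe_mul, Matrix.mul_apply, Fin.sum_univ_two]
  push_cast
  linear_combination (A.1 1 0 : ℂ) * h

theorem discriminant_slash (A : SL(2, ℤ)) :
    SlashAction.map (12 : ℤ) A ModularForm.discriminant = ModularForm.discriminant := by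
  have hA : A ∈ Subgroup.closure {ModularGroup.S, ModularGroup.T} := by
    rw [SpecialLinearGroup.SL2Z_generators]
    trivial
  induction hA using Subgroup.closure_induction with
  | mem x hx =>
    rcases hx with rfl | rfl
    · exact ModularForm.discriminant_S_invariant
    · exact ModularForm.discriminant_T_invariant
  | one => exact SlashAction.slash_one _ _
  | mul x y _ _ hx hy => rw [SlashAction.slash_mul, hx, hy]
  | inv x _ hx =>
    conv_lhs => rw [← hx]
    rw [← SlashAction.slash_mul, mul_inv_cancel, SlashAction.slash_one]

theorem eta_smul_pow (A : SL(2, ℤ)) (τ : ℍ) :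
    ModularForm.eta ((A • τ : ℍ) : ℂ) ^ 24 = autFactor A τ ^ 12 * ModularForm.eta τ ^ 24 := by
  have h := congrFun (discriminant_slash A) τ
  rw [ModularForm.SL_slash_apply, ← autFactor_eq_denom] at h
  simp only [ModularForm.discriminant] at h
  have h0 := autFactor_ne_zero A τ
  rw [← h, zpow_neg, zpow_ofNat]
  field_simp

theorem Metaplectic.w_ne_zero (α : Metaplectic) (τ : ℍ) : α.w τ ≠ 0 := fun h =>
  autFactor_ne_zero α.A τ (by rw [← α.sq, h, zero_pow two_ne_zero])

theorem continuous_eta : Continuous fun τ : ℍ => ModularForm.eta τ := by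
  rw [continuous_iff_continuousAt]
  intro τ
  exact (ModularForm.differentiableAt_eta_of_mem_upperHalfPlaneSet τ.2).continuousAt.comp
    UpperHalfPlane.continuous_coe.continuousAt

/-- The quotient defining `ε` does not depend on the point. -/
theorem eta_smul (α : Metaplectic) (τ : ℍ) :
    ModularForm.eta ((α.A • τ : ℍ) : ℂ) = epsilon α * (ModularForm.eta τ * α.w τ) := by
  let g : ℍ → ℂ := fun τ => ModularForm.eta ((α.A • τ : ℍ) : ℂ) / (ModularForm.eta τ * α.w τ)
  have hne : ∀ τ : ℍ, ModularForm.eta τ * α.w τ ≠ 0 := fun τ =>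
    mul_ne_zero (ModularForm.eta_ne_zero τ.2) (α.w_ne_zero τ)
  have hg : Continuous g := by
    refine Continuous.div ?_ (continuous_eta.mul α.holo.continuous) hne
    exact continuous_eta.comp (continuous_const_smul (α.A : GL (Fin 2) ℝ))
  -- Because η²⁴ has weight 12 for the full modular group, the quotient takes values in a finite
  -- set; it is continuous on the connected space ℍ, hence constant.
  have hpow : ∀ τ, g τ ^ 24 = 1 := by
    intro τ
    simp only [g]
    rw [div_pow, eta_smul_pow, ← α.sq, mul_pow, ← pow_mul, mul_comm, div_self]
    exact mul_ne_zero (pow_ne_zero _ (ModularForm.eta_ne_zero τ.2)) (pow_ne_zero _ (α.w_ne_zero τ))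
  have hfin : ({x : ℂ | x ^ 24 = 1}).Finite := by
    refine ((Polynomial.nthRootsFinset 24 (1 : ℂ)).finite_toSet).subset fun x hx => ?_
    simpa [Polynomial.mem_nthRootsFinset] using hx
  have h := isPreconnected_univ.constant_of_mapsTo hfin.isDiscrete hg.continuousOn
    (fun τ _ => hpow τ) (Set.mem_univ τ) (Set.mem_univ UpperHalfPlane.I)
  rw [← div_eq_iff (hne τ)]
  exact h

theorem eta_add_one (τ : ℂ) : ModularForm.eta (τ + 1) = e (1 / 24) * ModularForm.eta τ := by
  have h1 : ∀ n, ModularForm.eta_q n (τ + 1) = ModularForm.eta_q n τ := by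
    intro n
    simp only [ModularForm.eta_q_eq_pow]
    rw [mul_add, mul_one, Complex.exp_add, Complex.exp_two_pi_mul_I, mul_one]
  rw [ModularForm.eta, ModularForm.eta]
  simp only [h1]
  rw [← mul_assoc, e, Function.Periodic.qParam, Function.Periodic.qParam, ← Complex.exp_add]
  congr 2
  push_cast
  ring

theorem rootS_ne_zero (τ : ℍ) : rootS τ ≠ 0 := by
  intro h
  have := rootS_sq τ
  rw [h, zero_pow two_ne_zero] at this
  exact mul_ne_zero (neg_ne_zero.2 Complex.I_ne_zero) τ.ne_zero this.symm

theorem e_quarter : e (1 / 4) = Complex.I := by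
  rw [e, show (2 * Real.pi * Complex.I * (1 / 4) : ℂ) = Real.pi / 2 * Complex.I by ring,
    Complex.exp_pi_div_two_mul_I]

theorem e_eighth_sq : e (1 / 8) ^ 2 = Complex.I := by
  rw [← e_quarter, sq, ← e_add]
  norm_num

theorem mdifferentiable_rootS : MDifferentiable 𝓘(ℂ) 𝓘(ℂ) fun τ : ℍ => rootS τ := by
  rw [UpperHalfPlane.mdifferentiable_iff]
  have h : DifferentiableOn ℂ rootS {z | 0 < z.im} := by
    intro z hz
    refine DifferentiableAt.differentiableWithinAt ?_
    refine DifferentiableAt.cpow (by fun_prop) (by fun_prop) ?_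
    left
    simpa using hz
  refine h.congr fun z hz => ?_
  simp only [Function.comp_apply]
  rw [UpperHalfPlane.ofComplex_apply_of_im_pos hz]

theorem autFactor_S (τ : ℍ) : autFactor ModularGroup.S τ = τ := by
  rw [autFactor_eq_denom, ModularGroup.denom_S]

theorem autFactor_T (τ : ℍ) : autFactor ModularGroup.T τ = 1 := by
  simp [autFactor, ModularGroup.T]

/-- The element of the metaplectic group over the inversion. -/
def mpS : Metaplectic where
  A := ModularGroup.S
  w τ := e (1 / 8) * rootS τ
  holo := mdifferentiable_const.mul mdifferentiable_rootS
  sq τ := by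
    rw [mul_pow, e_eighth_sq, rootS_sq, autFactor_S, ← mul_assoc, mul_neg, Complex.I_mul_I, neg_neg,
      one_mul]

/-- The element of the metaplectic group over the translation. -/
def mpT : Metaplectic where
  A := ModularGroup.T
  w _ := 1
  holo := mdifferentiable_const
  sq τ := by rw [autFactor_T, one_pow]

/-- The nontrivial element of the metaplectic group over the identity. -/
def mpZ : Metaplectic where
  A := 1
  w _ := -1
  holo := mdifferentiable_const
  sq τ := by simp [autFactor]

theorem coe_S_smul (τ : ℍ) : ((ModularGroup.S • τ : ℍ) : ℂ) = -1 / τ := by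
  rw [coe_smul_eq, autFactor_S]
  simp [ModularGroup.S]

theorem coe_T_smul (τ : ℍ) : ((ModularGroup.T • τ : ℍ) : ℂ) = τ + 1 := by
  rw [coe_smul_eq, autFactor_T]
  simp [ModularGroup.T]

theorem epsilon_mpS : epsilon mpS = e (-(1 / 8)) := by
  have hI : ((UpperHalfPlane.I : ℍ) : ℂ) = Complex.I := rfl
  have h := ModularForm.eta_ne_zero (UpperHalfPlane.I : ℍ).2
  rw [epsilon]
  simp only [mpS]
  rw [coe_S_smul, hI, rootS_I, e_neg, show -1 / Complex.I = Complex.I by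
    rw [div_eq_iff Complex.I_ne_zero, Complex.I_mul_I], mul_one, ← div_div, div_self, one_div]
  exact h

theorem epsilon_mpT : epsilon mpT = e (1 / 24) := by
  have h := ModularForm.eta_ne_zero (UpperHalfPlane.I : ℍ).2
  rw [epsilon]
  simp only [mpT]
  rw [coe_T_smul, eta_add_one, mul_one, mul_div_assoc, div_self h, mul_one]

theorem epsilon_mpZ : epsilon mpZ = -1 := by
  have h := ModularForm.eta_ne_zero (UpperHalfPlane.I : ℍ).2
  rw [epsilon]
  simp only [mpZ]
  rw [one_smul, mul_neg, mul_one, div_neg, div_self h]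

/-! ### Reduction of the metaplectic law to generators -/

namespace PosDefLattice

variable {L : Type*} [AddCommGroup L] (Λ : PosDefLattice L)

/-- The slash operator of weight `k` on functions on `ℍ × (ℂ ⊗ L)`. -/
def slash (k : ℤ) (A : SL(2, ℤ)) (ψ : ℍ → ℂ ⊗[ℤ] L → ℂ) : ℍ → ℂ ⊗[ℤ] L → ℂ := fun τ z =>
  ψ (A • τ) ((autFactor A τ)⁻¹ • z) * e (-((A.1 1 0 : ℤ) : ℂ) * Λ.quadC z / autFactor A τ) *
    autFactor A τ ^ (-k)

theorem slash_one (k : ℤ) (ψ : ℍ → ℂ ⊗[ℤ] L → ℂ) : Λ.slash k 1 ψ = ψ := by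
  funext τ z
  simp [slash, autFactor, e_zero]

theorem slash_mul (k : ℤ) (A B : SL(2, ℤ)) (ψ : ℍ → ℂ ⊗[ℤ] L → ℂ) :
    Λ.slash k (A * B) ψ = Λ.slash k B (Λ.slash k A ψ) := by
  funext τ z
  have hA := autFactor_ne_zero A (B • τ)
  have hB := autFactor_ne_zero B τ
  have h := lowerLeft_mul A B τ
  simp only [slash]
  rw [mul_smul, autFactor_mul, mul_zpow, quadC_smul, smul_smul (autFactor A (B • τ))⁻¹, ← mul_inv]
  have he : e (-(((A * B).1 1 0 : ℤ) : ℂ) * Λ.quadC z / (autFactor A (B • τ) * autFactor B τ)) =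
      e (-((A.1 1 0 : ℤ) : ℂ) * ((autFactor B τ)⁻¹ ^ 2 * Λ.quadC z) / autFactor A (B • τ)) *
        e (-((B.1 1 0 : ℤ) : ℂ) * Λ.quadC z / autFactor B τ) := by
    rw [← e_add]
    congr 1
    rw [autFactor_mul] at h
    field_simp
    linear_combination -Λ.quadC z * h
  rw [he]
  ring

theorem slash_eq_of_generators (k : ℤ) (ψ : ℍ → ℂ ⊗[ℤ] L → ℂ)
    (hS : Λ.slash k ModularGroup.S ψ = ψ) (hT : Λ.slash k ModularGroup.T ψ = ψ) (A : SL(2, ℤ)) :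
    Λ.slash k A ψ = ψ := by
  have hA : A ∈ Subgroup.closure {ModularGroup.S, ModularGroup.T} := by
    rw [SpecialLinearGroup.SL2Z_generators]
    trivial
  induction hA using Subgroup.closure_induction with
  | mem x hx =>
    rcases hx with rfl | rfl
    · exact hS
    · exact hT
  | one => exact Λ.slash_one _ _
  | mul x y _ _ hx hy => rw [slash_mul, hx, hy]
  | inv x _ hx =>
    conv_lhs => rw [← hx]
    rw [← slash_mul, mul_inv_cancel, slash_one]

/-- The transformation law under a single element of the metaplectic group. -/
def LawAt (κ h : ℤ) (φ : ℍ → ℂ ⊗[ℤ] L → ℂ) (α : Metaplectic) : Prop :=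
  ∀ (τ : ℍ) (z : ℂ ⊗[ℤ] L),
    φ (α.A • τ) ((autFactor α.A τ)⁻¹ • z) *
        e (-((α.A.1 1 0 : ℤ) : ℂ) * Λ.quadC z / autFactor α.A τ) * α.w τ ^ (-κ) =
      epsilon α ^ h * φ τ z

theorem epsilon_ne_zero (α : Metaplectic) : epsilon α ≠ 0 := fun h =>
  ModularForm.eta_ne_zero (α.A • UpperHalfPlane.I : ℍ).2 (by
    have := eta_smul α UpperHalfPlane.I
    rwa [h, zero_mul] at this)

/-- Division by a power of `η` turns the transformation law into invariance of integral weight. -/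
theorem lawAt_iff {κ h k : ℤ} (hk : κ = h + 2 * k) (φ : ℍ → ℂ ⊗[ℤ] L → ℂ) (α : Metaplectic) :
    Λ.LawAt κ h φ α ↔ Λ.slash k α.A (fun τ z => φ τ z * (ModularForm.eta τ ^ h)⁻¹) =
      fun τ z => φ τ z * (ModularForm.eta τ ^ h)⁻¹ := by
  have key : ∀ τ : ℍ, (ModularForm.eta ((α.A • τ : ℍ) : ℂ) ^ h)⁻¹ * autFactor α.A τ ^ (-k) =
      (epsilon α ^ h)⁻¹ * (ModularForm.eta τ ^ h)⁻¹ * α.w τ ^ (-κ) := by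
    intro τ
    have hw := α.w_ne_zero τ
    rw [eta_smul, ← α.sq, mul_zpow, mul_zpow, hk, neg_add, zpow_add₀ hw, zpow_neg, zpow_neg,
      zpow_neg, zpow_mul, ← zpow_natCast (α.w τ) 2]
    rw [mul_inv, mul_inv]
    push_cast
    ring
  have he := fun τ : ℍ => zpow_ne_zero h (ModularForm.eta_ne_zero τ.2)
  have hε := zpow_ne_zero h (epsilon_ne_zero α)
  have hs : ∀ (τ : ℍ) (z : ℂ ⊗[ℤ] L),
      Λ.slash k α.A (fun τ z => φ τ z * (ModularForm.eta τ ^ h)⁻¹) τ z =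
        (epsilon α ^ h)⁻¹ * (φ (α.A • τ) ((autFactor α.A τ)⁻¹ • z) *
          e (-((α.A.1 1 0 : ℤ) : ℂ) * Λ.quadC z / autFactor α.A τ) * α.w τ ^ (-κ)) *
            (ModularForm.eta τ ^ h)⁻¹ := by
    intro τ z
    rw [slash]
    linear_combination (φ (α.A • τ) ((autFactor α.A τ)⁻¹ • z) *
      e (-((α.A.1 1 0 : ℤ) : ℂ) * Λ.quadC z / autFactor α.A τ)) * key τ
  constructor
  · intro hl
    funext τ z
    rw [hs, hl, inv_mul_cancel_left₀ hε]
  · intro hl τ z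
    have := congrFun (congrFun hl τ) z
    rw [hs] at this
    rw [← mul_right_cancel₀ (inv_ne_zero (he τ)) this, mul_inv_cancel_left₀ hε]

/-- Division by η^h leaves an integral weight, for which the law depends only on the matrix A. Hence
the generators S and T of SL(2, ℤ) suffice, and metaplectic elements need not be multiplied. -/
theorem metaplecticLaw_of_generators {κ h : ℤ} (hκ : Even (κ - h)) {φ : ℍ → ℂ ⊗[ℤ] L → ℂ}
    (hS : Λ.LawAt κ h φ mpS) (hT : Λ.LawAt κ h φ mpT) : Λ.MetaplecticLaw κ h φ := by
  obtain ⟨k, hk⟩ := hκ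
  have hk : κ = h + 2 * k := by omega
  intro α
  exact (Λ.lawAt_iff hk φ α).2 (Λ.slash_eq_of_generators k _ ((Λ.lawAt_iff hk φ mpS).1 hS)
    ((Λ.lawAt_iff hk φ mpT).1 hT) α.A)

end PosDefLattice

/-! ### Theta expansion of Jacobi forms -/

theorem _root_.HasSum.of_eq {ι : Type*} {f g : ι → ℂ} {a : ℂ} (hf : HasSum f a)
    (h : ∀ i, f i = g i) : HasSum g a := funext h ▸ hf

namespace PosDefLattice

variable {L : Type*} [AddCommGroup L] (Λ : PosDefLattice L)

/-- The representative in `[0, 1)` of the exponents mod `ℤ` of the theta coefficients. -/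
def expo (ρ : Λ.shadow) (h : ℤ) (d : Λ.Disc) : ℚ :=
  Int.fract ((h : ℚ) / 24 - Λ.quadQ ((ρ : ℚ ⊗[ℤ] L) + Λ.rep d))

theorem expo_nonneg (ρ : Λ.shadow) (h : ℤ) (d : Λ.Disc) : 0 ≤ Λ.expo ρ h d := Int.fract_nonneg _

theorem exists_quadQ_add_expo (ρ : Λ.shadow) (h : ℤ) (x : Λ.dual) :
    ∃ m : ℤ, Λ.quadQ ((ρ : ℚ ⊗[ℤ] L) + x) + Λ.expo ρ h (Λ.toDisc x) = (h : ℚ) / 24 + m := by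
  obtain ⟨m, hm⟩ := (e_ratCast_eq_iff _ _).1
    (Λ.e_quadQ_shadow_congr ρ (Λ.toDisc_rep (Λ.toDisc x)).symm)
  refine ⟨m - ⌊(h : ℚ) / 24 - Λ.quadQ ((ρ : ℚ ⊗[ℤ] L) + Λ.rep (Λ.toDisc x))⌋, ?_⟩
  rw [hm, expo, Int.fract]
  push_cast
  ring

/-- Under τ ↦ τ + 1 the theta function contributes the first factor and its coefficient the second;
together they give the value of ε^h at T. -/
theorem e_quadQ_mul_e_expo (ρ : Λ.shadow) (h : ℤ) (d : Λ.Disc) :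
    e (Λ.quadQ ((ρ : ℚ ⊗[ℤ] L) + Λ.rep d)) * e (Λ.expo ρ h d) = e (1 / 24) ^ h := by
  obtain ⟨m, hm⟩ := Λ.exists_quadQ_add_expo ρ h (Λ.rep d)
  rw [toDisc_rep] at hm
  rw [← e_add, ← Rat.cast_add, hm, ← e_int_mul]
  push_cast
  rw [e_add_int]
  congr 1
  ring

/-- The indices of the Fourier expansion, sorted by the elements of the shadow. -/
def fourierEquiv (ρ : Λ.shadow) (h : ℤ) : Λ.dual × ℕ ≃ Λ.FourierIndex h :=
  Equiv.ofBijective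
    (fun p => ⟨(Λ.quadQ ((ρ : ℚ ⊗[ℤ] L) + p.1) + Λ.expo ρ h (Λ.toDisc p.1) + p.2, ρ + p.1), by
      refine ⟨?_, (Λ.shadowAdd ρ p.1).2, ?_⟩
      · obtain ⟨m, hm⟩ := Λ.exists_quadQ_add_expo ρ h p.1
        exact ⟨m + p.2, by rw [hm]; push_cast; ring⟩
      · have := Λ.expo_nonneg ρ h (Λ.toDisc p.1)
        have h2 : (0 : ℚ) ≤ p.2 := p.2.cast_nonneg
        simp only
        linarith⟩)
    (by
      constructor
      · rintro ⟨x, m⟩ ⟨y, k⟩ hxy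
        have h1 := congrArg Subtype.val hxy
        simp only [Prod.mk.injEq] at h1
        obtain rfl : x = y := Subtype.ext (add_left_cancel h1.2)
        have : (m : ℚ) = k := add_left_cancel h1.1
        rw [Nat.cast_injective this]
      · rintro ⟨⟨n, r⟩, ⟨m, hm⟩, hr, hn⟩
        obtain ⟨x, hx⟩ := (Λ.shadowEquiv ρ).surjective ⟨r, hr⟩
        have hx : (ρ : ℚ ⊗[ℤ] L) + x = r := congrArg Subtype.val hx
        obtain ⟨k, hk⟩ := Λ.exists_quadQ_add_expo ρ h x
        simp only at hm hn
        have hlt : Λ.expo ρ h (Λ.toDisc x) < 1 := Int.fract_lt_one _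
        -- The integer m - k is n - β(r) minus an exponent in [0, 1), so n ≥ β(r) makes it greater
        -- than -1.
        have hpos : 0 ≤ m - k := by
          have h2 : (-1 : ℚ) < ((m - k : ℤ) : ℚ) := by
            push_cast
            rw [hx] at hk
            linarith
          have h3 : -1 < m - k := by exact_mod_cast h2
          omega
        obtain ⟨j, hj⟩ := Int.eq_ofNat_of_zero_le hpos
        refine ⟨(x, j), Subtype.ext (Prod.ext ?_ hx)⟩
        simp only
        have h4 : (j : ℚ) = m - k := by
          have : ((j : ℤ) : ℚ) = ((m - k : ℤ) : ℚ) := by rw [hj]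
          push_cast at this
          exact this
        rw [hk, h4, hm]
        ring)

theorem fourierEquiv_term (ρ : Λ.shadow) (h : ℤ) (x : Λ.dual) (m : ℕ) (t τ : ℂ) (z : ℂ ⊗[ℤ] L) :
    t * e (((Λ.fourierEquiv ρ h (x, m)).1.1 : ℂ) * τ) *
        e (Λ.formC z (inclC L (Λ.fourierEquiv ρ h (x, m)).1.2)) =
      t * e ((Λ.expo ρ h (Λ.toDisc x) + m) * τ) * Λ.term τ z (ρ + x) := by
  have h1 : (Λ.fourierEquiv ρ h (x, m)).1.1 =
    Λ.quadQ ((ρ : ℚ ⊗[ℤ] L) + x) + Λ.expo ρ h (Λ.toDisc x) + m := rfl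
  have h2 : (Λ.fourierEquiv ρ h (x, m)).1.2 = ρ + x := rfl
  rw [h1, h2, term, Λ.formC_symm z]
  push_cast
  rw [show ((Λ.quadQ ((ρ : ℚ ⊗[ℤ] L) + x) : ℂ) + Λ.expo ρ h (Λ.toDisc x) + m) * τ =
    (Λ.quadQ ((ρ : ℚ ⊗[ℤ] L) + x) : ℂ) * τ + (Λ.expo ρ h (Λ.toDisc x) + m) * τ by ring, e_add]
  ring

/-- Translation by τx moves the index r to r + x, and translation by y contributes e(β(r, y)) =
e(β(y)) because r lies in the shadow. -/
theorem term_lattice_add (τ : ℂ) (z : ℂ ⊗[ℤ] L) (r : Λ.shadow) (x y : L) :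
    Λ.term τ (z + τ ⊗ₜ[ℤ] x + (1 : ℂ) ⊗ₜ[ℤ] y) r *
        e (τ * (Λ.quad x : ℂ) + Λ.formC ((1 : ℂ) ⊗ₜ[ℤ] x) z) =
      e (Λ.quad y) * Λ.term τ z (r + inclQ L x) := by
  have h1 : τ ⊗ₜ[ℤ] x = τ • inclC L (inclQ L x) := by
    rw [inclC_inclQ, TensorProduct.smul_tmul', smul_eq_mul, mul_one]
  rw [h1, ← inclC_inclQ, ← inclC_inclQ, term_add_arg, Λ.formQ_symm _ (r : ℚ ⊗[ℤ] L), e_formQ_shadow]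
  have key : Λ.term τ (z + τ • inclC L (inclQ L x)) r *
      e (τ * (Λ.quad x : ℂ) + Λ.formC (inclC L (inclQ L x)) z) = Λ.term τ z (r + inclQ L x) := by
    simp only [term, ← e_add]
    congr 1
    simp only [quadQ_add, quadQ_inclQ, map_add, map_smul, LinearMap.add_apply, formC_inclC,
      smul_eq_mul]
    push_cast
    ring
  linear_combination e (Λ.quad y) * key

/-- A vector of functions on `ℍ`, indexed by `L^# / L`, that is the vector of theta coefficients
of a Jacobi form. -/
structure IsThetaVector [Fintype Λ.Disc] (ρ : Λ.shadow) (C : ℝ) (κ h : ℤ) (F : ℍ → Λ.Disc → ℂ) :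
    Prop where
  expansion : ∀ d, ∃ a : ℕ → ℂ, ∀ τ : ℍ,
    HasSum (fun m : ℕ => a m * e ((Λ.expo ρ h d + m) * τ)) (F τ d)
  inversion : ∀ τ : ℍ, (C * (rootS (ModularGroup.S • τ : ℍ) ^ Module.finrank ℤ L)⁻¹ *
    (e (1 / 8) * rootS τ) ^ (-κ)) • Λ.kernelOp ρ (-1) (F (ModularGroup.S • τ)) =
      e (-(1 / 8)) ^ h • F τ
  parity : F = 0 ∨ Even (κ - h)

variable {Λ} in
-- The element (1, -1) fixes (τ, z), acts through the weight by (-1)^κ, and has character value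
-- (-1)^h.
theorem even_of_lawAt_mpZ {κ h : ℤ} {φ : ℍ → ℂ ⊗[ℤ] L → ℂ} (hφ : Λ.LawAt κ h φ mpZ) :
    φ = 0 ∨ Even (κ - h) := by
  rcases Int.even_or_odd (κ - h) with hκ | hκ
  · exact Or.inr hκ
  left
  funext τ z
  have := hφ τ z
  rw [epsilon_mpZ] at this
  simp only [mpZ, autFactor] at this
  simp only [one_smul, Matrix.SpecialLinearGroup.coe_one, Matrix.one_apply_ne (one_ne_zero' (Fin 2)),
    Matrix.one_apply_eq, Int.cast_zero, Int.cast_one, zero_mul, zero_add, inv_one, neg_zero,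
    zero_div, e_zero, mul_one] at this
  have h1 : (-1 : ℂ) ^ (-κ) = -(-1) ^ h := by
    rcases Int.even_or_odd h with hh | hh
    · rw [hh.neg_one_zpow, Odd.neg_one_zpow]
      rw [odd_neg]
      have := hκ.add_even hh
      rwa [sub_add_cancel] at this
    · rw [hh.neg_one_zpow, neg_neg, Even.neg_one_zpow]
      rw [even_neg]
      have := hκ.add_odd hh
      rwa [sub_add_cancel] at this
  have h2 : (-1 : ℂ) ^ h ≠ 0 := zpow_ne_zero _ (by norm_num)
  rw [h1] at this
  have h3 : (2 * (-1 : ℂ) ^ h) * φ τ z = 0 := by linear_combination -this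
  exact (mul_eq_zero.1 h3).resolve_left (mul_ne_zero two_ne_zero h2)

variable {Λ} in
theorem HasFourier.hasSum_prod (ρ : Λ.shadow) {h : ℤ} {c : Λ.FourierIndex h → ℂ}
    {φ : ℍ → ℂ ⊗[ℤ] L → ℂ} (hc : Λ.HasFourier h c φ) (τ : ℍ) (z : ℂ ⊗[ℤ] L) :
    HasSum (fun p : Λ.dual × ℕ => c (Λ.fourierEquiv ρ h p) *
      e ((Λ.expo ρ h (Λ.toDisc p.1) + p.2) * τ) * Λ.term τ z (ρ + p.1)) (φ τ z) := by
  have h1 := (Λ.fourierEquiv ρ h).hasSum_iff.2 (hc τ z)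
  refine h1.of_eq fun p => ?_
  obtain ⟨x, m⟩ := p
  exact Λ.fourierEquiv_term ρ h x m _ τ z

variable {Λ} in
-- Unconditional convergence permits summing first over the powers of q that belong to one element
-- of the shadow. The theta term is a nonzero common factor, so each inner series converges by
-- itself.
theorem exists_coeff (ρ : Λ.shadow) {h : ℤ} {c' : Λ.dual × ℕ → ℂ} {φ : ℍ → ℂ ⊗[ℤ] L → ℂ}
    (h1 : ∀ (τ : ℍ) z, HasSum (fun p : Λ.dual × ℕ => c' p *
      e ((Λ.expo ρ h (Λ.toDisc p.1) + p.2) * τ) * Λ.term τ z (ρ + p.1)) (φ τ z)) :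
    ∃ G : Λ.dual → ℍ → ℂ,
      (∀ (x : Λ.dual) (τ : ℍ), HasSum (fun m : ℕ => c' (x, m) *
        e ((Λ.expo ρ h (Λ.toDisc x) + m) * τ)) (G x τ)) ∧
      ∀ (τ : ℍ) z, HasSum (fun x : Λ.dual => G x τ * Λ.term τ z (ρ + x)) (φ τ z) := by
  have h2 : ∀ (x : Λ.dual) (τ : ℍ), Summable (fun m : ℕ => c' (x, m) *
      e ((Λ.expo ρ h (Λ.toDisc x) + m) * τ)) := by
    intro x τ
    have := (h1 τ 0).summable.prod_factor x
    exact (summable_mul_right_iff (Λ.term_ne_zero τ 0 (ρ + x))).1 this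
  refine ⟨fun x τ => ∑' m : ℕ, c' (x, m) * e ((Λ.expo ρ h (Λ.toDisc x) + m) * τ),
    fun x τ => (h2 x τ).hasSum, fun τ z => ?_⟩
  have h3 : ∀ x : Λ.dual, HasSum (fun m : ℕ => c' (x, m) *
      e ((Λ.expo ρ h (Λ.toDisc x) + m) * τ) * Λ.term τ z (ρ + x))
        ((∑' m : ℕ, c' (x, m) * e ((Λ.expo ρ h (Λ.toDisc x) + m) * τ)) * Λ.term τ z (ρ + x)) :=
    fun x => (h2 x τ).hasSum.mul_right _
  exact HasSum.prod_fiberwise (h1 τ z) h3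

variable [Module.Free ℤ L] [Module.Finite ℤ L]

variable {Λ}

/-- Inversion of the theta part of a theta expansion. -/
theorem IsInversionConst.discTheta_S {C : ℝ} (hC : Λ.IsInversionConst C) (ρ : Λ.shadow)
    (b : Λ.Disc → ℂ) (τ : ℍ) (z : ℂ ⊗[ℤ] L) :
    Λ.discTheta ρ b (ModularGroup.S • τ : ℍ) ((τ : ℂ)⁻¹ • z) * e (-Λ.quadC z / τ) =
      C * (rootS (ModularGroup.S • τ : ℍ) ^ Module.finrank ℤ L)⁻¹ *
        Λ.discTheta ρ (Λ.kernelOp ρ (-1) b) τ z := by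
  have h0 := τ.ne_zero
  -- The sign -1 makes the arguments return to (τ, z) rather than to (τ, -z).
  rw [hC.discTheta ρ b (-1) (ModularGroup.S • τ), quadC_smul, smul_smul, coe_S_smul]
  have h1 : -1 / (-1 / (τ : ℂ)) = τ := by field_simp
  have h2 : ((((-1 : ℤˣ) : ℤ) : ℂ) / (-1 / (τ : ℂ))) * (τ : ℂ)⁻¹ = 1 := by
    push_cast
    field_simp
  have h3 : e (-((τ : ℂ)⁻¹ ^ 2 * Λ.quadC z) / (-1 / (τ : ℂ))) * e (-Λ.quadC z / τ) = 1 := by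
    rw [← e_add]
    convert e_zero using 2
    field_simp
    ring
  rw [h1, h2, one_smul]
  linear_combination (C * (rootS (-1 / τ) ^ Module.finrank ℤ L)⁻¹ *
    Λ.discTheta ρ (Λ.kernelOp ρ (-1) b) τ z) * h3

/-- Linear independence of the theta functions turns the law for S into a law for the coefficients
alone, in a form that can be compared between lattices. -/
theorem lawAt_mpS_iff {C : ℝ} (hC : Λ.IsInversionConst C) (ρ : Λ.shadow) (κ h : ℤ)
    (F : ℍ → Λ.Disc → ℂ) :
    Λ.LawAt κ h (fun τ z => Λ.discTheta ρ (F τ) τ z) mpS ↔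
      ∀ τ : ℍ, (C * (rootS (ModularGroup.S • τ : ℍ) ^ Module.finrank ℤ L)⁻¹ *
        (e (1 / 8) * rootS τ) ^ (-κ)) • Λ.kernelOp ρ (-1) (F (ModularGroup.S • τ)) =
          e (-(1 / 8)) ^ h • F τ := by
  have hS : (ModularGroup.S.1 1 0 : ℤ) = 1 := by simp [ModularGroup.S]
  have key : ∀ (τ : ℍ) (z : ℂ ⊗[ℤ] L),
      Λ.discTheta ρ (F (mpS.A • τ)) (mpS.A • τ : ℍ) ((autFactor mpS.A τ)⁻¹ • z) *
        e (-((mpS.A.1 1 0 : ℤ) : ℂ) * Λ.quadC z / autFactor mpS.A τ) * mpS.w τ ^ (-κ) =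
      Λ.discTheta ρ ((C * (rootS (ModularGroup.S • τ : ℍ) ^ Module.finrank ℤ L)⁻¹ *
        (e (1 / 8) * rootS τ) ^ (-κ)) • Λ.kernelOp ρ (-1) (F (ModularGroup.S • τ))) τ z := by
    intro τ z
    simp only [mpS]
    rw [autFactor_S, hS, discTheta_smul, Int.cast_one, neg_one_mul, hC.discTheta_S]
    ring
  constructor
  · intro hl τ
    rw [← sub_eq_zero]
    refine Λ.discTheta_injective ρ τ.im_pos _ fun z => ?_
    have := hl τ z
    rw [key, epsilon_mpS, ← discTheta_smul] at this
    rw [sub_eq_add_neg, ← neg_one_smul ℂ (e _ ^ h • F τ), Λ.discTheta_add ρ _ _ τ.im_pos, this,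
      discTheta_smul ρ (-1)]
    ring
  · intro hl τ z
    change Λ.discTheta ρ (F (mpS.A • τ)) (mpS.A • τ : ℍ) _ * _ * _ = _
    rw [key, hl, discTheta_smul, epsilon_mpS]

/-- The expansion at z + τl, reindexed by a shift by l, is compared coefficientwise with the
expansion at z; the sign changes sides because e(β(l))² = 1. -/
theorem coeff_add_lattice (ρ : Λ.shadow) {τ : ℂ} {G : Λ.dual → ℂ} {ψ : ℂ ⊗[ℤ] L → ℂ}
    (hG : ∀ z, HasSum (fun x : Λ.dual => G x * Λ.term τ z (ρ + x)) (ψ z)) {l : L}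
    (hψ : ∀ z, ψ (z + τ ⊗ₜ[ℤ] l + (1 : ℂ) ⊗ₜ[ℤ] (0 : L)) *
        e (τ * (Λ.quad l : ℂ) + Λ.formC ((1 : ℂ) ⊗ₜ[ℤ] l) z) = e (Λ.quad l : ℂ) * ψ z)
    (x : Λ.dual) : G (x + Λ.inclDual l) = e (Λ.quad l) * G x := by
  have hz : ∀ z, HasSum (fun x : Λ.dual => (G (x - Λ.inclDual l) - e (Λ.quad l) * G x) *
      Λ.term τ z (ρ + x)) 0 := by
    intro z
    have e1 := (hG (z + τ ⊗ₜ[ℤ] l + (1 : ℂ) ⊗ₜ[ℤ] (0 : L))).mul_right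
      (e (τ * (Λ.quad l : ℂ) + Λ.formC ((1 : ℂ) ⊗ₜ[ℤ] l) z))
    rw [hψ z, ← (Equiv.subRight (Λ.inclDual l)).hasSum_iff] at e1
    have e3 := e1.sub ((hG z).mul_left (e (Λ.quad l)))
    rw [sub_self] at e3
    refine e3.of_eq fun x => ?_
    have hq : (Λ.quad 0 : ℂ) = 0 := by simp [quad]
    have hx : (ρ : ℚ ⊗[ℤ] L) + (x - Λ.inclDual l : Λ.dual) + inclQ L l = ρ + x := by
      rw [AddSubgroup.coe_sub, coe_inclDual]
      abel
    have := Λ.term_lattice_add τ z (Λ.shadowAdd ρ (x - Λ.inclDual l)) l 0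
    rw [hq, e_zero, one_mul, show ((Λ.shadowAdd ρ (x - Λ.inclDual l) : Λ.shadow) : ℚ ⊗[ℤ] L) =
      ρ + (x - Λ.inclDual l : Λ.dual) from rfl, hx] at this
    simp only [Function.comp_apply, Equiv.subRight_apply]
    rw [mul_assoc (G _), this]
    ring
  have h0 := congrFun (Λ.eq_zero_of_tsum_term_eq_zero ρ τ _ (fun z => (hz z).summable)
    fun z => (hz z).tsum_eq) (x + Λ.inclDual l)
  simp only [add_sub_cancel_right, Pi.zero_apply] at h0
  linear_combination (-e (Λ.quad l)) * h0 - G (x + Λ.inclDual l) * Λ.e_quad_add_self l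

/-- The theta expansion of Jacobi forms. -/
theorem exists_isThetaVector {C : ℝ} (hC : Λ.IsInversionConst C) (ρ : Λ.shadow) {κ h : ℤ}
    {φ : ℍ → ℂ ⊗[ℤ] L → ℂ} (hφ : φ ∈ JacobiForms κ Λ h) :
    ∃ F, Λ.IsThetaVector ρ C κ h F ∧ φ = fun τ z => Λ.discTheta ρ (F τ) τ z := by
  obtain ⟨-, hmp, hlat, c, hc⟩ := hφ
  obtain ⟨c', h1⟩ : ∃ c' : Λ.dual × ℕ → ℂ, ∀ (τ : ℍ) z, HasSum (fun p : Λ.dual × ℕ => c' p *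
      e ((Λ.expo ρ h (Λ.toDisc p.1) + p.2) * τ) * Λ.term τ z (ρ + p.1)) (φ τ z) :=
    ⟨_, hc.hasSum_prod ρ⟩
  obtain ⟨G, h2, h3⟩ := exists_coeff ρ h1
  have h4 : ∀ (l : L) (x : Λ.dual) (τ : ℍ), G (x + Λ.inclDual l) τ = e (Λ.quad l) * G x τ :=
    fun l x τ => coeff_add_lattice ρ (h3 τ) (fun z => (hlat l 0 τ z).trans (by rw [add_zero])) x
  -- Removing e(β(x)) from the coefficient at ρ + x leaves a function of the class of x, by `h4`.
  let F : ℍ → Λ.Disc → ℂ := fun τ d => (e (Λ.quadQ (Λ.rep d : ℚ ⊗[ℤ] L)))⁻¹ * G (Λ.rep d) τ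
  have h5 : ∀ (x : Λ.dual) τ, G x τ = e (Λ.quadQ (x : ℚ ⊗[ℤ] L)) * F τ (Λ.toDisc x) := by
    intro x τ
    obtain ⟨l, hl⟩ := (Λ.toDisc_eq_iff _ _).1 (Λ.toDisc_rep (Λ.toDisc x))
    have hx : x = Λ.rep (Λ.toDisc x) + Λ.inclDual l := Subtype.ext hl
    simp only [F]
    rw [hl, e_quadQ_add_inclQ, mul_right_comm, mul_inv_cancel_left₀ (e_ne_zero _), mul_comm, ← h4,
      ← hx]
  have h6 : φ = fun τ z => Λ.discTheta ρ (F τ) τ z := by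
    funext τ z
    rw [← (h3 τ z).tsum_eq, discTheta]
    exact tsum_congr fun x => by rw [h5]
  refine ⟨F, ⟨fun d => ?_, ?_, ?_⟩, h6⟩
  · refine ⟨fun m => (e (Λ.quadQ (Λ.rep d : ℚ ⊗[ℤ] L)))⁻¹ * c' (Λ.rep d, m),
      fun τ => ?_⟩
    have := (h2 (Λ.rep d) τ).mul_left (e (Λ.quadQ (Λ.rep d : ℚ ⊗[ℤ] L)))⁻¹
    simp only [toDisc_rep, ← mul_assoc] at this
    exact this
  · rw [← lawAt_mpS_iff hC, ← h6]
    exact hmp mpS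
  · refine (even_of_lawAt_mpZ (hmp mpZ)).imp_left fun h0 => ?_
    funext τ
    refine Λ.discTheta_injective ρ τ.im_pos _ fun z => ?_
    have := congrFun (congrFun h6 τ) z
    rw [h0] at this
    exact this.symm

end PosDefLattice

/-- Functions with a one-sided Fourier expansion on `ℍ` are holomorphic. -/
theorem mdifferentiable_of_hasSum {q : ℚ} (hq : 0 ≤ q) {a : ℕ → ℂ} {f : ℍ → ℂ}
    (hf : ∀ τ : ℍ, HasSum (fun m : ℕ => a m * e ((q + m) * τ)) (f τ)) :
    MDifferentiable 𝓘(ℂ) 𝓘(ℂ) f := by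
  rw [UpperHalfPlane.mdifferentiable_iff]
  have key : DifferentiableOn ℂ (fun t : ℂ => ∑' m : ℕ, a m * e ((q + m) * t)) {t | 0 < t.im} := by
    intro t₀ ht₀
    have ht₀ : 0 < t₀.im := ht₀
    -- All exponents are nonnegative, so the series at a point of half the height dominates termwise
    -- on the half plane above that height.
    let τ₁ : ℍ := ⟨(t₀.im / 2 : ℝ) * Complex.I, by simpa using half_pos ht₀⟩
    have hopen : IsOpen {t : ℂ | t₀.im / 2 < t.im} := isOpen_lt continuous_const Complex.continuous_im
    have h := Complex.differentiableOn_tsum_of_summable_norm (hf τ₁).summable.norm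
      (fun m => ((differentiable_e.comp
        (differentiable_id.const_mul ((q : ℂ) + m))).const_mul (a m)).differentiableOn
          (s := {t : ℂ | t₀.im / 2 < t.im})) hopen (by
        intro m t ht
        simp only [Function.comp_apply, id_eq, norm_mul]
        refine mul_le_mul_of_nonneg_left ?_ (norm_nonneg _)
        rw [norm_e, norm_e, Real.exp_le_exp]
        have hqm : (0 : ℝ) ≤ (q : ℝ) + m := by positivity
        have hre : ∀ s : ℂ, (((q : ℂ) + m) * s).im = ((q : ℝ) + m) * s.im := by
          intro s
          have : ((q : ℂ) + m) = (((q : ℝ) + m : ℝ) : ℂ) := by push_cast; rfl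
          rw [this, Complex.im_ofReal_mul]
        rw [hre, hre]
        have h1 : ((τ₁ : ℍ) : ℂ).im = t₀.im / 2 := by simp [τ₁]
        rw [h1]
        have ht : t₀.im / 2 < t.im := ht
        have h2 : ((q : ℝ) + m) * (t₀.im / 2) ≤ ((q : ℝ) + m) * t.im :=
          mul_le_mul_of_nonneg_left ht.le hqm
        have h3 : 0 ≤ 2 * Real.pi := by positivity
        nlinarith [mul_le_mul_of_nonneg_left h2 h3])
    exact ((h t₀ (half_lt_self ht₀)).differentiableAt
      (hopen.mem_nhds (half_lt_self ht₀))).differentiableWithinAt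
  refine key.congr fun t ht => ?_
  rw [Function.comp_apply, ← (hf _).tsum_eq, UpperHalfPlane.ofComplex_apply_of_im_pos ht]

/-! ### From theta vectors back to Jacobi forms -/

namespace PosDefLattice

variable {L : Type*} [AddCommGroup L] {Λ : PosDefLattice L}

theorem discTheta_lattice_add (ρ : Λ.shadow) (b : Λ.Disc → ℂ) (τ : ℂ) (x y : L) (z : ℂ ⊗[ℤ] L) :
    Λ.discTheta ρ b τ (z + τ ⊗ₜ[ℤ] x + (1 : ℂ) ⊗ₜ[ℤ] y) *
        e (τ * (Λ.quad x : ℂ) + Λ.formC ((1 : ℂ) ⊗ₜ[ℤ] x) z) =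
      e (Λ.quad (x + y) : ℂ) * Λ.discTheta ρ b τ z := by
  rw [discTheta, discTheta, ← tsum_mul_right, ← tsum_mul_left]
  conv_rhs => rw [← (Equiv.addRight (Λ.inclDual x)).tsum_eq]
  refine tsum_congr fun w => ?_
  simp only [Equiv.coe_addRight]
  have h1 := Λ.term_lattice_add τ z (Λ.shadowAdd ρ w) x y
  rw [show ((Λ.shadowAdd ρ w : Λ.shadow) : ℚ ⊗[ℤ] L) = ρ + w from rfl] at h1
  have h2 : Λ.toDisc (w + Λ.inclDual x) = Λ.toDisc w :=
    ((Λ.toDisc_eq_iff _ _).2 ⟨x, by rw [AddSubgroup.coe_add, coe_inclDual]⟩).symm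
  rw [mul_assoc, h1, h2, AddSubgroup.coe_add, coe_inclDual, e_quadQ_add_inclQ, e_quad_add, add_assoc]
  linear_combination (-e (Λ.quadQ w) * b (Λ.toDisc w) * e (Λ.quad y) *
    Λ.term τ z (ρ + (w + inclQ L x))) * Λ.e_quad_add_self x

variable [Module.Free ℤ L] [Module.Finite ℤ L]

variable (Λ) in
theorem discTheta_eq_sum_single (ρ : Λ.shadow) (b : Λ.Disc → ℂ) {τ : ℂ} (hτ : 0 < τ.im)
    (z : ℂ ⊗[ℤ] L) : open Classical in
    Λ.discTheta ρ b τ z = ∑ d, b d * Λ.discTheta ρ (Pi.single d 1) τ z := by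
  classical
  rw [Λ.discTheta_eq_sum ρ b hτ]
  refine Finset.sum_congr rfl fun d _ => ?_
  rw [Λ.discTheta_eq_sum ρ _ hτ, Finset.sum_eq_single d]
  · rw [Pi.single_eq_same, one_mul]
  · intro d' _ hd
    rw [Pi.single_eq_of_ne hd, zero_mul]
  · simp

namespace IsThetaVector

variable {ρ : Λ.shadow} {C : ℝ} {κ h : ℤ}
  {F : ℍ → Λ.Disc → ℂ}

theorem mdifferentiable (hF : Λ.IsThetaVector ρ C κ h F) (d : Λ.Disc) :
    MDifferentiable 𝓘(ℂ) 𝓘(ℂ) fun τ => F τ d := by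
  obtain ⟨a, ha⟩ := hF.expansion d
  exact mdifferentiable_of_hasSum (Λ.expo_nonneg ρ h d) ha

theorem map_T (hF : Λ.IsThetaVector ρ C κ h F) (τ : ℍ) (d : Λ.Disc) :
    F (ModularGroup.T • τ) d = e (Λ.expo ρ h d) * F τ d := by
  obtain ⟨a, ha⟩ := hF.expansion d
  refine (ha _).unique (((ha τ).mul_left (e (Λ.expo ρ h d))).of_eq fun m => ?_)
  rw [coe_T_smul, mul_add, mul_one, e_add, e_add]
  have := e_int m
  push_cast at this
  rw [this]
  ring

theorem isHolo (hF : Λ.IsThetaVector ρ C κ h F) :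
    IsHolo fun τ z => Λ.discTheta ρ (F τ) τ z := by
  classical
  have h1 : DifferentiableOn ℂ (fun p : ℂ × (Fin (Module.finrank ℤ L) → ℂ) =>
      ∑ d, F (UpperHalfPlane.ofComplex p.1) d * Λ.discTheta ρ (Pi.single d 1) p.1 (ofCoords L p.2))
      {p | 0 < p.1.im} := by
    refine DifferentiableOn.fun_sum fun d _ => ?_
    refine DifferentiableOn.mul ?_ (Λ.differentiableOn_discTheta ρ _)
    exact (UpperHalfPlane.mdifferentiable_iff.1 (hF.mdifferentiable d)).comp
      differentiableOn_fst fun p hp => hp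
  refine h1.congr fun p hp => ?_
  have hp : 0 < p.1.im := hp
  dsimp only
  rw [Λ.discTheta_eq_sum_single ρ _ (UpperHalfPlane.im_pos _),
    UpperHalfPlane.ofComplex_apply_of_im_pos hp]

theorem hasFourier (hF : Λ.IsThetaVector ρ C κ h F) :
    ∃ c, Λ.HasFourier h c fun τ z => Λ.discTheta ρ (F τ) τ z := by
  choose a ha using hF.expansion
  let c' : Λ.dual × ℕ → ℂ := fun p => e (Λ.quadQ (p.1 : ℚ ⊗[ℤ] L)) * a (Λ.toDisc p.1) p.2
  have key : ∀ (τ : ℍ) z, HasSum (fun p : Λ.dual × ℕ => c' p *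
      e ((Λ.expo ρ h (Λ.toDisc p.1) + p.2) * τ) * Λ.term τ z (ρ + p.1))
        (Λ.discTheta ρ (F τ) τ z) := by
    intro τ z
    have hfib : ∀ x : Λ.dual, HasSum (fun m : ℕ => c' (x, m) *
        e ((Λ.expo ρ h (Λ.toDisc x) + m) * τ) * Λ.term τ z (ρ + x))
          (e (Λ.quadQ (x : ℚ ⊗[ℤ] L)) * F τ (Λ.toDisc x) * Λ.term τ z (ρ + x)) := by
      intro x
      refine (((ha (Λ.toDisc x) τ).mul_left (e (Λ.quadQ (x : ℚ ⊗[ℤ] L)))).mul_right _).of_eq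
        fun m => ?_
      simp only [c']
      ring
    have hs : Summable (fun p : Λ.dual × ℕ => c' p *
        e ((Λ.expo ρ h (Λ.toDisc p.1) + p.2) * τ) * Λ.term τ z (ρ + p.1)) := by
      refine Summable.of_norm ?_
      rw [summable_prod_of_nonneg fun _ => norm_nonneg _]
      refine ⟨fun x => (hfib x).summable.norm, ?_⟩
      -- Apart from the norm of the theta term, the inner sum of norms depends only on the class of
      -- x. Finitely many classes give a uniform bound, and the theta series converges absolutely.
      let B : Λ.Disc → ℝ := fun d => ∑' m : ℕ, ‖a d m * e ((Λ.expo ρ h d + m) * τ)‖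
      obtain ⟨M, hM⟩ := (Set.finite_range B).bddAbove
      refine Summable.of_nonneg_of_le (fun _ => tsum_nonneg fun _ => norm_nonneg _) (fun x => ?_)
        ((Λ.summable_term_coset ρ τ.im_pos z).mul_left M)
      have h1 : ∀ m : ℕ, ‖c' (x, m) * e ((Λ.expo ρ h (Λ.toDisc x) + m) * τ) * Λ.term τ z (ρ + x)‖ =
          ‖a (Λ.toDisc x) m * e ((Λ.expo ρ h (Λ.toDisc x) + m) * τ)‖ * ‖Λ.term τ z (ρ + x)‖ := by
        intro m
        simp only [c', norm_mul, norm_e_ratCast, one_mul]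
      simp only [h1]
      rw [tsum_mul_right]
      exact mul_le_mul_of_nonneg_right (hM ⟨_, rfl⟩) (norm_nonneg _)
    have h2 := hs.hasSum.prod_fiberwise hfib
    have h3 := h2.tsum_eq
    rw [discTheta, h3]
    exact hs.hasSum
  refine ⟨fun p => c' ((Λ.fourierEquiv ρ h).symm p), fun τ z => ?_⟩
  refine (Λ.fourierEquiv ρ h).hasSum_iff.1 ((key τ z).of_eq fun p => ?_)
  obtain ⟨x, m⟩ := p
  rw [Function.comp_apply, Λ.fourierEquiv_term ρ h x m]
  beta_reduce
  rw [Equiv.symm_apply_apply]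

theorem lawAt_mpT (hF : Λ.IsThetaVector ρ C κ h F) :
    Λ.LawAt κ h (fun τ z => Λ.discTheta ρ (F τ) τ z) mpT := by
  intro τ z
  have hT : (ModularGroup.T.1 1 0 : ℤ) = 0 := by simp [ModularGroup.T]
  rw [epsilon_mpT]
  simp only [mpT]
  rw [autFactor_T, hT, inv_one, one_smul, Int.cast_zero, neg_zero, zero_mul, zero_div, e_zero,
    mul_one, one_zpow, mul_one, coe_T_smul, discTheta_add_one, ← discTheta_smul]
  congr 1
  funext d
  rw [hF.map_T, ← mul_assoc, e_quadQ_mul_e_expo, Pi.smul_apply, smul_eq_mul]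

/-- Theta vectors give Jacobi forms. -/
theorem mem_jacobiForms (hC : Λ.IsInversionConst C) (hF : Λ.IsThetaVector ρ C κ h F) :
    (fun τ z => Λ.discTheta ρ (F τ) τ z) ∈ JacobiForms κ Λ h := by
  rcases hF.parity with h0 | heven
  · have : (fun (τ : ℍ) z => Λ.discTheta ρ (F τ) τ z) = 0 := by
      funext τ z
      simp [h0, discTheta]
    rw [this]
    exact zero_mem _
  · exact ⟨hF.isHolo, Λ.metaplecticLaw_of_generators heven ((lawAt_mpS_iff hC ρ κ h F).2 hF.inversion)
      hF.lawAt_mpT, fun x y τ z => discTheta_lattice_add ρ _ _ x y z, hF.hasFourier⟩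

end IsThetaVector

end PosDefLattice

/-! ### Spaces of theta vectors -/

theorem rootS_S_smul (τ : ℍ) : rootS (ModularGroup.S • τ : ℍ) = (rootS τ)⁻¹ := by
  have h0 := τ.ne_zero
  rw [coe_S_smul, rootS, rootS, ← Complex.inv_cpow]
  · congr 1
    rw [mul_inv, inv_neg, Complex.inv_I]
    ring
  · rw [Ne, Complex.arg_eq_pi_iff]
    have : 0 < τ.im := τ.im_pos
    simp only [Complex.mul_re, Complex.neg_re, Complex.neg_im, Complex.I_re, Complex.I_im,
      UpperHalfPlane.coe_im, not_and]
    intro h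
    linarith

/-- The n-th powers of the square root coming from the theta functions and from the weight shift
cancel; the rank survives only as a power of an eighth root of unity. -/
theorem inversion_factor (κ : ℤ) (n : ℕ) (τ : ℍ) :
    (rootS (ModularGroup.S • τ : ℍ) ^ n)⁻¹ * (e (1 / 8) * rootS τ) ^ (-(κ + n)) =
      (e (1 / 8) * rootS τ) ^ (-κ) * e (1 / 8) ^ (-n : ℤ) := by
  have h1 := rootS_ne_zero τ
  have h2 := e_ne_zero (1 / 8)
  rw [rootS_S_smul, neg_add, zpow_add₀ (mul_ne_zero h2 h1), zpow_neg _ (n : ℤ), zpow_neg _ (n : ℤ),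
    zpow_natCast, zpow_natCast, mul_pow, inv_pow, inv_inv]
  have := pow_ne_zero n h1
  field_simp

namespace PosDefLattice

variable {L : Type*} [AddCommGroup L] [Module.Free ℤ L] [Module.Finite ℤ L] (Λ : PosDefLattice L)

/-- `discTheta` as a linear map in the coefficients. -/
def discThetaLin (ρ : Λ.shadow) (τ : ℍ) (z : ℂ ⊗[ℤ] L) : (Λ.Disc → ℂ) →ₗ[ℂ] ℂ where
  toFun b := Λ.discTheta ρ b τ z
  map_add' b b' := Λ.discTheta_add ρ b b' τ.im_pos z
  map_smul' t b := discTheta_smul ρ t b τ z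

/-- The function with given theta coefficients. -/
def ofVector (ρ : Λ.shadow) : (ℍ → Λ.Disc → ℂ) →ₗ[ℂ] (ℍ → ℂ ⊗[ℤ] L → ℂ) where
  toFun F τ z := Λ.discTheta ρ (F τ) τ z
  map_add' F F' := funext fun τ => funext fun z => Λ.discTheta_add ρ (F τ) (F' τ) τ.im_pos z
  map_smul' t F := funext fun τ => funext fun z => discTheta_smul ρ t (F τ) τ z

theorem discThetaLin_injective (ρ : Λ.shadow) (τ : ℍ) {b b' : Λ.Disc → ℂ}
    (h : ∀ z, Λ.discTheta ρ b τ z = Λ.discTheta ρ b' τ z) : b = b' := by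
  rw [← sub_eq_zero]
  refine Λ.discTheta_injective ρ τ.im_pos _ fun z => ?_
  change Λ.discThetaLin ρ τ z (b - b') = 0
  rw [map_sub, sub_eq_zero]
  exact h z

theorem ofVector_injective (ρ : Λ.shadow) : Function.Injective (Λ.ofVector ρ) := fun _ _ h =>
  funext fun τ => Λ.discThetaLin_injective ρ τ fun z => congrFun (congrFun h τ) z

/-- The space of theta vectors. -/
def thetaVectors (ρ : Λ.shadow) (κ h : ℤ) : Submodule ℂ (ℍ → Λ.Disc → ℂ) :=
  (JacobiForms κ Λ h).comap (Λ.ofVector ρ)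

variable {Λ} in
-- The preimage of the Jacobi forms is a subspace by construction; this intrinsic description of it
-- is the one that can be carried along σ.
theorem mem_thetaVectors_iff {C : ℝ} (hC : Λ.IsInversionConst C) (ρ : Λ.shadow) (κ h : ℤ)
    (F : ℍ → Λ.Disc → ℂ) : F ∈ Λ.thetaVectors ρ κ h ↔ Λ.IsThetaVector ρ C κ h F := by
  constructor
  · intro hF
    obtain ⟨F', hF', h⟩ := exists_isThetaVector hC ρ hF
    rwa [Λ.ofVector_injective ρ (show Λ.ofVector ρ F = Λ.ofVector ρ F' from h)]
  · exact fun hF => hF.mem_jacobiForms hC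

/-- Jacobi forms correspond to theta vectors. -/
def vectorEquiv {C : ℝ} (hC : Λ.IsInversionConst C) (ρ : Λ.shadow) (κ h : ℤ) :
    Λ.thetaVectors ρ κ h ≃ₗ[ℂ] JacobiForms κ Λ h :=
  LinearEquiv.ofBijective ((Λ.ofVector ρ).restrict fun _ hF => hF) (by
    constructor
    · intro F F' h
      exact Subtype.ext (Λ.ofVector_injective ρ (congrArg Subtype.val h))
    · rintro ⟨φ, hφ⟩
      obtain ⟨F, hF, h⟩ := exists_isThetaVector hC ρ hφ
      exact ⟨⟨F, (mem_thetaVectors_iff hC ρ κ _ F).2 hF⟩, Subtype.ext h.symm⟩)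

theorem vectorEquiv_apply {C : ℝ} (hC : Λ.IsInversionConst C) (ρ : Λ.shadow) (κ h : ℤ)
    (F : Λ.thetaVectors ρ κ h) (τ : ℍ) (z : ℂ ⊗[ℤ] L) :
    (Λ.vectorEquiv hC ρ κ h F).1 τ z = Λ.discTheta ρ (F.1 τ) τ z := rfl

theorem sum_theta_eq (ρ : Λ.shadow) {m : ℕ} (t : Fin m → ℂ) (b : Fin m → Λ.Disc → ℂ) (τ : ℍ)
    (z : ℂ ⊗[ℤ] L) : ∑ i, t i * Λ.theta (Λ.coeffEquiv ρ (b i)) τ z =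
      Λ.discTheta ρ (∑ i, t i • b i) τ z := by
  change _ = Λ.discThetaLin ρ τ z _
  rw [map_sum]
  refine Finset.sum_congr rfl fun i _ => ?_
  rw [map_smul, theta_coeffEquiv]
  rfl

end PosDefLattice

/-! ### Transport along the isomorphism of bilinear modules -/

section Compare

variable {L₁ L₂ : Type*} [AddCommGroup L₁] [AddCommGroup L₂]
  {Λ₁ : PosDefLattice L₁} {Λ₂ : PosDefLattice L₂}
  {σ : Λ₁.Disc ≃+ Λ₂.Disc} {ρ₁ : Λ₁.shadow} {ρ₂ : Λ₂.shadow} {c : ℚ}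

/-- The congruence β(y, y) ≡ β(x, x) mod ℤ determines β(y) only modulo ½ℤ, whence the signs in the
relation between T and σ. -/
theorem FormCompat.exists_sign (hσ : FormCompat σ) {x : Λ₁.dual} {y : Λ₂.dual}
    (h : σ (Λ₁.toDisc x) = Λ₂.toDisc y) :
    ∃ u : ℤˣ, e (Λ₂.quadQ (y : ℚ ⊗[ℤ] L₂)) = ((u : ℤ) : ℂ) * e (Λ₁.quadQ (x : ℚ ⊗[ℤ] L₁)) := by
  obtain ⟨m, hm⟩ := hσ.formQ h h
  have hq : Λ₂.quadQ (y : ℚ ⊗[ℤ] L₂) = m / 2 + Λ₁.quadQ (x : ℚ ⊗[ℤ] L₁) := by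
    rw [PosDefLattice.quadQ, hm, PosDefLattice.quadQ]
    ring
  have h2 : e (m / 2) * e (m / 2) = 1 := by
    rw [← e_add, add_halves, e_int]
  rw [hq]
  push_cast
  rw [e_add]
  rcases mul_self_eq_one_iff.1 h2 with h3 | h3
  · exact ⟨1, by simp [h3]⟩
  · exact ⟨-1, by simp [h3]⟩

/-- The isomorphism of the spaces `W` given by `σ` and a choice of elements of the shadows. -/
def transport (σ : Λ₁.Disc ≃+ Λ₂.Disc) (ρ₁ : Λ₁.shadow) (ρ₂ : Λ₂.shadow) : Λ₁.W ≃ₗ[ℂ] Λ₂.W :=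
  (Λ₁.coeffEquiv ρ₁).symm.trans
    ((LinearEquiv.funCongrLeft ℂ ℂ σ.symm.toEquiv).trans (Λ₂.coeffEquiv ρ₂))

theorem transport_coeffEquiv (b : Λ₁.Disc → ℂ) :
    transport σ ρ₁ ρ₂ (Λ₁.coeffEquiv ρ₁ b) = Λ₂.coeffEquiv ρ₂ fun d => b (σ.symm d) := by
  rw [transport, LinearEquiv.trans_apply, LinearEquiv.symm_apply_apply]
  rfl

/-- The map s sends ρ₁ + x to ρ₂ + y for a chosen representative y of the image class; the sign
compares the normalising factors e(β(x)) and e(β(y)). -/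
theorem liesOver_transport (hσ : FormCompat σ) : LiesOver σ (transport σ ρ₁ ρ₂) := by
  let x : Λ₁.shadow → Λ₁.dual := (Λ₁.shadowEquiv ρ₁).symm
  let y : Λ₁.shadow → Λ₂.dual := fun r => Λ₂.rep (σ (Λ₁.toDisc (x r)))
  have hx : ∀ r, Λ₁.shadowAdd ρ₁ (x r) = r := (Λ₁.shadowEquiv ρ₁).apply_symm_apply
  have hy : ∀ r, σ (Λ₁.toDisc (x r)) = Λ₂.toDisc (y r) := fun r => (Λ₂.toDisc_rep _).symm
  choose u hu using fun r => hσ.exists_sign (hy r)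
  refine ⟨fun r => Λ₂.shadowAdd ρ₂ (y r), u, fun r r' t hr => ⟨y r' - y r, ?_, ?_⟩, fun a r => ?_⟩
  · change (ρ₂ : ℚ ⊗[ℤ] L₂) + y r' = ρ₂ + y r + (y r' - y r : Λ₂.dual)
    rw [AddSubgroup.coe_sub]
    abel
  · rw [map_sub, ← hy, ← hy, ← map_sub, ← map_sub]
    congr 2
    refine Subtype.ext ?_
    have h1 : (ρ₁ : ℚ ⊗[ℤ] L₁) + x r = r := congrArg Subtype.val (hx r)
    have h2 : (ρ₁ : ℚ ⊗[ℤ] L₁) + x r' = r' := congrArg Subtype.val (hx r')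
    rw [AddSubgroup.coe_sub, ← add_right_inj (r : ℚ ⊗[ℤ] L₁), ← hr, ← h1, ← h2]
    abel
  · obtain ⟨b, rfl⟩ := (Λ₁.coeffEquiv ρ₁).surjective a
    rw [transport_coeffEquiv, PosDefLattice.coeffEquiv_shadowAdd, ← hy, AddEquiv.symm_apply_apply, hu]
    have h1 := Λ₁.coeffEquiv_shadowAdd ρ₁ b (x r)
    rw [hx] at h1
    rw [h1, mul_assoc]

/-- The shift of the character by 3n changes the exponent by 3n/24 = n/8, and the difference for the
two ranks cancels c mod ℤ. -/
theorem ShadowCompat.expo_eq (h : ShadowCompat σ ρ₁ ρ₂ c) {m : ℤ}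
    (hc : c = ((Module.finrank ℤ L₂ : ℚ) - Module.finrank ℤ L₁) / 8 + m) (k : ℤ) (d : Λ₁.Disc) :
    Λ₂.expo ρ₂ (k + 3 * Module.finrank ℤ L₂) (σ d) = Λ₁.expo ρ₁ (k + 3 * Module.finrank ℤ L₁) d := by
  obtain ⟨j, hj⟩ := h.rep d
  rw [PosDefLattice.expo, PosDefLattice.expo, Int.fract_eq_fract]
  refine ⟨-m - j, ?_⟩
  rw [hj, hc]
  push_cast
  ring

/-- Transport of theta vectors along `σ`. -/
def vectorTransport (σ : Λ₁.Disc ≃+ Λ₂.Disc) : (ℍ → Λ₁.Disc → ℂ) ≃ₗ[ℂ] (ℍ → Λ₂.Disc → ℂ) :=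
  LinearEquiv.piCongrRight fun _ => LinearEquiv.funCongrLeft ℂ ℂ σ.symm.toEquiv

theorem vectorTransport_apply (σ : Λ₁.Disc ≃+ Λ₂.Disc) (F : ℍ → Λ₁.Disc → ℂ) :
    vectorTransport σ F = fun τ d => F τ (σ.symm d) := rfl

variable [Module.Free ℤ L₁] [Module.Finite ℤ L₁] [Module.Free ℤ L₂] [Module.Finite ℤ L₂]

theorem ShadowCompat.kernelOp (h : ShadowCompat σ ρ₁ ρ₂ c) (hσ : FormCompat σ) (b : Λ₁.Disc → ℂ)
    (d : Λ₁.Disc) : Λ₂.kernelOp ρ₂ (-1) (fun d => b (σ.symm d)) (σ d) =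
      e (-2 * c) * Λ₁.kernelOp ρ₁ (-1) b d := by
  rw [PosDefLattice.kernelOp, PosDefLattice.kernelOp, ← Equiv.sum_comp σ.toEquiv, Finset.mul_sum]
  refine Finset.sum_congr rfl fun d' _ => ?_
  change b (σ.symm (σ d')) * Λ₂.kernel ρ₂ (-1) (σ d') (σ d) = _
  rw [AddEquiv.symm_apply_apply, h.kernel hσ]
  ring

/-- Compatible lattices have the same theta vectors. -/
theorem ShadowCompat.isThetaVector (h : ShadowCompat σ ρ₁ ρ₂ c) (hσ : FormCompat σ) {C₁ C₂ : ℝ}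
    (hC₁ : Λ₁.IsInversionConst C₁) (hC₂ : Λ₂.IsInversionConst C₂) {κ k : ℤ} {F : ℍ → Λ₁.Disc → ℂ}
    (hF : Λ₁.IsThetaVector ρ₁ C₁ (κ + Module.finrank ℤ L₁) (k + 3 * Module.finrank ℤ L₁) F) :
    Λ₂.IsThetaVector ρ₂ C₂ (κ + Module.finrank ℤ L₂) (k + 3 * Module.finrank ℤ L₂)
      fun τ d => F τ (σ.symm d) := by
  obtain ⟨rfl, m, hc⟩ := h.const_eq hC₁ hC₂
  have hω := e_ne_zero (1 / 8)
  refine ⟨fun d => ?_, fun τ => ?_, ?_⟩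
  · obtain ⟨a, ha⟩ := hF.expansion (σ.symm d)
    refine ⟨a, fun τ => ?_⟩
    have := h.expo_eq hc k (σ.symm d)
    rw [AddEquiv.apply_symm_apply] at this
    rw [this]
    exact ha τ
  · funext d
    obtain ⟨d, rfl⟩ := σ.surjective d
    have h1 := congrFun (hF.inversion τ) d
    have h2 := h.kernelOp hσ (F (ModularGroup.S • τ)) d
    simp only [Pi.smul_apply, smul_eq_mul] at h1 ⊢
    rw [h2, AddEquiv.symm_apply_apply]
    -- Exponents of e(1/8) in the inversion law: -n from the weight, 2n₁ - 2n₂ from the change of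
    -- kernel, and -(k + 3n) from the character. Both sides change by 3n₁ - 3n₂ between the two
    -- lattices.
    have hcw : e (-2 * c) =
        e (1 / 8) ^ (2 * Module.finrank ℤ L₁ - 2 * Module.finrank ℤ L₂ : ℤ) := by
      rw [← e_int_mul, ← e_add_int _ (2 * m), hc]
      congr 1
      push_cast
      ring
    have e1 : e (1 / 8) ^ (-Module.finrank ℤ L₂ : ℤ) *
        e (1 / 8) ^ (2 * Module.finrank ℤ L₁ - 2 * Module.finrank ℤ L₂ : ℤ) =
        e (1 / 8) ^ (3 * Module.finrank ℤ L₁ - 3 * Module.finrank ℤ L₂ : ℤ) *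
          e (1 / 8) ^ (-Module.finrank ℤ L₁ : ℤ) := by
      rw [← zpow_add₀ hω, ← zpow_add₀ hω]
      congr 1
      ring
    have e2 : e (1 / 8) ^ (-(k + 3 * Module.finrank ℤ L₂) : ℤ) =
        e (1 / 8) ^ (3 * Module.finrank ℤ L₁ - 3 * Module.finrank ℤ L₂ : ℤ) *
          e (1 / 8) ^ (-(k + 3 * Module.finrank ℤ L₁) : ℤ) := by
      rw [← zpow_add₀ hω]
      congr 1
      ring
    rw [mul_assoc (C₁ : ℂ), inversion_factor, e_neg, inv_zpow'] at h1 ⊢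
    rw [hcw, e2]
    linear_combination
      (C₁ * (e (1 / 8) * rootS τ) ^ (-κ) *
        Λ₁.kernelOp ρ₁ (-1) (F (ModularGroup.S • τ)) d) * e1 +
      e (1 / 8) ^ (3 * Module.finrank ℤ L₁ - 3 * Module.finrank ℤ L₂ : ℤ) * h1
  · rcases hF.parity with h0 | ⟨j, hj⟩
    · left
      funext τ d
      rw [h0]
      rfl
    · right
      -- Weight minus character is κ - k - 2n, whose parity does not depend on n.
      exact ⟨j + Module.finrank ℤ L₁ - Module.finrank ℤ L₂, by linarith⟩

theorem ShadowCompat.map_thetaVectors (h : ShadowCompat σ ρ₁ ρ₂ c) (hσ : FormCompat σ) {C₁ C₂ : ℝ}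
    (hC₁ : Λ₁.IsInversionConst C₁) (hC₂ : Λ₂.IsInversionConst C₂) (κ k : ℤ) :
    (Λ₁.thetaVectors ρ₁ (κ + Module.finrank ℤ L₁) (k + 3 * Module.finrank ℤ L₁)).map
        (vectorTransport σ).toLinearMap =
      Λ₂.thetaVectors ρ₂ (κ + Module.finrank ℤ L₂) (k + 3 * Module.finrank ℤ L₂) := by
  ext F
  rw [Submodule.mem_map, PosDefLattice.mem_thetaVectors_iff hC₂]
  constructor
  · rintro ⟨F, hF, rfl⟩
    exact h.isThetaVector hσ hC₁ hC₂ ((PosDefLattice.mem_thetaVectors_iff hC₁ _ _ _ _).1 hF)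
  · intro hF
    refine ⟨fun τ d => F τ (σ d), ?_, ?_⟩
    · exact (PosDefLattice.mem_thetaVectors_iff hC₁ _ _ _ _).2
        (h.symm.isThetaVector hσ.symm hC₂ hC₁ hF)
    · funext τ d
      exact congrArg (F τ) (σ.apply_symm_apply d)

/-- The isomorphism of spaces of Jacobi forms given by `σ`. -/
def jacobiTransport (h : ShadowCompat σ ρ₁ ρ₂ c) (hσ : FormCompat σ) {C₁ C₂ : ℝ}
    (hC₁ : Λ₁.IsInversionConst C₁) (hC₂ : Λ₂.IsInversionConst C₂) (κ k : ℤ) :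
    JacobiForms (κ + Module.finrank ℤ L₁) Λ₁ (k + 3 * Module.finrank ℤ L₁) ≃ₗ[ℂ]
      JacobiForms (κ + Module.finrank ℤ L₂) Λ₂ (k + 3 * Module.finrank ℤ L₂) :=
  (Λ₁.vectorEquiv hC₁ ρ₁ _ _).symm.trans
    (((vectorTransport σ).ofSubmodules _ _ (h.map_thetaVectors hσ hC₁ hC₂ κ k)).trans
      (Λ₂.vectorEquiv hC₂ ρ₂ _ _))

theorem inducedByTheta_jacobiTransport (h : ShadowCompat σ ρ₁ ρ₂ c) (hσ : FormCompat σ)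
    {C₁ C₂ : ℝ} (hC₁ : Λ₁.IsInversionConst C₁) (hC₂ : Λ₂.IsInversionConst C₂) (κ k : ℤ) :
    InducedByTheta (transport σ ρ₁ ρ₂) (jacobiTransport h hσ hC₁ hC₂ κ k) := by
  classical
  intro φ
  obtain ⟨F, rfl⟩ := (Λ₁.vectorEquiv hC₁ ρ₁ _ _).surjective φ
  have hF := (PosDefLattice.mem_thetaVectors_iff hC₁ _ _ _ _).1 F.2
  refine ⟨⟨Fintype.card Λ₁.Disc, fun i τ => F.1 τ ((Fintype.equivFin _).symm i),
    fun i => Λ₁.coeffEquiv ρ₁ (Pi.single ((Fintype.equivFin _).symm i) 1),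
    fun i => hF.mdifferentiable _, fun τ z => ?_⟩, fun m f a ha τ z => ?_⟩
  · rw [PosDefLattice.vectorEquiv_apply, Λ₁.discTheta_eq_sum_single ρ₁ _ τ.im_pos,
      ← (Fintype.equivFin Λ₁.Disc).symm.sum_comp]
    simp only [PosDefLattice.theta_coeffEquiv]
  · obtain ⟨b, rfl⟩ : ∃ b : Fin m → Λ₁.Disc → ℂ, a = fun i => Λ₁.coeffEquiv ρ₁ (b i) :=
      ⟨fun i => (Λ₁.coeffEquiv ρ₁).symm (a i), by
        funext i
        rw [LinearEquiv.apply_symm_apply]⟩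
    -- Linear independence at each fixed τ determines the coefficient vector, so the expansion may
    -- be chosen arbitrarily and no regularity of the `f i` is needed.
    have hFτ : F.1 τ = ∑ i, f i τ • b i :=
      Λ₁.discThetaLin_injective ρ₁ τ fun z => by
        rw [← Λ₁.sum_theta_eq ρ₁, ← ha τ z, PosDefLattice.vectorEquiv_apply]
    simp only [transport_coeffEquiv]
    rw [Λ₂.sum_theta_eq ρ₂, jacobiTransport, LinearEquiv.trans_apply, LinearEquiv.trans_apply,
      LinearEquiv.symm_apply_apply, PosDefLattice.vectorEquiv_apply, LinearEquiv.ofSubmodules_apply,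
      vectorTransport_apply]
    congr 1
    funext d
    beta_reduce
    rw [hFτ]
    simp only [Finset.sum_apply, Pi.smul_apply]

end Compare

end JacobiLattice

end

open JacobiLattice in
theorem theorem2p7 {L₁ L₂ : Type*} [AddCommGroup L₁] [Module.Free ℤ L₁] [Module.Finite ℤ L₁]
    [AddCommGroup L₂] [Module.Free ℤ L₂] [Module.Finite ℤ L₂]
    (Λ₁ : PosDefLattice L₁) (Λ₂ : PosDefLattice L₂) (n₁ n₂ : ℕ)
    (hn₁ : Module.finrank ℤ L₁ = n₁) (hn₂ : Module.finrank ℤ L₂ = n₂)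
    (σ : Λ₁.Disc ≃+ Λ₂.Disc)
    (hσ : ∀ x y, Λ₂.discForm (σ x) (σ y) = Λ₁.discForm x y) :
    ∃ T : Λ₁.W ≃ₗ[ℂ] Λ₂.W, LiesOver σ T ∧
      ∀ κ h : ℤ, ∃ Φ : JacobiForms (κ + n₁) Λ₁ (h + 3 * n₁) ≃ₗ[ℂ]
        JacobiForms (κ + n₂) Λ₂ (h + 3 * n₂), InducedByTheta T Φ := by
  subst hn₁ hn₂
  obtain ⟨ρ₁⟩ := Λ₁.shadow_nonempty
  obtain ⟨ρ₂, c, h⟩ := exists_shadowCompat (σ := σ) hσ ρ₁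
  obtain ⟨C₁, hC₁⟩ := Λ₁.exists_tsum_term_inversion
  obtain ⟨C₂, hC₂⟩ := Λ₂.exists_tsum_term_inversion
  exact ⟨transport σ ρ₁ ρ₂, liesOver_transport hσ, fun κ k =>
    ⟨jacobiTransport h hσ hC₁ hC₂ κ k, inducedByTheta_jacobiTransport h hσ hC₁ hC₂ κ k⟩⟩
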